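/- Let $n\ge 1$ be an integer, $C_0\in\{1,-1\}$ and $C_{2n}\in\{1,0,-1\}$. **Setting.** For $C\in\{1,0,-1\}$ let $M_C$ be the sphere, the plane or the unit disc, respectively, with coordinate $z$, complex co-frame $e=\frac{2\,dz}{1+C|z|^2}$ and curvature $C$. Let $\mathbb H^1_C=\{(z_1,z_2)\in\mathbb C^2:\ |z_1|^2+C|z_2|^2=1\}$, identified with the group of matrices $h=\begin{pmatrix}z_1&-C\bar z_2\\ z_2&\bar z_1\end{pmatrix}$, with projection $\pi:\mathbb H^1_C\to M_C$, $h\mapsto z=z_2/z_1$, and left-invariant forms $$\sigma=\sigma^1+i\sigma^2=2i(z_1dz_2-z_2dz_1),\qquad \sigma^0=i(\bar z_1dz_1+C\bar z_2dz_2-z_1d\bar z_1-Cz_2d\bar z_2),$$ so that $h^{-1}dh=\sigma^0t_0+\sigma^1t_1+\sigma^2t_2$ with $$t_0=-\tfrac i2\begin{pmatrix}1&0\\0&-1\end{pmatrix},\qquad t_1=-\tfrac i2\begin{pmatrix}0&C\\1&0\end{pmatrix},\qquad t_2=\tfrac12\begin{pmatrix}0&-C\\1&0\end{pmatrix}.$$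 Put $M_0=M_{C_0}$ and $M_{2n}=M_{C_{2n}}$, with co-frames $e_0,e_{2n}$. From now on $\sigma^a$ and $t_a$ are those of $\mathbb H^1_{C_0}$, and $\tau,\tau^0$ denote the forms $\sigma,\sigma^0$ of $\mathbb H^1_{C_{2n}}$. A holomorphic map $f:M_0\to M_{2n}$ *determines a vortex* if locally, in unitary co-frames, $f^*e_{2n}=\phi^n e_0$ with $\phi$ a smooth complex function. A *lift* of this vortex is a pair $(\Phi,A)$ of a smooth complex function and a smooth real one-form on $\mathbb H^1_{C_0}$ such that, for some smooth map $U:\mathbb H^1_{C_0}\to\mathbb H^1_{C_{2n}}$ with $\pi\circ U=f\circ\pi$, $$\Phi^n\sigma=U^*\tau,\qquad nA=U^*\tau^0-\sigma^0 .$$ An *$n$-vortex configuration* on $\mathbb H^1_{C_0}$ is a smooth pair $(\Phi,A)$ with $$(d\Phi+iA\Phi)\wedge\sigma=0,\qquad dA=-\frac i2\Big(\frac{C_0}{n}-\frac{C_{2n}}{n}|\Phi|^{2n}\Big)\bar\sigma\wedge\sigma .$$ Let $\mathbb R^3_{C_0}$ be $\mathbb R^3$ with the metric $\frac1{C_0}(dx^0)^2+(dx^1)^2+(dx^2)^2$,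 let $r^2=C_0(x^0)^2+(x^1)^2+(x^2)^2$, $\mathcal I=\{C_0r^2>-1\}$, $\Omega=\frac{1+C_0r^2}{2}$, and let $H,G:\mathcal I\to\mathbb H^1_{C_0}$ be $$G(x)=\frac{\mathbb I-2\sum_a x^at_a}{\sqrt{1+C_0r^2}},\qquad H=G^2,\quad\text{i.e. } z_1=\frac{1-C_0r^2+2ix^0}{1+C_0r^2},\ \ z_2=\frac{2i(x^1+ix^2)}{1+C_0r^2}.$$ The flat Dirac operator twisted by a real one-form $A$ on $\mathcal I$ is $D_A=\gamma^0(\partial_0+iA_0)+\gamma^1(\partial_1+iA_1)+\gamma^2(\partial_2+iA_2)$, with $\gamma^0=-2C_0t_0$, $\gamma^1=-2t_1$, $\gamma^2=-2t_2$. A *smooth vortex magnetic mode* on $\mathcal I$ is a smooth spinor $\Psi:\mathcal I\to\mathbb C^2$ and a smooth real one-form $A$ on $\mathcal I$ with $$D_A\Psi=0,\qquad dA=H^*\Big(-\frac{C_{2n}}{C_0n}\,4i\,|\hat\Psi|^{2n-2}\star\hat\Psi^\dagger h^{-1}dh\,\hat\Psi+C_0\Big(\frac1n-\frac34\Big)\sigma^1\wedge\sigma^2\Big),$$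 where $\hat\Psi=\Omega G^{-1}\Psi$ is the corresponding spinor in the left-invariant frame of the group (as a function on $\mathcal I$, so that $H^*$ acts only on the forms), and $\star$ is the Hodge star on $\mathbb H^1_{C_0}$ of the metric $\frac14\big(\frac1{C_0}(\sigma^0)^2+(\sigma^1)^2+(\sigma^2)^2\big)$ with orientation $\sigma^0\wedge\sigma^1\wedge\sigma^2$. **Statement.** Let $f:M_0\to M_{2n}$ be a holomorphic map which determines a vortex. Then the vortex has a lift $(\Phi,A)$. Moreover, every lift $(\Phi,A)$ is an $n$-vortex configuration on $\mathbb H^1_{C_0}$, and $$\Psi_H=\Omega^{-1}G\begin{pmatrix}H^*\Phi\\0\end{pmatrix},\qquad A'=H^*\Big(A+\frac34\sigma^0\Big)$$ is a smooth vortex magnetic mode on $\mathcal I\subset\mathbb R^3_{C_0}$. -/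

import Mathlib

open scoped ContDiff ComplexConjugate

noncomputable section

namespace Vortex

/-! ### The group manifolds and the Riemann surfaces -/

/-- The quadratic form `|z₁|² + C |z₂|²` on `ℂ²`. -/
def form (C : ℝ) (z : ℂ × ℂ) : ℝ := ‖z.1‖ ^ 2 + C * ‖z.2‖ ^ 2

/-- The cone `|z₁|² + C |z₂|² > 0`, an open neighbourhood of the group manifold in `ℂ²`. Smooth
functions, maps and forms on the group manifold are represented by smooth ones on this
neighbourhood (every smooth object on the group extends to it); all equations are only imposed at
points of the group and on vectors tangent to it, so they do not depend on the extension. -/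
def cone (C : ℝ) : Set (ℂ × ℂ) := {z | 0 < form C z}

/-- The group manifold `{(z₁, z₂) : |z₁|² + C |z₂|² = 1}`, i.e. `SU(2)`, `SE₂`, `SU(1,1)` for
`C = 1, 0, -1`; the pair `(z₁, z₂)` stands for the matrix `groupMatrix C (z₁, z₂)`. -/
def group (C : ℝ) : Set (ℂ × ℂ) := {z | form C z = 1}

theorem group_subset_cone (C : ℝ) : group C ⊆ cone C := by
  intro z hz
  have h : form C z = 1 := hz
  show 0 < form C z
  rw [h]
  exact one_pos

/-- The matrix of a group element. -/
def groupMatrix (C : ℝ) (z : ℂ × ℂ) : Matrix (Fin 2) (Fin 2) ℂ :=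
  !![z.1, -(C : ℂ) * conj z.2; z.2, conj z.1]

/-- The tangent space of the group manifold at `h`: the kernel of the differential of `form C`. -/
def tangent (C : ℝ) (h : ℂ × ℂ) : Set (ℂ × ℂ) :=
  {v | (conj h.1 * v.1 + (C : ℂ) * conj h.2 * v.2).re = 0}

theorem ne_zero_of_mem_cone {C : ℝ} {z : ℂ × ℂ} (hz : z ∈ cone C) : z ≠ 0 := by
  rintro rfl
  have h : 0 < form C 0 := hz
  simp [form] at h

theorem form_smul (C : ℝ) (a : ℂ) (z : ℂ × ℂ) : form C (a • z) = ‖a‖ ^ 2 * form C z := by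
  simp only [form, Prod.smul_fst, Prod.smul_snd, smul_eq_mul, norm_mul]
  ring

/-- The Riemann surface `M_C` of curvature `C`, with coordinate `z = z₂ / z₁`, as an open subset of
the projective line: the sphere for `C = 1`, the plane for `C = 0`, the unit disc for `C = -1`. -/
def Surface (C : ℝ) : Type := {p : Projectivization ℂ (ℂ × ℂ) // p.rep ∈ cone C}

/-- The point `[z₁ : z₂]` of `M_C`. Restricted to the group manifold this is the Hopf
projection `h ↦ z₂ / z₁`. -/
def proj (C : ℝ) (z : ℂ × ℂ) (hz : z ∈ cone C) : Surface C :=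
  ⟨Projectivization.mk ℂ z (ne_zero_of_mem_cone hz), by
    obtain ⟨a, ha⟩ := Projectivization.exists_smul_eq_mk_rep ℂ z (ne_zero_of_mem_cone hz)
    show 0 < form C _
    rw [← ha, Units.smul_def, form_smul]
    have h : 0 < form C z := hz
    have : 0 < ‖(a : ℂ)‖ := norm_pos_iff.mpr a.ne_zero
    positivity⟩

/-- `s₁ s₂' - s₂ s₁'` for a curve `s` in `ℂ²`. -/
def wronskian (s : ℂ → ℂ × ℂ) (ζ : ℂ) : ℂ :=
  (s ζ).1 * deriv (fun ξ => (s ξ).2) ζ - (s ζ).2 * deriv (fun ξ => (s ξ).1) ζ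

/-- The coefficient of `dζ` in the complex co-frame of `M_C` pulled back by the holomorphic map
`ζ ↦ [s₁(ζ) : s₂(ζ)]`, in the unitary frame given by the local lift `s`.
For `s(ζ) = (1, ζ)` it is the coefficient `2 / (1 + C |ζ|²)` of `e = 2 dz / (1 + C |z|²)`. -/
def coframe (C : ℝ) (s : ℂ → ℂ × ℂ) (ζ : ℂ) : ℂ := 2 * wronskian s ζ / (form C (s ζ) : ℂ)

/-- `ζ ↦ [s(ζ)]` is a holomorphic coordinate of `M_{C₀}` centred at `p`, and in this coordinate `f`
is the holomorphic map `ζ ↦ [F(ζ)]`. -/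
structure LocalRep {C₀ C₂ : ℝ} (f : Surface C₀ → Surface C₂) (p : Surface C₀)
    (s F : ℂ → ℂ × ℂ) : Prop where
  analytic_s : AnalyticAt ℂ s 0
  analytic_F : AnalyticAt ℂ F 0
  centre : ∃ h : s 0 ∈ cone C₀, proj C₀ (s 0) h = p
  immersive : wronskian s 0 ≠ 0
  represents : ∀ᶠ ζ in nhds (0 : ℂ), ∃ (hs : s ζ ∈ cone C₀) (hF : F ζ ∈ cone C₂),
    f (proj C₀ (s ζ) hs) = proj C₂ (F ζ) hF

/-- `f : M_{C₀} → M_{C₂}` is holomorphic. -/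
def IsHolomorphicMap {C₀ C₂ : ℝ} (f : Surface C₀ → Surface C₂) : Prop :=
  ∀ p, ∃ s F, LocalRep f p s F

/-- `f` determines an `n`-vortex: locally, `f^* e_{2n} = φⁿ e₀` for a smooth complex function `φ`.
(A change of local lifts multiplies the co-frames by smooth phases, which is absorbed by a local
gauge transformation of `φ`.) -/
def DeterminesVortex (n : ℕ) {C₀ C₂ : ℝ} (f : Surface C₀ → Surface C₂) : Prop :=
  ∀ p s F, LocalRep f p s F → ∃ φ : ℂ → ℂ, ∀ᶠ ζ in nhds (0 : ℂ),
    ContDiffAt ℝ ∞ φ ζ ∧ coframe C₂ F ζ = φ ζ ^ n * coframe C₀ s ζ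

/-! ### Differential forms -/

/-- The wedge product of two complex one-forms at a point. -/
def wedge {E : Type*} (α β : E → ℂ) (v w : E) : ℂ := α v * β w - α w * β v

/-- The exterior derivative of a real one-form. -/
def extD {E : Type*} [NormedAddCommGroup E] [NormedSpace ℝ E] (A : E → E →L[ℝ] ℝ)
    (x v w : E) : ℝ := fderiv ℝ A x v w - fderiv ℝ A x w v

/-- The left-invariant form `σ⁰ = i (z̄₁ dz₁ + C z̄₂ dz₂ - z₁ dz̄₁ - C z₂ dz̄₂)`, which is real. -/
def sigma0 (C : ℝ) (z : ℂ × ℂ) : ℂ × ℂ →L[ℝ] ℝ :=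
  (-2 : ℝ) • Complex.imCLM.comp
    ((conj z.1 • ContinuousLinearMap.fst ℂ ℂ ℂ +
      ((C : ℂ) * conj z.2) • ContinuousLinearMap.snd ℂ ℂ ℂ).restrictScalars ℝ)

theorem sigma0_eq (C : ℝ) (z v : ℂ × ℂ) : (sigma0 C z v : ℂ) =
    Complex.I * (conj z.1 * v.1 + C * conj z.2 * v.2 - z.1 * conj v.1 - C * z.2 * conj v.2) := by
  apply Complex.ext
  · simp [sigma0]
    ring
  · simp [sigma0]

/-- The left-invariant form `σ = σ¹ + i σ² = 2 i (z₁ dz₂ - z₂ dz₁)`. -/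
def sigma (z v : ℂ × ℂ) : ℂ := 2 * Complex.I * (z.1 * v.2 - z.2 * v.1)

/-- The real left-invariant forms `σ⁰, σ¹, σ²`, as complex valued forms. -/
def sigmaC (C : ℝ) (z : ℂ × ℂ) : Fin 3 → (ℂ × ℂ → ℂ) :=
  ![fun v => (sigma0 C z v : ℂ), fun v => ((sigma z v).re : ℂ), fun v => ((sigma z v).im : ℂ)]

/-! ### Lifts of vortices and vortex configurations -/

/-- `(Φ, A)` is an `n`-vortex configuration on the group manifold of `C₀`:
`(dΦ + i A Φ) ∧ σ = 0` and `dA = -(i/2) (C₀/n - (C₂/n) |Φ|²ⁿ) σ̄ ∧ σ`. -/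
structure IsVortexConfiguration (n : ℕ) (C₀ C₂ : ℝ) (Φ : ℂ × ℂ → ℂ)
    (A : ℂ × ℂ → ℂ × ℂ →L[ℝ] ℝ) : Prop where
  smooth_field : ContDiffOn ℝ ∞ Φ (cone C₀)
  smooth_form : ContDiffOn ℝ ∞ A (cone C₀)
  selfdual : ∀ h ∈ group C₀, ∀ v ∈ tangent C₀ h, ∀ w ∈ tangent C₀ h,
    wedge (fun u => fderiv ℝ Φ h u + Complex.I * (A h u : ℂ) * Φ h) (sigma h) v w = 0
  curvature : ∀ h ∈ group C₀, ∀ v ∈ tangent C₀ h, ∀ w ∈ tangent C₀ h,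
    (extD A h v w : ℂ) = -(Complex.I / 2) *
      ((C₀ : ℂ) / n - (C₂ : ℂ) / n * (‖Φ h‖ : ℂ) ^ (2 * n)) *
        wedge (fun u => conj (sigma h u)) (sigma h) v w

/-- `(Φ, A)` is a lift of the vortex determined by `f`, through the smooth bundle map `U` between
group manifolds which covers `f` (that is `π ∘ U = f ∘ π`):
`Φⁿ σ = U^* τ` and `n A = U^* τ⁰ - σ⁰`, where `τ, τ⁰` are the left-invariant forms of the target. -/
structure IsLift (n : ℕ) {C₀ C₂ : ℝ} (f : Surface C₀ → Surface C₂) (U : ℂ × ℂ → ℂ × ℂ)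
    (Φ : ℂ × ℂ → ℂ) (A : ℂ × ℂ → ℂ × ℂ →L[ℝ] ℝ) : Prop where
  smooth_map : ContDiffOn ℝ ∞ U (cone C₀)
  smooth_field : ContDiffOn ℝ ∞ Φ (cone C₀)
  smooth_form : ContDiffOn ℝ ∞ A (cone C₀)
  covers : ∀ (h : ℂ × ℂ) (hh : h ∈ group C₀), ∃ hU : U h ∈ group C₂,
    proj C₂ (U h) (group_subset_cone C₂ hU) = f (proj C₀ h (group_subset_cone C₀ hh))
  field_eq : ∀ h ∈ group C₀, ∀ v ∈ tangent C₀ h,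
    Φ h ^ n * sigma h v = sigma (U h) (fderiv ℝ U h v)
  form_eq : ∀ h ∈ group C₀, ∀ v ∈ tangent C₀ h,
    n * A h v = sigma0 C₂ (U h) (fderiv ℝ U h v) - sigma0 C₀ h v

/-! ### The space `ℝ³_{C₀}`, the maps `H` and `G`, and vortex magnetic modes -/

/-- The generators `t₀, t₁, t₂`, with `[t₀,t₁] = t₂`, `[t₀,t₂] = -t₁`, `[t₁,t₂] = C t₀`. -/
def gen (C : ℝ) : Fin 3 → Matrix (Fin 2) (Fin 2) ℂ :=
  ![!![-(Complex.I / 2), 0; 0, Complex.I / 2],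
    !![0, -(Complex.I / 2) * C; -(Complex.I / 2), 0],
    !![0, -((C : ℂ) / 2); 1 / 2, 0]]

/-- The Maurer-Cartan form: `h⁻¹ dh = σ⁰ t₀ + σ¹ t₁ + σ² t₂` on the group manifold. -/
theorem maurerCartan (C : ℝ) (h v : ℂ × ℂ) (hh : h ∈ group C) (hv : v ∈ tangent C h) :
    (groupMatrix C h)⁻¹ * groupMatrix C v = ∑ a, sigmaC C h a v • gen C a := by
  have h1 : h.1.re * h.1.re + h.1.im * h.1.im + C * (h.2.re * h.2.re + h.2.im * h.2.im) = 1 := by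
    have := hh
    simp only [group, form, Set.mem_ofPred_eq, ← Complex.normSq_eq_norm_sq,
      Complex.normSq_apply] at this
    exact this
  have hdet : (groupMatrix C h).det = 1 := by
    rw [groupMatrix, Matrix.det_fin_two_of]
    apply Complex.ext
    · simp; linarith
    · simp; ring
  have h2 : (conj h.1 * v.1 + (C : ℂ) * conj h.2 * v.2).re = 0 := hv
  simp at h2
  rw [Matrix.inv_def, hdet, Ring.inverse_one, one_smul, groupMatrix, Matrix.adjugate_fin_two_of,
    groupMatrix, Fin.sum_univ_three]
  ext i j
  fin_cases i <;> fin_cases j <;> apply Complex.ext <;>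
    simp [sigmaC, gen, sigma0, sigma] <;> linarith

/-- Diagonal of the metric `(1/C₀) (dx⁰)² + (dx¹)² + (dx²)²`, `C₀ = ±1`, and of its inverse. -/
def eta (C₀ : ℝ) : Fin 3 → ℝ := ![C₀, 1, 1]

/-- `r² = C₀ (x⁰)² + (x¹)² + (x²)²`. -/
def rsq (C₀ : ℝ) (x : Fin 3 → ℝ) : ℝ := C₀ * x 0 ^ 2 + x 1 ^ 2 + x 2 ^ 2

/-- The region `C₀ r² > -1`. -/
def region (C₀ : ℝ) : Set (Fin 3 → ℝ) := {x | -1 < C₀ * rsq C₀ x}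

/-- The inverse stereographic map `H`, given by the first column `(z₁, z₂)` of the matrix. -/
def stereo (C₀ : ℝ) (x : Fin 3 → ℝ) : ℂ × ℂ :=
  ((1 - C₀ * rsq C₀ x + 2 * Complex.I * x 0) / (1 + C₀ * rsq C₀ x),
    2 * Complex.I * (x 1 + Complex.I * x 2) / (1 + C₀ * rsq C₀ x))

/-- The inverse gnomonic map `G(x) = (1 - 2 x·t) / √(1 + C₀ r²)`. -/
def gnomonic (C₀ : ℝ) (x : Fin 3 → ℝ) : Matrix (Fin 2) (Fin 2) ℂ :=
  ((Real.sqrt (1 + C₀ * rsq C₀ x) : ℂ)⁻¹) •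
    ((1 : Matrix (Fin 2) (Fin 2) ℂ) - (2 : ℂ) • ∑ a, (x a : ℂ) • gen C₀ a)

/-- `H = G²` on the region. -/
theorem gnomonic_sq (C₀ : ℝ) (hC₀ : C₀ * C₀ = 1) (x : Fin 3 → ℝ) (hx : x ∈ region C₀) :
    gnomonic C₀ x * gnomonic C₀ x = groupMatrix C₀ (stereo C₀ x) := by
  have hx' : 0 < 1 + C₀ * rsq C₀ x := by
    have : -1 < C₀ * rsq C₀ x := hx
    linarith
  have hs : ((Real.sqrt (1 + C₀ * rsq C₀ x) : ℂ)⁻¹) * ((Real.sqrt (1 + C₀ * rsq C₀ x) : ℂ)⁻¹) =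
      (1 + C₀ * rsq C₀ x : ℂ)⁻¹ := by
    rw [← mul_inv, ← Complex.ofReal_mul, Real.mul_self_sqrt hx'.le]
    push_cast
    rfl
  have hne : (1 + C₀ * rsq C₀ x : ℂ) ≠ 0 := by exact_mod_cast hx'.ne'
  have hC : (C₀ : ℂ) * C₀ = 1 := by exact_mod_cast hC₀
  have hr : (rsq C₀ x : ℂ) = C₀ * x 0 ^ 2 + x 1 ^ 2 + x 2 ^ 2 := by simp [rsq]
  rw [gnomonic, smul_mul_smul_comm, hs, Fin.sum_univ_three]
  ext i j
  have hI : Complex.I ^ 2 = -1 := Complex.I_sq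
  have h2 : conj (2 : ℂ) = 2 := map_ofNat _ 2
  fin_cases i <;> fin_cases j <;>
    simp [gen, groupMatrix, stereo, Matrix.mul_apply, Fin.sum_univ_two, h2] <;>
    field_simp
  · rw [hr]
    linear_combination (C₀ * x 1 ^ 2 + x 0 ^ 2 : ℂ) * hI + (x 0 ^ 2 : ℂ) * hC
  · linear_combination (2 * C₀ * x 2 : ℂ) * hI
  · linear_combination (-2 * x 2 : ℂ) * hI
  · rw [hr]
    linear_combination (C₀ * x 1 ^ 2 + x 0 ^ 2 : ℂ) * hI + (x 0 ^ 2 : ℂ) * hC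

/-- The conformal factor `Ω = (1 + C₀ r²) / 2`: the group metric
`(1/4) ((1/C₀) (σ⁰)² + (σ¹)² + (σ²)²)` pulls back under `H` to `Ω⁻²` times the flat metric. -/
def conformal (C₀ : ℝ) (x : Fin 3 → ℝ) : ℝ := (1 + C₀ * rsq C₀ x) / 2

/-- The pull-back of a one-form by `H`. -/
def pullH (C₀ : ℝ) (A : ℂ × ℂ → ℂ × ℂ →L[ℝ] ℝ) (x : Fin 3 → ℝ) : (Fin 3 → ℝ) →L[ℝ] ℝ :=
  (A (stereo C₀ x)).comp (fderiv ℝ (stereo C₀) x)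

/-- The flat Dirac operator `∑ₐ γᵃ (∂ₐ + i Aₐ)` of `ℝ³_{C₀}` twisted by the `U(1)` gauge field `A`,
with the Clifford matrices `γₐ = -2 tₐ`, whose index is raised by the metric. -/
def dirac (C₀ : ℝ) (A : (Fin 3 → ℝ) → (Fin 3 → ℝ) →L[ℝ] ℝ) (Ψ : (Fin 3 → ℝ) → Fin 2 → ℂ)
    (x : Fin 3 → ℝ) : Fin 2 → ℂ :=
  ∑ a, (eta C₀ a : ℂ) • ((-2 : ℂ) • gen C₀ a).mulVec
    (fderiv ℝ Ψ x (Pi.single a 1) + (Complex.I * (A x (Pi.single a 1) : ℂ)) • Ψ x)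

/-- Hodge star, on the group manifold, of the one-form `∑ₐ αₐ σᵃ` at `h`. The metric is
`(1/4) ((1/C₀) (σ⁰)² + (σ¹)² + (σ²)²)`, `C₀ = ±1`, with orientation `σ⁰ ∧ σ¹ ∧ σ²`, so that
`⋆σ⁰ = (C₀/2) σ¹ ∧ σ²`, `⋆σ¹ = (1/2) σ² ∧ σ⁰`, `⋆σ² = (1/2) σ⁰ ∧ σ¹`. -/
def star (C₀ : ℝ) (h : ℂ × ℂ) (α : Fin 3 → ℂ) (v w : ℂ × ℂ) : ℂ :=
  ∑ a, α a * ((eta C₀ a : ℂ) / 2) * wedge (sigmaC C₀ h (a + 1)) (sigmaC C₀ h (a + 2)) v w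

/-- The right hand side of the non-linear equation of a vortex magnetic mode, for a spinor with
value `ψ` at the point `h` of the group manifold, evaluated on tangent vectors `v, w`:
`-(C₂ / (C₀ n)) 4 i |ψ|²ⁿ⁻² ⋆ ψ† h⁻¹dh ψ + C₀ (1/n - 3/4) σ¹ ∧ σ²`, with `h⁻¹dh = ∑ₐ σᵃ tₐ`. -/
def modeSource (n : ℕ) (C₀ C₂ : ℝ) (h : ℂ × ℂ) (ψ : Fin 2 → ℂ) (v w : ℂ × ℂ) : ℂ :=
  -((C₂ : ℂ) / (C₀ * n)) * (4 * Complex.I) * ((‖ψ 0‖ ^ 2 + ‖ψ 1‖ ^ 2 : ℝ) : ℂ) ^ (n - 1) *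
      star C₀ h (fun a => dotProduct (fun i => conj (ψ i)) ((gen C₀ a).mulVec ψ)) v w
    + C₀ * (1 / (n : ℂ) - 3 / 4) * wedge (sigmaC C₀ h 1) (sigmaC C₀ h 2) v w

/-- A smooth vortex magnetic mode on the region of `ℝ³_{C₀}`: a smooth spinor `Ψ` and a smooth
one-form `A` such that `Ψ` is a zero-mode of the flat Dirac operator twisted by `A`, and `dA` is
the pull-back by `H` of the non-linear equation on the group manifold, where the spinor `Ψ`
corresponds to the spinor `Ω G⁻¹ Ψ` in the left-invariant frame of the group manifold. -/
structure IsVortexMagneticMode (n : ℕ) (C₀ C₂ : ℝ) (Ψ : (Fin 3 → ℝ) → Fin 2 → ℂ)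
    (A : (Fin 3 → ℝ) → (Fin 3 → ℝ) →L[ℝ] ℝ) : Prop where
  smooth_spinor : ContDiffOn ℝ ∞ Ψ (region C₀)
  smooth_form : ContDiffOn ℝ ∞ A (region C₀)
  zero_mode : ∀ x ∈ region C₀, dirac C₀ A Ψ x = 0
  curvature : ∀ x ∈ region C₀, ∀ v w : Fin 3 → ℝ,
    (extD A x v w : ℂ) = modeSource n C₀ C₂ (stereo C₀ x)
      ((conformal C₀ x : ℂ) • ((gnomonic C₀ x)⁻¹).mulVec (Ψ x))
      (fderiv ℝ (stereo C₀) x v) (fderiv ℝ (stereo C₀) x w)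

/-- The spinor `Ψ_H = Ω⁻¹ G (H^*Φ, 0)ᵀ`. -/
def spinorH (C₀ : ℝ) (Φ : ℂ × ℂ → ℂ) (x : Fin 3 → ℝ) : Fin 2 → ℂ :=
  ((conformal C₀ x : ℂ)⁻¹) • (gnomonic C₀ x).mulVec ![Φ (stereo C₀ x), 0]

/-- The gauge field `A' = H^*(A + (3/4) σ⁰)`. -/
def gaugeH (C₀ : ℝ) (A : ℂ × ℂ → ℂ × ℂ →L[ℝ] ℝ) : (Fin 3 → ℝ) → (Fin 3 → ℝ) →L[ℝ] ℝ :=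
  pullH C₀ (fun h => A h + (3 / 4 : ℝ) • sigma0 C₀ h)

end Vortex

end

/-!
The vortex equations and the equations of a magnetic mode follow from exterior calculus once there
is a lift; the existence of a lift is a statement about holomorphic functions.

*Lifts satisfy the equations.* Objects on a group manifold are represented on the cone around it,
and an equation between forms on tangent vectors of the group may be differentiated: a form which
vanishes on tangent vectors is pulled back to zero by the radial retraction onto the group, hence so
is its exterior derivative (`dForm_eq_zero_of_forall_tangent`). The structure equations
`dσ = -i σ⁰ ∧ σ` and `dσ⁰ = (iC/2) σ̄ ∧ σ` on both groups then turn `Φⁿ σ = U^* τ` and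
`n A = U^* τ⁰ - σ⁰` into `n Φⁿ⁻¹ (dΦ + iAΦ) ∧ σ = 0` and the curvature equation. The factor `Φⁿ⁻¹`
is cancelled by continuity (`IsLift.selfdual`).

*Vortex configurations give magnetic modes.* The first vortex equation says that `dΦ + iAΦ = μσ` for
some `μ`. With the explicit derivative of `H` the Dirac operator applied to `Ψ_H` is a combination
of `μ` and `Φ` whose coefficients vanish identically (`dirac_spinorH`). The curvature of `A'` is the
pull-back of `dA + 3/4 dσ⁰`, and for a spinor `(Φ, 0)` the source is the right multiple of
`σ¹ ∧ σ²`.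

*Existence of a lift.* It suffices to represent `f` by holomorphic homogeneous coordinates
`S = (P, Q)` on the cone such that the Wronskian of `S` is the `n`-th power of a holomorphic
function `g`: with `ρ = |P|² + C_{2n} |Q|²`, the pair `U = ρ^(-1/2) S`, `Φ = ρ^(-1/n) g` satisfies
`Φⁿ σ = U^* τ`, and `A` is defined by its equation (`exists_isLift_of_represents`). Locally the
co-frame condition `f^* e_{2n} = φⁿ e₀` says that the Wronskian is `φⁿ` times a nonvanishing
continuous function, so by a winding number argument the orders of its zeros are divisible by `n`
(`dvd_of_eventually_eq_pow_mul`). On the disc, Weierstrass' theorem yields a denominator `P` with the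
poles of `f` as zeros, and an `n`-th root of the Wronskian. On the sphere, `f` is rational by the
generalised Liouville theorem, and the Wronskian is a homogeneous polynomial whose linear factors,
including the one at infinity, occur with multiplicities divisible by `n`.
-/

namespace Vortex

/-! ### The exterior derivative of one-forms -/

/-- The exterior derivative of a one-form with values in a normed space. For real values it is
`extD`. -/
noncomputable def dForm {E F : Type*} [NormedAddCommGroup E] [NormedSpace ℝ E]
    [NormedAddCommGroup F] [NormedSpace ℝ F] (α : E → E →L[ℝ] F) (x v w : E) : F :=
  fderiv ℝ α x v w - fderiv ℝ α x w v

section dForm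

variable {E E' F : Type*} [NormedAddCommGroup E] [NormedSpace ℝ E] [NormedAddCommGroup E']
  [NormedSpace ℝ E'] [NormedAddCommGroup F] [NormedSpace ℝ F]

theorem dForm_congr {α α' : E → E →L[ℝ] F} {x : E} (h : α =ᶠ[nhds x] α') (v w : E) :
    dForm α x v w = dForm α' x v w := by
  rw [dForm, dForm, h.fderiv_eq]

theorem dForm_add {α α' : E → E →L[ℝ] F} {x : E} (h : DifferentiableAt ℝ α x)
    (h' : DifferentiableAt ℝ α' x) (v w : E) :
    dForm (fun y => α y + α' y) x v w = dForm α x v w + dForm α' x v w := by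
  simp only [dForm, fderiv_fun_add h h', add_apply]
  abel

theorem dForm_sub {α α' : E → E →L[ℝ] F} {x : E} (h : DifferentiableAt ℝ α x)
    (h' : DifferentiableAt ℝ α' x) (v w : E) :
    dForm (fun y => α y - α' y) x v w = dForm α x v w - dForm α' x v w := by
  simp only [dForm, fderiv_fun_sub h h', sub_apply]
  abel

theorem dForm_const_smul {α : E → E →L[ℝ] F} {x : E} (h : DifferentiableAt ℝ α x) (c : ℝ)
    (v w : E) : dForm (fun y => c • α y) x v w = c • dForm α x v w := by
  simp only [dForm, fderiv_fun_const_smul h, smul_apply, smul_sub]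

/-- The Leibniz rule `d(gα) = dg ∧ α + g dα`. -/
theorem dForm_smul {α : E → E →L[ℝ] ℂ} {g : E → ℂ} {x : E} (h : DifferentiableAt ℝ α x)
    (hg : DifferentiableAt ℝ g x) (v w : E) :
    dForm (fun y => g y • α y) x v w = wedge (fderiv ℝ g x) (α x) v w + g x * dForm α x v w := by
  simp only [dForm, fderiv_fun_smul hg h, add_apply,
    smul_apply, ContinuousLinearMap.smulRight_apply, smul_eq_mul, wedge]
  ring

/-- The exterior derivative commutes with pull-back. -/
theorem dForm_pullback {α : E' → E' →L[ℝ] F} {κ : E → E'} {x : E}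
    (hα : DifferentiableAt ℝ α (κ x)) (hκ : ContDiffAt ℝ ∞ κ x) (v w : E) :
    dForm (fun y => (α (κ y)).comp (fderiv ℝ κ y)) x v w =
      dForm α (κ x) (fderiv ℝ κ x v) (fderiv ℝ κ x w) := by
  have h1 : HasFDerivAt κ (fderiv ℝ κ x) x := (hκ.differentiableAt (by simp)).hasFDerivAt
  have h2 : DifferentiableAt ℝ (fderiv ℝ κ) x :=
    (hκ.fderiv_right (m := 1) (by norm_cast)).differentiableAt (by simp)
  have h3 : HasFDerivAt (fun y => α (κ y)) ((fderiv ℝ α (κ x)).comp (fderiv ℝ κ x)) x :=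
    hα.hasFDerivAt.comp x h1
  have h4 := (h3.clm_comp h2.hasFDerivAt).fderiv
  have hsymm : fderiv ℝ (fderiv ℝ κ) x v w = fderiv ℝ (fderiv ℝ κ) x w v :=
    (hκ.isSymmSndFDerivAt (by simpa using WithTop.coe_le_coe.2 (le_top : (2 : ℕ∞) ≤ ⊤))).eq v w
  simp only [dForm, h4]
  simp [hsymm]

end dForm

/-! ### The left-invariant forms and the geometry of the group manifolds -/

theorem sigma0_antisymm (C : ℝ) (z w : ℂ × ℂ) : sigma0 C z w = -sigma0 C w z := by
  simp [sigma0]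
  ring

theorem contDiff_sigma0 (C : ℝ) : ContDiff ℝ ∞ (sigma0 C) := by
  have h : ContDiff ℝ ∞ fun z : ℂ × ℂ =>
      (conj z.1 • ContinuousLinearMap.fst ℂ ℂ ℂ +
        ((C : ℂ) * conj z.2) • ContinuousLinearMap.snd ℂ ℂ ℂ : ℂ × ℂ →L[ℂ] ℂ) := by
    have h1 : ContDiff ℝ ∞ fun z : ℂ × ℂ => conj z.1 := Complex.conjCLE.contDiff.comp contDiff_fst
    have h2 : ContDiff ℝ ∞ fun z : ℂ × ℂ => conj z.2 := Complex.conjCLE.contDiff.comp contDiff_snd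
    exact (h1.smul contDiff_const).add ((contDiff_const.mul h2).smul contDiff_const)
  have h' := (ContinuousLinearMap.restrictScalarsL ℂ (ℂ × ℂ) ℂ ℝ ℝ).contDiff (n := ∞) |>.comp h
  exact (contDiff_const.clm_comp h').const_smul (-2 : ℝ)

/-- As `σ⁰` is bilinear and antisymmetric in the base point and the vector, its exterior derivative
is read off from its values. -/
theorem dForm_sigma0 (C : ℝ) (z v w : ℂ × ℂ) : dForm (sigma0 C) z v w = 2 * sigma0 C v w := by
  have hd : DifferentiableAt ℝ (sigma0 C) z := (contDiff_sigma0 C).differentiable (by simp) z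
  have key : ∀ a b, fderiv ℝ (sigma0 C) z a b = sigma0 C a b := by
    intro a b
    have h1 := (hd.hasFDerivAt.clm_apply (hasFDerivAt_const b z)).fderiv
    have h2 : (fun y => sigma0 C y b) = fun y => (-sigma0 C b) y := by
      funext y
      rw [sigma0_antisymm, neg_apply]
    rw [h2, ContinuousLinearMap.fderiv] at h1
    have h3 := DFunLike.congr_fun h1 a
    simp at h3
    rw [← h3, sigma0_antisymm C b a, neg_neg]
  rw [dForm, key, key, sigma0_antisymm C w v]
  ring

/-- `σ` as a field of real-linear maps. -/
noncomputable def sigmaL (z : ℂ × ℂ) : ℂ × ℂ →L[ℝ] ℂ :=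
  (2 * Complex.I * z.1) • ContinuousLinearMap.snd ℝ ℂ ℂ -
    (2 * Complex.I * z.2) • ContinuousLinearMap.fst ℝ ℂ ℂ

theorem sigmaL_apply (z v : ℂ × ℂ) : sigmaL z v = sigma z v := by
  simp [sigmaL, sigma]
  ring

theorem contDiff_sigmaL : ContDiff ℝ ∞ sigmaL := by
  unfold sigmaL
  exact ((contDiff_const.mul contDiff_fst).smul contDiff_const).sub
    ((contDiff_const.mul contDiff_snd).smul contDiff_const)

theorem dForm_sigmaL (z v w : ℂ × ℂ) : dForm sigmaL z v w = 2 * sigma v w := by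
  have hd : DifferentiableAt ℝ sigmaL z := contDiff_sigmaL.differentiable (by simp) z
  have key : ∀ a b, fderiv ℝ sigmaL z a b = sigma a b := by
    intro a b
    have h1 := (hd.hasFDerivAt.clm_apply (hasFDerivAt_const b z)).fderiv
    have h2 : (fun y => sigmaL y b) = fun y => (-sigmaL b) y := by
      funext y
      rw [neg_apply, sigmaL_apply, sigmaL_apply]
      simp only [sigma]
      ring
    rw [h2, ContinuousLinearMap.fderiv] at h1
    have h3 := DFunLike.congr_fun h1 a
    simp at h3
    rw [← h3, sigmaL_apply]
    simp only [sigma]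
    ring
  rw [dForm, key, key]
  simp only [sigma]
  ring

/-- The polarisation `⟨z, v⟩` of the quadratic form `form C`, as a real-linear map in `v`. -/
noncomputable def formL (C : ℝ) (z : ℂ × ℂ) : ℂ × ℂ →L[ℝ] ℝ :=
  Complex.reCLM.comp ((conj z.1 • ContinuousLinearMap.fst ℂ ℂ ℂ +
      ((C : ℂ) * conj z.2) • ContinuousLinearMap.snd ℂ ℂ ℂ).restrictScalars ℝ)

theorem formL_apply (C : ℝ) (z v : ℂ × ℂ) :
    formL C z v = (conj z.1 * v.1 + (C : ℂ) * conj z.2 * v.2).re := by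
  simp [formL]

theorem mem_tangent_iff {C : ℝ} {z v : ℂ × ℂ} : v ∈ tangent C z ↔ formL C z v = 0 := by
  rw [formL_apply]
  rfl

theorem form_eq_re_im (C : ℝ) (z : ℂ × ℂ) :
    form C z = z.1.re ^ 2 + z.1.im ^ 2 + C * (z.2.re ^ 2 + z.2.im ^ 2) := by
  simp only [form, ← Complex.normSq_eq_norm_sq, Complex.normSq_apply]
  ring

theorem hasFDerivAt_form (C : ℝ) (z : ℂ × ℂ) : HasFDerivAt (form C) ((2 : ℝ) • formL C z) z := by
  have h1 : HasFDerivAt (fun y : ℂ × ℂ => ‖y.1‖ ^ 2) _ z :=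
    (hasStrictFDerivAt_fst (𝕜 := ℝ) (p := z)).hasFDerivAt.norm_sq
  have h2 : HasFDerivAt (fun y : ℂ × ℂ => ‖y.2‖ ^ 2) _ z :=
    (hasStrictFDerivAt_snd (𝕜 := ℝ) (p := z)).hasFDerivAt.norm_sq
  refine (h1.add (h2.const_mul C)).congr_fderiv ?_
  ext v <;> simp [formL] <;> ring

theorem contDiff_form (C : ℝ) : ContDiff ℝ ∞ (form C) :=
  (contDiff_fst.norm_sq ℂ).add (contDiff_const.mul (contDiff_snd.norm_sq ℂ))

theorem isOpen_cone (C : ℝ) : IsOpen (cone C) :=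
  isOpen_lt continuous_const (contDiff_form C).continuous

theorem cone_mem_nhds {C : ℝ} {z : ℂ × ℂ} (hz : z ∈ cone C) : cone C ∈ nhds z :=
  (isOpen_cone C).mem_nhds hz

/-- The derivative of a map into the group manifold takes tangent values. -/
theorem fderiv_mem_tangent {E : Type*} [NormedAddCommGroup E] [NormedSpace ℝ E] {C : ℝ}
    {g : E → ℂ × ℂ} {x : E} (hg : DifferentiableAt ℝ g x) (hx : ∀ᶠ y in nhds x, g y ∈ group C)
    (v : E) : fderiv ℝ g x v ∈ tangent C (g x) := by
  have h1 := ((hasFDerivAt_form C (g x)).comp x hg.hasFDerivAt).fderiv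
  have h2 : form C ∘ g =ᶠ[nhds x] fun _ => 1 := hx
  rw [h2.fderiv_eq, fderiv_fun_const] at h1
  have h3 := DFunLike.congr_fun h1 v
  simp at h3
  exact mem_tangent_iff.2 h3

/-- The radial retraction of the cone onto the group manifold. It reduces statements about tangent
vectors of the group to statements on an open subset of `ℂ²`. -/
noncomputable def retract (C : ℝ) (z : ℂ × ℂ) : ℂ × ℂ := (Real.sqrt (form C z))⁻¹ • z

theorem form_real_smul (C a : ℝ) (z : ℂ × ℂ) : form C (a • z) = a ^ 2 * form C z := by
  have h := form_smul C (a : ℂ) z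
  rw [Complex.norm_real, Real.norm_eq_abs, sq_abs] at h
  exact h

theorem retract_mem_group {C : ℝ} {z : ℂ × ℂ} (hz : z ∈ cone C) : retract C z ∈ group C := by
  have h : 0 < form C z := hz
  show form C (retract C z) = 1
  rw [retract, form_real_smul, inv_pow, Real.sq_sqrt h.le, inv_mul_cancel₀ h.ne']

theorem retract_of_mem_group {C : ℝ} {h : ℂ × ℂ} (hh : h ∈ group C) : retract C h = h := by
  have h1 : form C h = 1 := hh
  simp [retract, h1]

theorem contDiffAt_retract {C : ℝ} {z : ℂ × ℂ} (hz : z ∈ cone C) :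
    ContDiffAt ℝ ∞ (retract C) z := by
  have h : form C z ≠ 0 := ne_of_gt hz
  have h' : Real.sqrt (form C z) ≠ 0 := (Real.sqrt_pos.2 hz).ne'
  exact (((contDiff_form C).contDiffAt.sqrt h).inv h').smul contDiffAt_id

theorem fderiv_retract {C : ℝ} {h v : ℂ × ℂ} (hh : h ∈ group C) (hv : v ∈ tangent C h) :
    fderiv ℝ (retract C) h v = v := by
  have hc := group_subset_cone C hh
  have h1 : form C h = 1 := hh
  have hs := (hasDerivAt_inv (by simp [h1])).comp_hasFDerivAt h
    ((hasFDerivAt_form C h).sqrt (by simp [h1]))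
  have h2 := hs.smul (hasFDerivAt_id h)
  have h3 : HasFDerivAt (retract C) _ h := h2
  rw [h3.fderiv]
  simp [h1, mem_tangent_iff.1 hv]

/-- A one-form on the cone which vanishes on the vectors tangent to the group manifold has an
exterior derivative which vanishes on these vectors: it pulls back to zero under the retraction. -/
theorem dForm_eq_zero_of_forall_tangent {F : Type*} [NormedAddCommGroup F] [NormedSpace ℝ F]
    {C : ℝ} {α : ℂ × ℂ → ℂ × ℂ →L[ℝ] F} {h : ℂ × ℂ} (hh : h ∈ group C)
    (hα : DifferentiableAt ℝ α h) (h0 : ∀ g ∈ group C, ∀ v ∈ tangent C g, α g v = 0)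
    {v w : ℂ × ℂ} (hv : v ∈ tangent C h) (hw : w ∈ tangent C h) : dForm α h v w = 0 := by
  have hc := group_subset_cone C hh
  have hr := retract_of_mem_group hh
  have h1 := dForm_pullback (κ := retract C) (x := h) (by rwa [hr]) (contDiffAt_retract hc) v w
  have h2 : (fun y => (α (retract C y)).comp (fderiv ℝ (retract C) y)) =ᶠ[nhds h] fun _ => 0 := by
    filter_upwards [cone_mem_nhds hc] with y hy
    refine ContinuousLinearMap.ext fun u => ?_
    refine h0 _ (retract_mem_group hy) _ ?_
    refine fderiv_mem_tangent ((contDiffAt_retract hy).differentiableAt (by simp)) ?_ u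
    filter_upwards [cone_mem_nhds hy] with y' hy' using retract_mem_group hy'
  rw [dForm_congr h2, hr, fderiv_retract hh hv, fderiv_retract hh hw] at h1
  rw [← h1]
  simp [dForm]

theorem conj_mul_add_of_mem_group {C : ℝ} {h : ℂ × ℂ} (hh : h ∈ group C) :
    conj h.1 * h.1 + (C : ℂ) * (conj h.2 * h.2) = 1 := by
  have h1 : form C h = 1 := hh
  rw [Complex.conj_mul', Complex.conj_mul']
  exact_mod_cast h1

/-- The tangent vector at `h` with `σ⁰ = a` and `σ = b`. -/
noncomputable def frame (C : ℝ) (h : ℂ × ℂ) (a : ℝ) (b : ℂ) : ℂ × ℂ :=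
  ((-h.1 * (Complex.I * a) + C * conj h.2 * (Complex.I * b)) / 2,
    (-h.2 * (Complex.I * a) - conj h.1 * (Complex.I * b)) / 2)

/-- A tangent vector is determined by the values of the left-invariant forms on it. -/
theorem eq_frame {C : ℝ} {h v : ℂ × ℂ} (hh : h ∈ group C) (hv : v ∈ tangent C h) :
    v = frame C h (sigma0 C h v) (sigma h v) := by
  have hN := conj_mul_add_of_mem_group hh
  have hI := Complex.I_mul_I
  have hT : conj h.1 * v.1 + C * conj h.2 * v.2 + (h.1 * conj v.1 + C * h.2 * conj v.2) = 0 := by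
    have h1 : (conj h.1 * v.1 + (C : ℂ) * conj h.2 * v.2).re = 0 := hv
    have h2 := Complex.add_conj (conj h.1 * v.1 + (C : ℂ) * conj h.2 * v.2)
    rw [h1] at h2
    simpa using h2
  refine Prod.ext ?_ ?_
  · simp only [frame, sigma0_eq, sigma]
    linear_combination (-v.1) * hN + (h.1 * hT) / 2 +
      (h.1 * (conj h.1 * v.1 + C * conj h.2 * v.2 - h.1 * conj v.1 - C * h.2 * conj v.2) / 2 -
      C * conj h.2 * (h.1 * v.2 - h.2 * v.1)) * hI
  · simp only [frame, sigma0_eq, sigma]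
    linear_combination (-v.2) * hN + (h.2 * hT) / 2 +
      (h.2 * (conj h.1 * v.1 + C * conj h.2 * v.2 - h.1 * conj v.1 - C * h.2 * conj v.2) / 2 +
      conj h.1 * (h.1 * v.2 - h.2 * v.1)) * hI

theorem sigma_frame {C : ℝ} {h : ℂ × ℂ} (hh : h ∈ group C) (a : ℝ) (b : ℂ) :
    sigma h (frame C h a b) = b := by
  have hN := conj_mul_add_of_mem_group hh
  have hI := Complex.I_mul_I
  simp only [frame, sigma]
  linear_combination b * hN - b * (conj h.1 * h.1 + (C : ℂ) * (conj h.2 * h.2)) * hI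

theorem frame_mem_tangent {C : ℝ} {h : ℂ × ℂ} (a : ℝ) (b : ℂ) :
    frame C h a b ∈ tangent C h := by
  show (conj h.1 * (frame C h a b).1 + (C : ℂ) * conj h.2 * (frame C h a b).2).re = 0
  simp [frame]
  ring

/-- The structure equation `dσ = -i σ⁰ ∧ σ` of the group manifold. -/
theorem dForm_sigmaL_eq {C : ℝ} {h v w : ℂ × ℂ} (hh : h ∈ group C) (hv : v ∈ tangent C h)
    (hw : w ∈ tangent C h) : dForm sigmaL h v w =
      -Complex.I * wedge (fun u => (sigma0 C h u : ℂ)) (sigma h) v w := by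
  have hN := conj_mul_add_of_mem_group hh
  have hI := Complex.I_mul_I
  rw [dForm_sigmaL, wedge]
  generalize ha : sigma0 C h v = a
  generalize hb : sigma h v = b
  generalize ha' : sigma0 C h w = a'
  generalize hb' : sigma h w = b'
  rw [eq_frame hh hv, eq_frame hh hw, ha, hb, ha', hb']
  simp only [frame, sigma]
  linear_combination (-Complex.I * (a * b' - a' * b)) * hN +
    Complex.I * (a * b' - a' * b) * (conj h.1 * h.1 + (C : ℂ) * (conj h.2 * h.2)) * hI

/-- The structure equation `dσ⁰ = (i C / 2) σ̄ ∧ σ` of the group manifold. -/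
theorem dForm_sigma0_eq {C : ℝ} {h v w : ℂ × ℂ} (hh : h ∈ group C) (hv : v ∈ tangent C h)
    (hw : w ∈ tangent C h) : ((dForm (sigma0 C) h v w : ℝ) : ℂ) =
      Complex.I / 2 * C * wedge (fun u => conj (sigma h u)) (sigma h) v w := by
  have hN := conj_mul_add_of_mem_group hh
  have hI := Complex.I_mul_I
  rw [dForm_sigma0, wedge, Complex.ofReal_mul, sigma0_eq]
  generalize ha : sigma0 C h v = a
  generalize hb : sigma h v = b
  generalize ha' : sigma0 C h w = a'
  generalize hb' : sigma h w = b'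
  rw [eq_frame hh hv, eq_frame hh hw, ha, hb, ha', hb']
  simp only [frame, map_div₀, map_add, map_sub, map_mul, map_neg, Complex.conj_I,
    Complex.conj_ofReal, Complex.conj_conj, map_ofNat]
  push_cast
  linear_combination (Complex.I / 2 * C * (conj b * b' - conj b' * b)) * hN -
    (Complex.I / 2 * C * (conj b * b' - conj b' * b)) *
      (conj h.1 * h.1 + (C : ℂ) * (conj h.2 * h.2)) * hI

/-! ### Lifts are vortex configurations -/

theorem fderiv_comp_retract {E : Type*} [NormedAddCommGroup E] [NormedSpace ℝ E] {C : ℝ}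
    {g : ℂ × ℂ → E} {h v : ℂ × ℂ} (hh : h ∈ group C) (hg : DifferentiableAt ℝ g h)
    (hv : v ∈ tangent C h) : fderiv ℝ (g ∘ retract C) h v = fderiv ℝ g h v := by
  have hr := retract_of_mem_group hh
  have hd := (contDiffAt_retract (group_subset_cone C hh)).differentiableAt (n := ∞) (by simp)
  rw [fderiv_comp h (by rwa [hr]) hd, ContinuousLinearMap.comp_apply, fderiv_retract hh hv, hr]

theorem fderiv_map_mem_tangent {C C' : ℝ} {U : ℂ × ℂ → ℂ × ℂ} {h v : ℂ × ℂ} (hh : h ∈ group C)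
    (hU : DifferentiableAt ℝ U h) (hUg : ∀ g ∈ group C, U g ∈ group C') (hv : v ∈ tangent C h) :
    fderiv ℝ U h v ∈ tangent C' (U h) := by
  have hr := retract_of_mem_group hh
  have hc := group_subset_cone C hh
  have hd := (contDiffAt_retract hc).differentiableAt (n := ∞) (by simp)
  have hd' : DifferentiableAt ℝ (U ∘ retract C) h := DifferentiableAt.comp h (by rwa [hr]) hd
  have h1 := fderiv_mem_tangent (C := C') hd' (by
    filter_upwards [cone_mem_nhds hc] with y hy using hUg _ (retract_mem_group hy)) v
  rwa [fderiv_comp_retract hh hU hv, Function.comp_apply, hr] at h1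

section Lift

variable {n : ℕ} {C₀ C₂ : ℝ} {f : Surface C₀ → Surface C₂} {U : ℂ × ℂ → ℂ × ℂ}
  {Φ : ℂ × ℂ → ℂ} {A : ℂ × ℂ → ℂ × ℂ →L[ℝ] ℝ}

theorem contDiffAt_of_mem_group {C : ℝ} {E : Type*} [NormedAddCommGroup E] [NormedSpace ℝ E]
    {g : ℂ × ℂ → E} (hg : ContDiffOn ℝ ∞ g (cone C)) {h : ℂ × ℂ} (hh : h ∈ group C) :
    ContDiffAt ℝ ∞ g h :=
  hg.contDiffAt (cone_mem_nhds (group_subset_cone C hh))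

theorem IsLift.map_mem_group (hl : IsLift n f U Φ A) (h : ℂ × ℂ) (hh : h ∈ group C₀) :
    U h ∈ group C₂ :=
  (hl.covers h hh).1

/-- The exterior derivative of `Φⁿ σ = U^* τ`, by the structure equations on both groups. -/
theorem IsLift.pow_mul_wedge_eq_zero (hl : IsLift n f U Φ A) {h v w : ℂ × ℂ}
    (hh : h ∈ group C₀) (hv : v ∈ tangent C₀ h) (hw : w ∈ tangent C₀ h) :
    (n : ℂ) * Φ h ^ (n - 1) *
      wedge (fun u => fderiv ℝ Φ h u + Complex.I * (A h u : ℂ) * Φ h) (sigma h) v w = 0 := by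
  have hΦ := contDiffAt_of_mem_group hl.smooth_field hh
  have hU := contDiffAt_of_mem_group hl.smooth_map hh
  have hΦd : DifferentiableAt ℝ Φ h := hΦ.differentiableAt (by simp)
  have hUd : DifferentiableAt ℝ U h := hU.differentiableAt (by simp)
  have hσ : ∀ z, DifferentiableAt ℝ sigmaL z := contDiff_sigmaL.differentiable (by simp)
  have hU' : DifferentiableAt ℝ (fderiv ℝ U) h :=
    (hU.fderiv_right (m := 1) (by norm_cast)).differentiableAt (by simp)
  have hpow : DifferentiableAt ℝ (fun y => Φ y ^ n) h := hΦd.pow n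
  have hd1 : DifferentiableAt ℝ (fun y => Φ y ^ n • sigmaL y) h := hpow.smul (hσ h)
  have hd2 : DifferentiableAt ℝ (fun y => (sigmaL (U y)).comp (fderiv ℝ U y)) h :=
    ((hσ (U h)).comp h hUd).clm_comp hU'
  have h0 := dForm_eq_zero_of_forall_tangent hh (hd1.sub hd2) (fun g hg u hu => by
    simp [sigmaL_apply, hl.field_eq g hg u hu]) hv hw
  have h1 := dForm_sub hd1 hd2 v w
  rw [dForm_smul (hσ h) hpow, dForm_pullback (hσ _) hU, dForm_sigmaL_eq hh hv hw,
    dForm_sigmaL_eq (hl.map_mem_group h hh) (fderiv_map_mem_tangent hh hUd hl.map_mem_group hv)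
      (fderiv_map_mem_tangent hh hUd hl.map_mem_group hw)] at h1
  rw [show dForm (fun y => Φ y ^ n • sigmaL y - (sigmaL (U y)).comp (fderiv ℝ U y)) h v w = 0
    from h0] at h1
  have e1 : ∀ u, fderiv ℝ (fun y => Φ y ^ n) h u = n * Φ h ^ (n - 1) * fderiv ℝ Φ h u := by
    intro u
    rw [(hΦd.hasFDerivAt.pow n).fderiv]
    simp
  have e2 : ∀ u ∈ tangent C₀ h, (sigma0 C₂ (U h) (fderiv ℝ U h u) : ℂ) =
      n * A h u + sigma0 C₀ h u := by
    intro u hu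
    have := hl.form_eq h hh u hu
    have h' : sigma0 C₂ (U h) (fderiv ℝ U h u) = n * A h u + sigma0 C₀ h u := by linarith
    rw [h']
    push_cast
    ring
  simp only [wedge, e1, sigmaL_apply, e2 v hv, e2 w hw, ← hl.field_eq h hh v hv,
    ← hl.field_eq h hh w hw] at h1 ⊢
  rcases n with _ | m
  · simp
  · rw [Nat.add_sub_cancel] at h1 ⊢
    rw [pow_succ] at h1
    linear_combination -h1

/-- The first vortex equation. Off the zeros of `Φ` it follows from the derivative of
`Φⁿ σ = U^* τ`; if it failed at a zero, then by continuity it would fail nearby, so that `Φ` and its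
derivative would vanish there. -/
theorem IsLift.selfdual (hn : 0 < n) (hl : IsLift n f U Φ A) {h v w : ℂ × ℂ}
    (hh : h ∈ group C₀) (hv : v ∈ tangent C₀ h) (hw : w ∈ tangent C₀ h) :
    wedge (fun u => fderiv ℝ Φ h u + Complex.I * (A h u : ℂ) * Φ h) (sigma h) v w = 0 := by
  have hΦ := contDiffAt_of_mem_group hl.smooth_field hh
  have hA := contDiffAt_of_mem_group hl.smooth_form hh
  have hc := group_subset_cone C₀ hh
  -- Both vectors are extended to left-invariant fields along the group.
  let V : ℂ × ℂ → ℂ × ℂ := fun g => frame C₀ g (sigma0 C₀ h v) (sigma h v)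
  let W : ℂ × ℂ → ℂ × ℂ := fun g => frame C₀ g (sigma0 C₀ h w) (sigma h w)
  let X : ℂ × ℂ → ℂ := fun g =>
    wedge (fun u => fderiv ℝ Φ g u + Complex.I * (A g u : ℂ) * Φ g) (sigma g) (V g) (W g)
  have hVh : V h = v := (eq_frame hh hv).symm
  have hWh : W h = w := (eq_frame hh hw).symm
  have hXh : X h = wedge (fun u => fderiv ℝ Φ h u + Complex.I * (A h u : ℂ) * Φ h) (sigma h) v w :=
    by simp only [X, hVh, hWh]
  rw [← hXh]
  have hframe : ∀ a b, Continuous fun g => frame C₀ g a b := by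
    intro a b
    unfold frame
    fun_prop
  have hXc : ContinuousAt X h := by
    have hΦ' : ContinuousAt (fderiv ℝ Φ) h := (hΦ.fderiv_right (m := 0) (by simp)).continuousAt
    have hAc : ContinuousAt A h := hA.continuousAt
    have hΦc : ContinuousAt Φ h := hΦ.continuousAt
    have hV : ContinuousAt V h := (hframe _ _).continuousAt
    have hW : ContinuousAt W h := (hframe _ _).continuousAt
    have hfield : ∀ {Y : ℂ × ℂ → ℂ × ℂ}, ContinuousAt Y h → ContinuousAt
        (fun g => fderiv ℝ Φ g (Y g) + Complex.I * (A g (Y g) : ℂ) * Φ g) h := by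
      intro Y hY
      exact (hΦ'.clm_apply hY).add ((continuousAt_const.mul
        (Complex.continuous_ofReal.continuousAt.comp (hAc.clm_apply hY))).mul hΦc)
    have hsig : ∀ {Y : ℂ × ℂ → ℂ × ℂ}, ContinuousAt Y h →
        ContinuousAt (fun g => sigma g (Y g)) h := by
      intro Y hY
      unfold sigma
      fun_prop
    exact ((hfield hV).mul (hsig hW)).sub ((hfield hW).mul (hsig hV))
  by_contra hX
  -- Near `h` the function `Φ` vanishes on the group, hence so does its tangential derivative.
  have h1 : ∀ᶠ g in nhds h, g ∈ group C₀ → Φ g = 0 := by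
    filter_upwards [hXc.eventually_ne hX] with g hg hgg
    by_contra hΦg
    have := hl.pow_mul_wedge_eq_zero hgg (frame_mem_tangent (sigma0 C₀ h v) (sigma h v))
      (frame_mem_tangent (sigma0 C₀ h w) (sigma h w))
    refine hg ((mul_eq_zero.1 this).resolve_left ?_)
    exact mul_ne_zero (by exact_mod_cast hn.ne') (pow_ne_zero _ hΦg)
  have h2 : (Φ ∘ retract C₀) =ᶠ[nhds h] fun _ => 0 := by
    have ht : Filter.Tendsto (retract C₀) (nhds h) (nhds h) := by
      have := (contDiffAt_retract hc).continuousAt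
      rwa [ContinuousAt, retract_of_mem_group hh] at this
    filter_upwards [ht.eventually h1, cone_mem_nhds hc] with y hy hyc
    exact hy (retract_mem_group hyc)
  have h3 : ∀ u ∈ tangent C₀ h, fderiv ℝ Φ h u = 0 := by
    intro u hu
    rw [← fderiv_comp_retract hh (hΦ.differentiableAt (by simp)) hu, h2.fderiv_eq]
    simp
  refine hX ?_
  rw [hXh]
  simp [wedge, h3 v hv, h3 w hw, h1.self_of_nhds hh]

/-- The exterior derivative of `n A = U^* τ⁰ - σ⁰`, by the structure equations on both groups. -/
theorem IsLift.dForm_eq (hn : 0 < n) (hl : IsLift n f U Φ A) {h v w : ℂ × ℂ}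
    (hh : h ∈ group C₀) (hv : v ∈ tangent C₀ h) (hw : w ∈ tangent C₀ h) :
    ((dForm A h v w : ℝ) : ℂ) = -(Complex.I / 2) *
      ((C₀ : ℂ) / n - (C₂ : ℂ) / n * (‖Φ h‖ : ℂ) ^ (2 * n)) *
        wedge (fun u => conj (sigma h u)) (sigma h) v w := by
  have hU := contDiffAt_of_mem_group hl.smooth_map hh
  have hUd : DifferentiableAt ℝ U h := hU.differentiableAt (by simp)
  have hAd : DifferentiableAt ℝ A h :=
    (contDiffAt_of_mem_group hl.smooth_form hh).differentiableAt (by simp)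
  have hσ : ∀ C z, DifferentiableAt ℝ (sigma0 C) z := fun C =>
    (contDiff_sigma0 C).differentiable (by simp)
  have hU' : DifferentiableAt ℝ (fderiv ℝ U) h :=
    (hU.fderiv_right (m := 1) (by norm_cast)).differentiableAt (by simp)
  have hd1 : DifferentiableAt ℝ (fun y => (n : ℝ) • A y) h := hAd.const_smul (n : ℝ)
  have hd2 : DifferentiableAt ℝ (fun y => (sigma0 C₂ (U y)).comp (fderiv ℝ U y)) h :=
    ((hσ C₂ (U h)).comp h hUd).clm_comp hU'
  have hd3 := hd2.sub (hσ C₀ h)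
  have h0 := dForm_eq_zero_of_forall_tangent hh (hd1.sub hd3) (fun g hg u hu => by
    simp [hl.form_eq g hg u hu]) hv hw
  have h1 := dForm_sub hd1 hd3 v w
  have h2 := dForm_sub hd2 (hσ C₀ h) v w
  have h3 := dForm_const_smul hAd (n : ℝ) v w
  have h4 := h1.symm.trans h0
  rw [show dForm ((fun y => (sigma0 C₂ (U y)).comp (fderiv ℝ U y)) - sigma0 C₀) h v w = _ from h2,
    h3, dForm_pullback (hσ C₂ _) hU, smul_eq_mul] at h4
  have h5 := congrArg (fun t : ℝ => (t : ℂ)) h4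
  simp only [Complex.ofReal_sub, Complex.ofReal_mul, Complex.ofReal_natCast,
    dForm_sigma0_eq hh hv hw,
    dForm_sigma0_eq (hl.map_mem_group h hh) (fderiv_map_mem_tangent hh hUd hl.map_mem_group hv)
      (fderiv_map_mem_tangent hh hUd hl.map_mem_group hw), Complex.ofReal_zero] at h5
  simp only [wedge, ← hl.field_eq h hh v hv, ← hl.field_eq h hh w hw, map_mul, map_pow] at h5 ⊢
  have h6 : (‖Φ h‖ : ℂ) ^ (2 * n) = conj (Φ h) ^ n * Φ h ^ n := by
    rw [pow_mul, ← Complex.conj_mul', mul_pow]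
  have hn' : (n : ℂ) ≠ 0 := by exact_mod_cast hn.ne'
  rw [h6]
  field_simp
  linear_combination 2 * h5

theorem IsLift.isVortexConfiguration (hn : 0 < n) (hl : IsLift n f U Φ A) :
    IsVortexConfiguration n C₀ C₂ Φ A where
  smooth_field := hl.smooth_field
  smooth_form := hl.smooth_form
  selfdual _ hh _ hv _ hw := hl.selfdual hn hh hv hw
  curvature _ hh _ hv _ hw := hl.dForm_eq hn hh hv hw

end Lift

/-! ### The pull-back to flat space -/

section Flat

variable {C₀ : ℝ} {x : Fin 3 → ℝ}

theorem isOpen_region (C₀ : ℝ) : IsOpen (region C₀) := by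
  refine isOpen_lt continuous_const ?_
  unfold rsq
  fun_prop

theorem region_mem_nhds (hx : x ∈ region C₀) : region C₀ ∈ nhds x := (isOpen_region C₀).mem_nhds hx

theorem one_add_pos_of_mem_region (hx : x ∈ region C₀) : 0 < 1 + C₀ * rsq C₀ x := by
  have : -1 < C₀ * rsq C₀ x := hx
  linarith

theorem stereo_mem_group (hC₀ : C₀ * C₀ = 1) (hx : x ∈ region C₀) : stereo C₀ x ∈ group C₀ := by
  have hN := (one_add_pos_of_mem_region hx).ne'
  show form C₀ (stereo C₀ x) = 1
  have h1 : (stereo C₀ x).1 = (((1 - C₀ * rsq C₀ x) / (1 + C₀ * rsq C₀ x) : ℝ) : ℂ) +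
      ((2 * x 0 / (1 + C₀ * rsq C₀ x) : ℝ) : ℂ) * Complex.I := by
    simp only [stereo]
    push_cast
    ring
  have h2 : (stereo C₀ x).2 = ((-2 * x 2 / (1 + C₀ * rsq C₀ x) : ℝ) : ℂ) +
      ((2 * x 1 / (1 + C₀ * rsq C₀ x) : ℝ) : ℂ) * Complex.I := by
    simp only [stereo]
    push_cast
    ring_nf
    rw [Complex.I_sq]
    ring
  rw [form_eq_re_im, h1, h2]
  simp only [Complex.add_re, Complex.add_im, Complex.ofReal_re, Complex.ofReal_im,
    Complex.re_ofReal_mul, Complex.im_ofReal_mul, Complex.I_re, Complex.I_im]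
  field_simp
  simp only [rsq]
  linear_combination (-4 * x 0 ^ 2) * hC₀

/-- The derivative of `1 + C₀ r²`. -/
def dN (C₀ : ℝ) (x v : Fin 3 → ℝ) : ℝ := 2 * C₀ * (C₀ * x 0 * v 0 + x 1 * v 1 + x 2 * v 2)

theorem hasFDerivAt_coord (x : Fin 3 → ℝ) (i : Fin 3) :
    HasFDerivAt (fun y : Fin 3 → ℝ => y i) (ContinuousLinearMap.proj (R := ℝ) i) x :=
  (ContinuousLinearMap.proj (R := ℝ) (φ := fun _ : Fin 3 => ℝ) i).hasFDerivAt

theorem contDiff_one_add_mul_rsq (C₀ : ℝ) :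
    ContDiff ℝ ∞ fun y : Fin 3 → ℝ => 1 + C₀ * rsq C₀ y := by
  unfold rsq
  fun_prop

theorem fderiv_one_add_mul_rsq (v : Fin 3 → ℝ) :
    fderiv ℝ (fun y : Fin 3 → ℝ => 1 + C₀ * rsq C₀ y) x v = dN C₀ x v := by
  have h := ((((hasFDerivAt_coord x 0).pow 2).const_mul C₀).add
    ((hasFDerivAt_coord x 1).pow 2)).add ((hasFDerivAt_coord x 2).pow 2)
  have h' := (h.const_mul C₀).const_add 1
  have h'' : HasFDerivAt (fun y : Fin 3 → ℝ => 1 + C₀ * rsq C₀ y) _ x := h'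
  rw [h''.fderiv]
  simp [dN]
  ring

/-- The two components of the first column of `√(1 + C₀ r²) G`. -/
def colP (y : Fin 3 → ℝ) : Fin 2 → ℂ := ![1 + Complex.I * y 0, Complex.I * y 1 - y 2]

theorem hasFDerivAt_ofReal_coord (x : Fin 3 → ℝ) (i : Fin 3) :
    HasFDerivAt (fun y : Fin 3 → ℝ => (y i : ℂ))
      (Complex.ofRealCLM.comp (ContinuousLinearMap.proj (R := ℝ) i)) x :=
  (Complex.ofRealCLM.comp
    (ContinuousLinearMap.proj (R := ℝ) (φ := fun _ : Fin 3 => ℝ) i)).hasFDerivAt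

theorem fderiv_colP_zero (v : Fin 3 → ℝ) :
    fderiv ℝ (fun y => colP y 0) x v = Complex.I * v 0 := by
  have h : HasFDerivAt (fun y => colP y 0) _ x :=
    ((hasFDerivAt_ofReal_coord x 0).const_mul Complex.I).const_add 1
  rw [h.fderiv]
  simp

theorem fderiv_colP_one (v : Fin 3 → ℝ) :
    fderiv ℝ (fun y => colP y 1) x v = Complex.I * v 1 - v 2 := by
  have h : HasFDerivAt (fun y => colP y 1) _ x :=
    ((hasFDerivAt_ofReal_coord x 1).const_mul Complex.I).sub (hasFDerivAt_ofReal_coord x 2)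
  rw [h.fderiv]
  simp

theorem contDiff_colP (i : Fin 2) : ContDiff ℝ ∞ fun y => colP y i := by
  have h : ∀ j : Fin 3, ContDiff ℝ ∞ fun y : Fin 3 → ℝ => (y j : ℂ) := fun j =>
    (Complex.ofRealCLM.comp
      (ContinuousLinearMap.proj (R := ℝ) (φ := fun _ : Fin 3 => ℝ) j)).contDiff
  fin_cases i
  · exact contDiff_const.add (contDiff_const.mul (h 0))
  · exact (contDiff_const.mul (h 1)).sub (h 2)

theorem stereo_eq (hx : x ∈ region C₀) : stereo C₀ x =
    (((2 / (1 + C₀ * rsq C₀ x) : ℝ) : ℂ) * colP x 0 - 1,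
      ((2 / (1 + C₀ * rsq C₀ x) : ℝ) : ℂ) * colP x 1) := by
  have hN : (1 + C₀ * rsq C₀ x : ℂ) ≠ 0 := by
    exact_mod_cast (one_add_pos_of_mem_region hx).ne'
  refine Prod.ext ?_ ?_
  · simp only [stereo, colP]
    push_cast
    field_simp
    ring
  · simp only [stereo, colP]
    push_cast
    field_simp
    linear_combination (x 2 : ℂ) * Complex.I_sq

theorem contDiffAt_two_div (hx : x ∈ region C₀) :
    ContDiffAt ℝ ∞ (fun y => ((2 / (1 + C₀ * rsq C₀ y) : ℝ) : ℂ)) x :=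
  Complex.ofRealCLM.contDiff.contDiffAt.comp x
    (contDiffAt_const.div (contDiff_one_add_mul_rsq C₀).contDiffAt
      (one_add_pos_of_mem_region hx).ne')

theorem stereo_eventuallyEq (hx : x ∈ region C₀) : stereo C₀ =ᶠ[nhds x] fun y =>
    (((2 / (1 + C₀ * rsq C₀ y) : ℝ) : ℂ) * colP y 0 - 1,
      ((2 / (1 + C₀ * rsq C₀ y) : ℝ) : ℂ) * colP y 1) := by
  filter_upwards [region_mem_nhds hx] with y hy using stereo_eq hy

theorem contDiffAt_stereo (hx : x ∈ region C₀) : ContDiffAt ℝ ∞ (stereo C₀) x :=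
  ((((contDiffAt_two_div hx).mul (contDiff_colP 0).contDiffAt).sub contDiffAt_const).prodMk
    ((contDiffAt_two_div hx).mul (contDiff_colP 1).contDiffAt)).congr_of_eventuallyEq
      (stereo_eventuallyEq hx)

theorem fderiv_two_div (hx : x ∈ region C₀) (v : Fin 3 → ℝ) :
    fderiv ℝ (fun y => ((2 / (1 + C₀ * rsq C₀ y) : ℝ) : ℂ)) x v =
      ((-2 * dN C₀ x v / (1 + C₀ * rsq C₀ x) ^ 2 : ℝ) : ℂ) := by
  have hN := (one_add_pos_of_mem_region hx).ne'
  have h1 := ((contDiff_one_add_mul_rsq C₀).differentiable (by simp) x).hasFDerivAt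
  have h2 := ((hasDerivAt_inv hN).comp_hasFDerivAt x h1).const_mul 2
  have h3 := Complex.ofRealCLM.hasFDerivAt.comp x h2
  have h4 : HasFDerivAt (fun y => ((2 / (1 + C₀ * rsq C₀ y) : ℝ) : ℂ)) _ x := h3
  rw [h4.fderiv]
  have := fderiv_one_add_mul_rsq (C₀ := C₀) (x := x) v
  simp only [ContinuousLinearMap.comp_apply, smul_apply, this, Complex.ofRealCLM_apply, smul_eq_mul]
  congr 1
  field_simp

theorem fderiv_stereo (hx : x ∈ region C₀) (v : Fin 3 → ℝ) :
    fderiv ℝ (stereo C₀) x v =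
      (((2 / (1 + C₀ * rsq C₀ x) : ℝ) : ℂ) * (Complex.I * v 0) +
          ((-2 * dN C₀ x v / (1 + C₀ * rsq C₀ x) ^ 2 : ℝ) : ℂ) * colP x 0,
        ((2 / (1 + C₀ * rsq C₀ x) : ℝ) : ℂ) * (Complex.I * v 1 - v 2) +
          ((-2 * dN C₀ x v / (1 + C₀ * rsq C₀ x) ^ 2 : ℝ) : ℂ) * colP x 1) := by
  have h := ((contDiffAt_two_div hx).differentiableAt (by simp)).hasFDerivAt
  have h0 := (((contDiff_colP 0).differentiable (by simp)) x).hasFDerivAt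
  have h1 := (((contDiff_colP 1).differentiable (by simp)) x).hasFDerivAt
  have h2 : HasFDerivAt (fun y => (((2 / (1 + C₀ * rsq C₀ y) : ℝ) : ℂ) * colP y 0 - 1,
      ((2 / (1 + C₀ * rsq C₀ y) : ℝ) : ℂ) * colP y 1)) _ x :=
    ((h.mul h0).sub_const 1).prodMk (h.mul h1)
  rw [(stereo_eventuallyEq hx).fderiv_eq, h2.fderiv]
  simp only [ContinuousLinearMap.prod_apply, add_apply, smul_apply, fderiv_two_div hx,
    fderiv_colP_zero, fderiv_colP_one, smul_eq_mul]
  refine Prod.ext ?_ ?_ <;> simp <;> ring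

/-- The scalar factor `Ω⁻¹ (1 + C₀ r²)^(-1/2)` of the spinor `Ψ_H`. -/
noncomputable def spinorFactor (C₀ : ℝ) (y : Fin 3 → ℝ) : ℝ :=
  (conformal C₀ y)⁻¹ * (Real.sqrt (1 + C₀ * rsq C₀ y))⁻¹

theorem gnomonic_mulVec (C₀ : ℝ) (y : Fin 3 → ℝ) (c : ℂ) : (gnomonic C₀ y).mulVec ![c, 0] =
    fun i => ((Real.sqrt (1 + C₀ * rsq C₀ y))⁻¹ : ℝ) * colP y i * c := by
  funext i
  fin_cases i <;>
    simp [gnomonic, Matrix.mulVec, dotProduct, Fin.sum_univ_two, Fin.sum_univ_three, gen, colP] <;>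
    ring_nf <;> simp

theorem spinorH_apply (C₀ : ℝ) (Φ : ℂ × ℂ → ℂ) (y : Fin 3 → ℝ) (i : Fin 2) :
    spinorH C₀ Φ y i = (spinorFactor C₀ y : ℂ) * (colP y i * Φ (stereo C₀ y)) := by
  rw [spinorH, gnomonic_mulVec, Pi.smul_apply, spinorFactor, smul_eq_mul]
  push_cast
  ring

theorem contDiffAt_spinorFactor (hx : x ∈ region C₀) : ContDiffAt ℝ ∞ (spinorFactor C₀) x := by
  have hN := one_add_pos_of_mem_region hx
  have h1 : ContDiffAt ℝ ∞ (conformal C₀) x := (contDiff_one_add_mul_rsq C₀).contDiffAt.div_const 2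
  have h2 := (contDiff_one_add_mul_rsq C₀).contDiffAt.sqrt (x := x) hN.ne'
  refine (h1.inv ?_).mul (h2.inv (Real.sqrt_pos.2 hN).ne')
  exact (half_pos hN).ne'

theorem fderiv_spinorFactor (hx : x ∈ region C₀) (v : Fin 3 → ℝ) :
    fderiv ℝ (spinorFactor C₀) x v =
      -(3 / 2) * (dN C₀ x v / (1 + C₀ * rsq C₀ x)) * spinorFactor C₀ x := by
  have hN := one_add_pos_of_mem_region hx
  have hs := Real.sqrt_pos.2 hN
  have h1 := ((contDiff_one_add_mul_rsq C₀).differentiable (by simp) x).hasFDerivAt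
  have h2 : HasFDerivAt (conformal C₀) _ x := h1.mul_const 2⁻¹
  have h3 := (hasDerivAt_inv (half_pos hN).ne').comp_hasFDerivAt x h2
  have h4 := (hasDerivAt_inv hs.ne').comp_hasFDerivAt x (h1.sqrt hN.ne')
  have h5 : HasFDerivAt (spinorFactor C₀) _ x := h3.mul h4
  rw [h5.fderiv]
  have hsq : Real.sqrt (1 + C₀ * rsq C₀ x) ^ 2 = 1 + C₀ * rsq C₀ x := Real.sq_sqrt hN.le
  simp only [add_apply, smul_apply, fderiv_one_add_mul_rsq, smul_eq_mul, spinorFactor, conformal,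
    Function.comp_apply]
  generalize Real.sqrt (1 + C₀ * rsq C₀ x) = s at *
  rw [← hsq] at *
  field_simp
  ring

theorem contDiffOn_spinorH (hC₀ : C₀ * C₀ = 1) {Φ : ℂ × ℂ → ℂ} (hΦ : ContDiffOn ℝ ∞ Φ (cone C₀)) :
    ContDiffOn ℝ ∞ (spinorH C₀ Φ) (region C₀) := by
  intro x hx
  refine ContDiffAt.contDiffWithinAt (contDiffAt_pi.2 fun i => ?_)
  simp only [spinorH_apply]
  refine (Complex.ofRealCLM.contDiff.contDiffAt.comp x (contDiffAt_spinorFactor hx)).mul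
    ((contDiff_colP i).contDiffAt.mul ?_)
  exact (contDiffAt_of_mem_group hΦ (stereo_mem_group hC₀ hx)).comp x (contDiffAt_stereo hx)

theorem contDiffOn_gaugeH (hC₀ : C₀ * C₀ = 1) {A : ℂ × ℂ → ℂ × ℂ →L[ℝ] ℝ}
    (hA : ContDiffOn ℝ ∞ A (cone C₀)) : ContDiffOn ℝ ∞ (gaugeH C₀ A) (region C₀) := by
  intro x hx
  have h1 := (contDiffAt_of_mem_group hA (stereo_mem_group hC₀ hx)).add
    ((contDiff_sigma0 C₀).const_smul (3 / 4 : ℝ)).contDiffAt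
  exact ((h1.comp x (contDiffAt_stereo hx)).clm_comp
    ((contDiffAt_stereo hx).fderiv_right (m := ∞) (by norm_cast))).contDiffWithinAt

/-- The covariant derivative of the spinor `Ψ_H` in terms of that of `Φ`. -/
theorem covariant_spinorH (hC₀ : C₀ * C₀ = 1) {Φ : ℂ × ℂ → ℂ} (hΦ : ContDiffOn ℝ ∞ Φ (cone C₀))
    (A : ℂ × ℂ → ℂ × ℂ →L[ℝ] ℝ) (hx : x ∈ region C₀) (v : Fin 3 → ℝ) (i : Fin 2) :
    (fderiv ℝ (spinorH C₀ Φ) x v + (Complex.I * (gaugeH C₀ A x v : ℂ)) • spinorH C₀ Φ x) i =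
      spinorFactor C₀ x * (fderiv ℝ (fun y => colP y i) x v * Φ (stereo C₀ x) + colP x i *
        (-(3 / 2) * (dN C₀ x v / (1 + C₀ * rsq C₀ x) : ℝ) * Φ (stereo C₀ x) +
          (fderiv ℝ Φ (stereo C₀ x) (fderiv ℝ (stereo C₀) x v) +
            Complex.I * A (stereo C₀ x) (fderiv ℝ (stereo C₀) x v) * Φ (stereo C₀ x)) +
          Complex.I * (3 / 4) * sigma0 C₀ (stereo C₀ x) (fderiv ℝ (stereo C₀) x v) *
            Φ (stereo C₀ x))) := by
  have hΦ' := contDiffAt_of_mem_group hΦ (stereo_mem_group hC₀ hx)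
  have hd : DifferentiableAt ℝ (spinorH C₀ Φ) x :=
    ((contDiffOn_spinorH hC₀ hΦ).contDiffAt (region_mem_nhds hx)).differentiableAt (by simp)
  have h1 : fderiv ℝ (spinorH C₀ Φ) x v i = fderiv ℝ (fun y => spinorH C₀ Φ y i) x v := by
    rw [(hasFDerivAt_pi'.1 hd.hasFDerivAt i).fderiv]
    rfl
  have h2 := Complex.ofRealCLM.hasFDerivAt.comp x
    ((contDiffAt_spinorFactor hx).differentiableAt (by simp)).hasFDerivAt
  have h3 := ((contDiff_colP i).differentiable (by simp) x).hasFDerivAt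
  have h4 := (hΦ'.differentiableAt (by simp)).hasFDerivAt.comp x
    ((contDiffAt_stereo hx).differentiableAt (by simp)).hasFDerivAt
  have h5 : HasFDerivAt (fun y => spinorH C₀ Φ y i) _ x :=
    (h2.mul (h3.mul h4)).congr_of_eventuallyEq (.of_forall fun y => spinorH_apply C₀ Φ y i)
  rw [Pi.add_apply, h1, h5.fderiv, Pi.smul_apply, spinorH_apply]
  simp only [add_apply, smul_apply, smul_eq_mul, ContinuousLinearMap.comp_apply,
    fderiv_spinorFactor hx, Complex.ofRealCLM_apply, gaugeH, pullH, Function.comp_apply,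
    Pi.mul_apply]
  push_cast
  ring

theorem one_add_mul_rsq_eq (C₀ : ℝ) (hC₀ : C₀ * C₀ = 1) (x : Fin 3 → ℝ) :
    1 + C₀ * rsq C₀ x = 1 + x 0 ^ 2 + C₀ * (x 1 ^ 2 + x 2 ^ 2) := by
  simp only [rsq]
  linear_combination x 0 ^ 2 * hC₀

/-- The pull-back `H^*σ`. -/
theorem sigma_stereo (hx : x ∈ region C₀) (v : Fin 3 → ℝ) :
    sigma (stereo C₀ x) (fderiv ℝ (stereo C₀) x v) =
      4 * Complex.I * (2 * (colP x 0 * (Complex.I * v 1 - v 2) - colP x 1 * (Complex.I * v 0)) -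
        (1 + C₀ * rsq C₀ x : ℝ) * (Complex.I * v 1 - v 2) + dN C₀ x v * colP x 1) /
        ((1 + C₀ * rsq C₀ x : ℝ) : ℂ) ^ 2 := by
  have hN : ((1 + C₀ * rsq C₀ x : ℝ) : ℂ) ≠ 0 := by
    exact_mod_cast (one_add_pos_of_mem_region hx).ne'
  rw [fderiv_stereo hx, stereo_eq hx, sigma]
  generalize 1 + C₀ * rsq C₀ x = N at *
  push_cast
  field_simp
  ring

/-- The pull-back `H^*σ⁰`. -/
theorem sigma0_stereo (hx : x ∈ region C₀) (v : Fin 3 → ℝ) :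
    sigma0 C₀ (stereo C₀ x) (fderiv ℝ (stereo C₀) x v) =
      4 * ((1 + C₀ * rsq C₀ x) * v 0 - 2 * (v 0 + C₀ * (x 1 * v 2 - x 2 * v 1)) - dN C₀ x v * x 0) /
        (1 + C₀ * rsq C₀ x) ^ 2 := by
  have hN : ((1 + C₀ * rsq C₀ x : ℝ) : ℂ) ≠ 0 := by
    exact_mod_cast (one_add_pos_of_mem_region hx).ne'
  apply Complex.ofReal_injective
  rw [fderiv_stereo hx, stereo_eq hx, sigma0_eq]
  generalize 1 + C₀ * rsq C₀ x = N at *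
  simp only [colP, map_add, map_sub, map_mul, Complex.conj_ofReal, map_one, Complex.conj_I,
    Matrix.cons_val_zero, Matrix.cons_val_one]
  push_cast
  field_simp
  grind [Complex.I_mul_I]

/-- If `dΦ + iAΦ` is a multiple of `σ`, then `Ψ_H` is a zero mode of the Dirac operator: the terms
with `μ` cancel because the Clifford action of `H^*σ` annihilates the first column of `G`, and the
terms with `Φ` because `3/4 σ⁰` compensates the derivatives of `Ω⁻¹` and `G`. -/
theorem dirac_spinorH (hC₀ : C₀ * C₀ = 1) {Φ : ℂ × ℂ → ℂ} (hΦ : ContDiffOn ℝ ∞ Φ (cone C₀))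
    {A : ℂ × ℂ → ℂ × ℂ →L[ℝ] ℝ} (hx : x ∈ region C₀) {μ : ℂ}
    (hμ : ∀ v ∈ tangent C₀ (stereo C₀ x), fderiv ℝ Φ (stereo C₀ x) v +
      Complex.I * A (stereo C₀ x) v * Φ (stereo C₀ x) = μ * sigma (stereo C₀ x) v) :
    dirac C₀ (gaugeH C₀ A) (spinorH C₀ Φ) x = 0 := by
  have hNr := (one_add_pos_of_mem_region hx).ne'
  have hNe : ((1 + C₀ * rsq C₀ x : ℝ) : ℂ) = 1 + x 0 ^ 2 + C₀ * (x 1 ^ 2 + x 2 ^ 2) := by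
    rw [one_add_mul_rsq_eq C₀ hC₀]
    push_cast
    rfl
  have hN : ((1 + C₀ * rsq C₀ x : ℝ) : ℂ) ≠ 0 := by exact_mod_cast hNr
  have hC : (C₀ : ℂ) * C₀ = 1 := by exact_mod_cast hC₀
  have hI := Complex.I_mul_I
  have htan : ∀ v, fderiv ℝ (stereo C₀) x v ∈ tangent C₀ (stereo C₀ x) := fun v =>
    fderiv_mem_tangent ((contDiffAt_stereo hx).differentiableAt (by simp)) (by
      filter_upwards [region_mem_nhds hx] with y hy using stereo_mem_group hC₀ hy) v
  have h0 := fun v => covariant_spinorH hC₀ hΦ A hx v 0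
  have h1 := fun v => covariant_spinorH hC₀ hΦ A hx v 1
  simp only [hμ _ (htan _), sigma_stereo hx, sigma0_stereo hx, fderiv_colP_zero,
    fderiv_colP_one, Pi.add_apply, Pi.smul_apply] at h0 h1
  generalize Φ (stereo C₀ x) = φ at *
  generalize spinorFactor C₀ x = k at *
  rw [dirac]
  generalize spinorH C₀ Φ x = Ψ at *
  rw [Fin.sum_univ_three]
  refine funext (Fin.forall_fin_two.2 ⟨?_, ?_⟩)
  · simp only [Pi.add_apply, Pi.smul_apply, Matrix.mulVec, dotProduct, Fin.sum_univ_two,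
      Matrix.smul_apply, h0, h1]
    generalize 1 + C₀ * rsq C₀ x = N at *
    simp [gen, eta, dN, colP]
    field_simp
    clear h0 h1 hμ htan hΦ
    grind
  · simp only [Pi.add_apply, Pi.smul_apply, Matrix.mulVec, dotProduct, Fin.sum_univ_two,
      Matrix.smul_apply, h0, h1]
    generalize 1 + C₀ * rsq C₀ x = N at *
    simp [gen, eta, dN, colP]
    field_simp
    clear h0 h1 hμ htan hΦ
    grind

/-- `(dΦ + iAΦ) ∧ σ = 0` says that `dΦ + iAΦ` is a multiple of `σ`. -/
theorem IsVortexConfiguration.exists_eq_mul_sigma {n : ℕ} {C₂ : ℝ} {Φ : ℂ × ℂ → ℂ}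
    {A : ℂ × ℂ → ℂ × ℂ →L[ℝ] ℝ} (hc : IsVortexConfiguration n C₀ C₂ Φ A) {h : ℂ × ℂ}
    (hh : h ∈ group C₀) : ∃ μ : ℂ, ∀ v ∈ tangent C₀ h,
      fderiv ℝ Φ h v + Complex.I * A h v * Φ h = μ * sigma h v := by
  refine ⟨fderiv ℝ Φ h (frame C₀ h 0 1) + Complex.I * A h (frame C₀ h 0 1) * Φ h, fun v hv => ?_⟩
  have h1 := hc.selfdual h hh v hv _ (frame_mem_tangent 0 1)
  rw [wedge, sigma_frame hh] at h1
  linear_combination h1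

theorem isUnit_det_gnomonic (hx : x ∈ region C₀) (hC₀ : C₀ * C₀ = 1) :
    IsUnit (gnomonic C₀ x).det := by
  have h1 := congrArg Matrix.det (gnomonic_sq C₀ hC₀ x hx)
  have h2 : (groupMatrix C₀ (stereo C₀ x)).det = 1 := by
    rw [groupMatrix, Matrix.det_fin_two_of]
    linear_combination conj_mul_add_of_mem_group (stereo_mem_group hC₀ hx)
  rw [Matrix.det_mul, h2] at h1
  exact IsUnit.of_mul_eq_one _ h1

/-- For a spinor `(c, 0)` only the `σ⁰`-component of `Ψ̂† h⁻¹dh Ψ̂` survives, and its Hodge star is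
a multiple of `σ¹ ∧ σ²`. -/
theorem modeSource_eq {n : ℕ} (hn : 0 < n) (hC₀ : C₀ * C₀ = 1) (C₂ : ℝ) (h : ℂ × ℂ) (c : ℂ)
    (v w : ℂ × ℂ) : modeSource n C₀ C₂ h ![c, 0] v w =
      (-((C₂ : ℂ) / n) * (‖c‖ : ℂ) ^ (2 * n) + C₀ * (1 / (n : ℂ) - 3 / 4)) *
        wedge (sigmaC C₀ h 1) (sigmaC C₀ h 2) v w := by
  have hC : (C₀ : ℂ) ≠ 0 := by
    rintro h
    have : C₀ = 0 := by exact_mod_cast h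
    simp [this] at hC₀
  obtain ⟨m, rfl⟩ : ∃ m, n = m + 1 := ⟨n - 1, by omega⟩
  have hc : conj c * c = (‖c‖ : ℂ) ^ 2 := Complex.conj_mul' c
  have h1 : star C₀ h (fun a => dotProduct (fun i => conj ((![c, 0] : Fin 2 → ℂ) i))
      ((gen C₀ a).mulVec ![c, 0])) v w =
      -(Complex.I / 2) * (‖c‖ : ℂ) ^ 2 * (C₀ / 2) *
        wedge (sigmaC C₀ h 1) (sigmaC C₀ h 2) v w := by
    rw [star, Fin.sum_univ_three, ← hc]
    simp [gen, eta, dotProduct, Matrix.mulVec, Fin.sum_univ_two]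
    exact Or.inl (Or.inl (by ring))
  rw [modeSource, h1]
  have hm : ((m + 1 : ℕ) : ℂ) ≠ 0 := by exact_mod_cast m.succ_ne_zero
  have hI := Complex.I_mul_I
  simp only [Matrix.cons_val_zero, Matrix.cons_val_one, norm_zero, Nat.add_sub_cancel]
  rw [pow_mul]
  push_cast at *
  field_simp
  linear_combination (C₂ * ‖c‖ ^ 2 * ((‖c‖ : ℂ) ^ 2 + 0 ^ 2) ^ m *
    wedge (sigmaC C₀ h 1) (sigmaC C₀ h 2) v w * 16) * hI

theorem wedge_conj_sigma (C : ℝ) (h v w : ℂ × ℂ) :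
    wedge (fun u => conj (sigma h u)) (sigma h) v w =
      2 * Complex.I * wedge (sigmaC C h 1) (sigmaC C h 2) v w := by
  simp only [wedge, sigmaC, Matrix.cons_val_one, Matrix.cons_val_two, Matrix.tail_cons,
    Matrix.head_cons, Matrix.cons_val_zero]
  apply Complex.ext <;> simp <;> ring

theorem IsVortexConfiguration.isVortexMagneticMode {n : ℕ} (hn : 0 < n) (hC₀ : C₀ * C₀ = 1)
    {C₂ : ℝ} {Φ : ℂ × ℂ → ℂ} {A : ℂ × ℂ → ℂ × ℂ →L[ℝ] ℝ}
    (hc : IsVortexConfiguration n C₀ C₂ Φ A) :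
    IsVortexMagneticMode n C₀ C₂ (spinorH C₀ Φ) (gaugeH C₀ A) where
  smooth_spinor := contDiffOn_spinorH hC₀ hc.smooth_field
  smooth_form := contDiffOn_gaugeH hC₀ hc.smooth_form
  zero_mode x hx := by
    obtain ⟨μ, hμ⟩ := hc.exists_eq_mul_sigma (stereo_mem_group hC₀ hx)
    exact dirac_spinorH hC₀ hc.smooth_field hx hμ
  curvature x hx v w := by
    have hg := stereo_mem_group hC₀ hx
    have hN := one_add_pos_of_mem_region hx
    have htan : ∀ u, fderiv ℝ (stereo C₀) x u ∈ tangent C₀ (stereo C₀ x) := fun u =>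
      fderiv_mem_tangent ((contDiffAt_stereo hx).differentiableAt (by simp)) (by
        filter_upwards [region_mem_nhds hx] with y hy using stereo_mem_group hC₀ hy) u
    have hψ : (conformal C₀ x : ℂ) • ((gnomonic C₀ x)⁻¹).mulVec (spinorH C₀ Φ x) =
        ![Φ (stereo C₀ x), 0] := by
      have hΩ : (conformal C₀ x : ℂ) ≠ 0 := by exact_mod_cast (half_pos hN).ne'
      rw [spinorH, Matrix.mulVec_smul, smul_smul, mul_inv_cancel₀ hΩ, one_smul,
        Matrix.mulVec_mulVec, Matrix.nonsing_inv_mul _ (isUnit_det_gnomonic hx hC₀),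
        Matrix.one_mulVec]
    have hA : DifferentiableAt ℝ A (stereo C₀ x) :=
      (contDiffAt_of_mem_group hc.smooth_form hg).differentiableAt (by simp)
    have hσ : DifferentiableAt ℝ (sigma0 C₀) (stereo C₀ x) :=
      (contDiff_sigma0 C₀).differentiable (by simp) _
    have h1 : extD (gaugeH C₀ A) x v w = dForm (gaugeH C₀ A) x v w := rfl
    have h2 : dForm (gaugeH C₀ A) x v w = _ :=
      dForm_pullback (hA.add (hσ.const_smul (3 / 4 : ℝ))) (contDiffAt_stereo hx) v w
    have h3 := dForm_add hA (hσ.const_smul (3 / 4 : ℝ)) (fderiv ℝ (stereo C₀) x v)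
      (fderiv ℝ (stereo C₀) x w)
    have h4 := hc.curvature _ hg _ (htan v) _ (htan w)
    have h5 := dForm_sigma0_eq hg (htan v) (htan w)
    rw [hψ, modeSource_eq hn hC₀, h1, h2]
    rw [show dForm (A + (3 / 4 : ℝ) • sigma0 C₀) _ _ _ = _ from h3,
      show dForm ((3 / 4 : ℝ) • sigma0 C₀) _ _ _ = _ from dForm_const_smul hσ _ _ _, smul_eq_mul]
    push_cast
    rw [h5, show dForm A = extD A from rfl, h4, wedge_conj_sigma C₀]
    have hI := Complex.I_mul_I
    linear_combination ((C₂ : ℂ) / n * (‖Φ (stereo C₀ x)‖ : ℂ) ^ (2 * n) - C₀ / n + 3 / 4 * C₀) *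
      wedge (sigmaC C₀ (stereo C₀ x) 1) (sigmaC C₀ (stereo C₀ x) 2)
        (fderiv ℝ (stereo C₀) x v) (fderiv ℝ (stereo C₀) x w) * hI

end Flat

/-! ### Holomorphic functions of one variable with prescribed zeros -/

section Disc

open Metric Filter Topology

/-- A nonvanishing holomorphic function on a disc is an exponential. -/
theorem exists_eq_exp_of_ne_zero {h : ℂ → ℂ} {c : ℂ} {r : ℝ}
    (hh : DifferentiableOn ℂ h (ball c r)) (h0 : ∀ z ∈ ball c r, h z ≠ 0) :
    ∃ k : ℂ → ℂ, DifferentiableOn ℂ k (ball c r) ∧ ∀ z ∈ ball c r, h z = Complex.exp (k z) := by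
  rcases le_or_gt r 0 with hr | hr
  · rw [ball_eq_empty.2 hr]
    exact ⟨0, differentiableOn_empty, by simp⟩
  have hc : c ∈ ball c r := mem_ball_self hr
  have hex : Complex.IsExactOn (fun z => deriv h z / h z) (ball c r) :=
    ((hh.deriv isOpen_ball).div hh h0).isExactOn_ball
  obtain ⟨k, hk⟩ := hex
  have hd : ∀ z ∈ ball c r, HasDerivAt (fun z => h z * Complex.exp (-k z)) 0 z := by
    intro z hz
    have h1 := (hh.differentiableAt (isOpen_ball.mem_nhds hz)).hasDerivAt
    have h2 := ((hk z hz).neg).cexp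
    refine (h1.mul h2).congr_deriv ?_
    have := h0 z hz
    simp only [Pi.neg_apply]
    field_simp
    ring
  have hconst : ∀ z ∈ ball c r, h z * Complex.exp (-k z) = h c * Complex.exp (-k c) := by
    intro z hz
    exact isOpen_ball.is_const_of_deriv_eq_zero (convex_ball c r).isPreconnected
      (fun y hy => (hd y hy).differentiableAt.differentiableWithinAt)
      (fun y hy => (hd y hy).deriv) hz hc
  refine ⟨fun z => k z + (Complex.log (h c) - k c), fun z hz =>
    ((hk z hz).differentiableAt.add_const _).differentiableWithinAt, fun z hz => ?_⟩
  have h1 := hconst z hz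
  rw [Complex.exp_add, Complex.exp_sub, Complex.exp_log (h0 c hc)]
  rw [Complex.exp_neg, Complex.exp_neg] at h1
  have e1 := Complex.exp_ne_zero (k z)
  have e2 := Complex.exp_ne_zero (k c)
  field_simp at h1 ⊢
  linear_combination h1

/-- Taylor approximation of a holomorphic function on a smaller disc by an entire one. -/
theorem exists_differentiable_norm_sub_le {h : ℂ → ℂ} {s r : ℝ} (hs : 0 < s) (hsr : s < r)
    (hh : DifferentiableOn ℂ h (ball 0 r)) {ε : ℝ} (hε : 0 < ε) :
    ∃ t : ℂ → ℂ, Differentiable ℂ t ∧ ∀ z ∈ ball (0 : ℂ) s, ‖h z - t z‖ ≤ ε := by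
  obtain ⟨r', hr1, hr2⟩ := exists_between hsr
  lift r' to NNReal using (hs.trans hr1).le
  lift s to NNReal using hs.le
  have hp := (hh.mono (closedBall_subset_ball hr2)).hasFPowerSeriesOnBall
    (by exact_mod_cast hs.trans hr1)
  have hu := hp.tendstoUniformlyOn (r' := s) (by exact_mod_cast hr1)
  obtain ⟨N, hN⟩ := ((Metric.tendstoUniformlyOn_iff.1 hu) ε hε).exists
  refine ⟨(cauchyPowerSeries h 0 r').partialSum N, ?_, fun z hz => ?_⟩
  · unfold FormalMultilinearSeries.partialSum
    simp only [FormalMultilinearSeries.apply_eq_pow_smul_coeff]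
    fun_prop
  · have := hN z hz
    rw [zero_add, dist_eq_norm] at this
    exact this.le

/-- Vanishing of the first cohomology of an exhaustion of a disc by concentric discs. -/
theorem exists_sub_succ_eq {s : ℕ → ℝ} (hs0 : ∀ k, 0 < s k) (hs : StrictMono s) {h : ℕ → ℂ → ℂ}
    (hh : ∀ k, DifferentiableOn ℂ (h k) (ball 0 (s (k + 1)))) :
    ∃ c : ℕ → ℂ → ℂ, ∀ k, DifferentiableOn ℂ (c k) (ball 0 (s k)) ∧
      ∀ z ∈ ball (0 : ℂ) (s k), c k z - c (k + 1) z = h k z := by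
  choose t ht htle using fun k => exists_differentiable_norm_sub_le (hs0 k)
    (hs (Nat.lt_succ_self k)) (hh k) (ε := (1 / 2 : ℝ) ^ k) (by positivity)
  have hsum : Summable fun k : ℕ => (1 / 2 : ℝ) ^ k := summable_geometric_two
  have hbound : ∀ k j, ∀ z ∈ ball (0 : ℂ) (s k), ‖h (j + k) z - t (j + k) z‖ ≤ (1 / 2 : ℝ) ^ j := by
    intro k j z hz
    refine (htle (j + k) z (ball_subset_ball (hs.monotone (Nat.le_add_left k j)) hz)).trans ?_
    exact pow_le_pow_of_le_one (by norm_num) (by norm_num) (Nat.le_add_right j k)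
  refine ⟨fun k z => ∑' j, (h (j + k) z - t (j + k) z) - ∑ j ∈ Finset.range k, t j z,
    fun k => ⟨?_, fun z hz => ?_⟩⟩
  · refine DifferentiableOn.sub ?_ ?_
    · refine Complex.differentiableOn_tsum_of_summable_norm hsum (fun j => ?_) isOpen_ball
        (fun j z hz => hbound k j z hz)
      refine DifferentiableOn.sub ((hh (j + k)).mono (ball_subset_ball (hs.monotone ?_)))
        (ht _).differentiableOn
      omega
    · exact DifferentiableOn.fun_sum fun j _ => (ht j).differentiableOn
  · have h1 : Summable fun j => h (j + k) z - t (j + k) z :=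
      Summable.of_norm_bounded hsum fun j => hbound k j z hz
    have h2 := h1.tsum_eq_zero_add
    simp only [zero_add] at h2
    simp only [h2, Finset.sum_range_succ, add_right_comm _ 1 k, ← add_assoc]
    ring

/-- Functions on an increasing sequence of sets which extend each other have a common extension. -/
theorem exists_eqOn_of_forall_succ {B : ℕ → Set ℂ} (hB : Monotone B) {a : ℕ → ℂ → ℂ}
    (ha : ∀ k, ∀ z ∈ B k, a (k + 1) z = a k z) : ∃ b : ℂ → ℂ, ∀ k, Set.EqOn b (a k) (B k) := by
  classical
  have hj : ∀ j k, ∀ z ∈ B k, a (k + j) z = a k z := by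
    intro j k z hz
    induction j with
    | zero => rfl
    | succ j ih => rw [← ih, ← add_assoc]; exact ha _ z (hB (Nat.le_add_right k j) hz)
  refine ⟨fun z => if hz : ∃ k, z ∈ B k then a (Nat.find hz) z else 0, fun k z hz => ?_⟩
  have hex : ∃ k, z ∈ B k := ⟨k, hz⟩
  simp only [hex, dif_pos]
  have h1 := hj (k - Nat.find hex) (Nat.find hex) z (Nat.find_spec hex)
  rw [Nat.add_sub_cancel' (Nat.find_min' hex hz)] at h1
  exact h1.symm

/-- The order of vanishing of a product of powers of linear factors. -/
theorem analyticOrderAt_prod_sub_pow (S : Finset ℂ) (m : ℂ → ℕ) (p : ℂ) :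
    analyticOrderAt (fun z => ∏ q ∈ S, (z - q) ^ m q) p = if p ∈ S then (m p : ℕ∞) else 0 := by
  classical
  induction S using Finset.induction_on with
  | empty =>
    simp only [Finset.prod_empty, Finset.notMem_empty, if_false]
    exact analyticAt_const.analyticOrderAt_eq_zero.2 one_ne_zero
  | insert q S hq ih =>
    have h1 : AnalyticAt ℂ (fun z : ℂ => (z - q) ^ m q) p := by fun_prop
    have h2 : AnalyticAt ℂ (fun z : ℂ => ∏ q ∈ S, (z - q) ^ m q) p := by fun_prop
    have h3 : (fun z => ∏ q ∈ insert q S, (z - q) ^ m q) =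
        (fun z : ℂ => (z - q) ^ m q) * fun z : ℂ => ∏ q ∈ S, (z - q) ^ m q := by
      funext z
      simp [Finset.prod_insert hq]
    rw [h3, analyticOrderAt_mul h1 h2, ih]
    by_cases hpq : p = q
    · subst hpq
      have h4 : analyticOrderAt (fun z : ℂ => (z - p) ^ m p) p = m p :=
        analyticOrderAt_centeredMonomial
      simp [h4, hq]
    · have h4 : analyticOrderAt (fun z : ℂ => (z - q) ^ m q) p = 0 :=
        h1.analyticOrderAt_eq_zero.2 (pow_ne_zero _ (sub_ne_zero.2 hpq))
      simp [h4, hpq]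

/-- **Weierstrass' theorem** on the unit disc: every effective divisor is the divisor of a
holomorphic function. -/
theorem exists_analyticOrderAt_eq {m : ℂ → ℕ}
    (hm : ∀ r < 1, {p ∈ closedBall (0 : ℂ) r | m p ≠ 0}.Finite) :
    ∃ a : ℂ → ℂ, DifferentiableOn ℂ a (ball 0 1) ∧
      ∀ p ∈ ball (0 : ℂ) 1, analyticOrderAt a p = m p := by
  classical
  let s : ℕ → ℝ := fun k => 1 - 1 / (k + 2)
  have hs1 : ∀ k, s k < 1 := fun k => by
    have : (0 : ℝ) < 1 / ((k : ℝ) + 2) := by positivity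
    simp only [s]; linarith
  have hs0 : ∀ k, 0 < s k := fun k => by
    have : 1 / ((k : ℝ) + 2) < 1 := by
      rw [div_lt_one (by positivity)]
      have : (0 : ℝ) ≤ k := k.cast_nonneg
      linarith
    simp only [s]; linarith
  have hs : StrictMono s := strictMono_nat_of_lt_succ fun k => by
    have : 1 / (((k + 1 : ℕ) : ℝ) + 2) < 1 / ((k : ℝ) + 2) := by
      apply one_div_lt_one_div_of_lt
      · positivity
      · push_cast; linarith
    simp only [s]; linarith
  have hexh : ∀ z ∈ ball (0 : ℂ) 1, ∃ k, z ∈ ball (0 : ℂ) (s k) := by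
    intro z hz
    rw [mem_ball_zero_iff] at hz
    obtain ⟨k, hk⟩ := exists_nat_one_div_lt (sub_pos.2 hz)
    refine ⟨k, ?_⟩
    rw [mem_ball_zero_iff]
    have : 1 / ((k : ℝ) + 2) ≤ 1 / ((k : ℝ) + 1) := by
      apply one_div_le_one_div_of_le
      · positivity
      · linarith
    simp only [s]; linarith
  let S : ℕ → Finset ℂ := fun k => (hm (s (k + 1)) (hs1 _)).toFinset
  have hS : ∀ k p, p ∈ S k ↔ p ∈ closedBall (0 : ℂ) (s (k + 1)) ∧ m p ≠ 0 := fun k p => by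
    simp [S]
  have hSm : ∀ k, S k ⊆ S (k + 1) := fun k p hp => by
    rw [hS] at hp ⊢
    exact ⟨closedBall_subset_closedBall (hs.monotone (Nat.le_succ _)) hp.1, hp.2⟩
  let P : ℕ → ℂ → ℂ := fun k z => ∏ q ∈ S k, (z - q) ^ m q
  have hP : ∀ k, Differentiable ℂ (P k) := fun k => by
    simp only [P]
    fun_prop
  -- Consecutive partial products differ by an exponential.
  have hN : ∀ k, ∃ h : ℂ → ℂ, DifferentiableOn ℂ h (ball 0 (s (k + 1))) ∧
      ∀ z ∈ ball (0 : ℂ) (s (k + 1)), ∏ q ∈ S (k + 1) \ S k, (z - q) ^ m q = Complex.exp (h z) := by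
    intro k
    refine exists_eq_exp_of_ne_zero (by fun_prop) fun z hz => ?_
    refine Finset.prod_ne_zero_iff.2 fun q hq => pow_ne_zero _ (sub_ne_zero.2 ?_)
    rintro rfl
    rw [Finset.mem_sdiff, hS, hS] at hq
    exact hq.2 ⟨ball_subset_closedBall hz, hq.1.2⟩
  choose h hh hexp using hN
  obtain ⟨c, hc⟩ := exists_sub_succ_eq hs0 hs hh
  obtain ⟨a, ha⟩ := exists_eqOn_of_forall_succ (B := fun k => ball (0 : ℂ) (s k))
    (fun i j hij => ball_subset_ball (hs.monotone hij))
    (a := fun k z => P k z * Complex.exp (c k z)) (fun k z hz => by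
      have h1 := (hc k).2 z hz
      have h2 := hexp k z (ball_subset_ball (hs.monotone (Nat.le_succ k)) hz)
      have h3 : P (k + 1) z = P k z * Complex.exp (h k z) := by
        rw [← h2, mul_comm]
        exact (Finset.prod_sdiff (hSm k)).symm
      simp only [h3, mul_assoc, ← Complex.exp_add, ← h1, sub_add_cancel])
  have hnear : ∀ k, ∀ z ∈ ball (0 : ℂ) (s k), a =ᶠ[𝓝 z] fun z => P k z * Complex.exp (c k z) :=
    fun k z hz => by
      filter_upwards [isOpen_ball.mem_nhds hz] with y hy using ha k hy
  have hcd : ∀ k, ∀ z ∈ ball (0 : ℂ) (s k), AnalyticAt ℂ (fun z => Complex.exp (c k z)) z :=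
    fun k z hz => ((hc k).1.cexp).analyticAt (isOpen_ball.mem_nhds hz)
  refine ⟨a, fun z hz => ?_, fun p hp => ?_⟩
  · obtain ⟨k, hk⟩ := hexh z hz
    exact ((hnear k z hk).differentiableAt_iff.2 ((hP k z).mul
      (hcd k z hk).differentiableAt)).differentiableWithinAt
  · obtain ⟨k, hk⟩ := hexh p hp
    have h1 : AnalyticAt ℂ (P k) p := (hP k).analyticAt p
    have h2 : analyticOrderAt (fun z => Complex.exp (c k z)) p = 0 :=
      (hcd k p hk).analyticOrderAt_eq_zero.2 (Complex.exp_ne_zero _)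
    rw [analyticOrderAt_congr (hnear k p hk)]
    change analyticOrderAt (P k * fun z => Complex.exp (c k z)) p = m p
    rw [analyticOrderAt_mul h1 (hcd k p hk), h2, add_zero]
    refine (analyticOrderAt_prod_sub_pow _ _ _).trans ?_
    split_ifs with hps
    · rfl
    · have : m p = 0 := by
        by_contra hmp
        exact hps ((hS k p).2 ⟨ball_subset_closedBall
          (ball_subset_ball (hs.monotone (Nat.le_succ k)) hk), hmp⟩)
      simp [this]

end Disc

/-! ### Roots and divisors of holomorphic functions -/

section Roots

open Metric Filter Topology

/-- A family of functions `φ p`, each prescribed near its centre `p`, is glued to `z ↦ φ z z` when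
neighbouring members agree off the centres. -/
theorem eventuallyEq_of_forall_punctured {φ : ℂ → ℂ → ℂ} {p : ℂ}
    (h : ∀ᶠ z in 𝓝[≠] p, φ z z = φ p z) : (fun z => φ z z) =ᶠ[𝓝 p] φ p := by
  rw [eventually_nhdsWithin_iff] at h
  filter_upwards [h] with z hz
  by_cases hzp : z = p
  · rw [hzp]
  · exact hz hzp

theorem eventually_ne_zero_of_analyticOrderAt_ne_top {a : ℂ → ℂ} {p : ℂ} (ha : AnalyticAt ℂ a p)
    (h : analyticOrderAt a p ≠ ⊤) : ∀ᶠ z in 𝓝[≠] p, a z ≠ 0 :=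
  ha.eventually_eq_zero_or_eventually_ne_zero.resolve_left fun h' =>
    h (analyticOrderAt_eq_top.2 h')

/-- Two analytic functions with the same order at a point differ by a local unit. -/
theorem exists_eventuallyEq_mul_of_analyticOrderAt_eq {a b : ℂ → ℂ} {p : ℂ} {m : ℕ}
    (ha : AnalyticAt ℂ a p) (hb : AnalyticAt ℂ b p) (ham : analyticOrderAt a p = m)
    (hbm : analyticOrderAt b p = m) :
    ∃ v : ℂ → ℂ, AnalyticAt ℂ v p ∧ v p ≠ 0 ∧ b =ᶠ[𝓝 p] fun z => v z * a z := by
  obtain ⟨u, hu, hu0, hau⟩ := ha.analyticOrderAt_eq_natCast.1 ham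
  obtain ⟨w, hw, hw0, hbw⟩ := hb.analyticOrderAt_eq_natCast.1 hbm
  refine ⟨fun z => w z / u z, hw.div hu hu0, div_ne_zero hw0 hu0, ?_⟩
  filter_upwards [hau, hbw, hu.continuousAt.eventually_ne hu0] with z h1 h2 h3
  rw [h1, h2, smul_eq_mul, smul_eq_mul]
  field_simp

/-- Two holomorphic functions with the same divisor differ by a nonvanishing one. -/
theorem exists_eq_mul_of_analyticOrderAt_eq {D : Set ℂ} (hD : IsOpen D) {a b : ℂ → ℂ}
    {m : ℂ → ℕ} (ha : AnalyticOnNhd ℂ a D) (hb : AnalyticOnNhd ℂ b D)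
    (ham : ∀ p ∈ D, analyticOrderAt a p = m p) (hbm : ∀ p ∈ D, analyticOrderAt b p = m p) :
    ∃ h : ℂ → ℂ, DifferentiableOn ℂ h D ∧ ∀ z ∈ D, h z ≠ 0 ∧ b z = h z * a z := by
  have hloc : ∀ p, ∃ v : ℂ → ℂ, p ∈ D →
      AnalyticAt ℂ v p ∧ v p ≠ 0 ∧ b =ᶠ[𝓝 p] fun z => v z * a z := by
    intro p
    by_cases hp : p ∈ D
    · obtain ⟨v, hv⟩ := exists_eventuallyEq_mul_of_analyticOrderAt_eq (ha p hp) (hb p hp)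
        (ham p hp) (hbm p hp)
      exact ⟨v, fun _ => hv⟩
    · exact ⟨0, fun h => (hp h).elim⟩
  choose v hv using hloc
  have hglue : ∀ p ∈ D, (fun z => v z z) =ᶠ[𝓝 p] v p := by
    intro p hp
    obtain ⟨-, -, hb1⟩ := hv p hp
    refine eventuallyEq_of_forall_punctured ?_
    filter_upwards [eventually_ne_zero_of_analyticOrderAt_ne_top (ha p hp) (by simp [ham p hp]),
      nhdsWithin_le_nhds hb1, nhdsWithin_le_nhds (hD.mem_nhds hp)] with z h1 h2 h3
    exact mul_right_cancel₀ h1 ((hv z h3).2.2.self_of_nhds.symm.trans h2)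
  refine ⟨fun z => v z z, fun p hp => ?_, fun z hz => ⟨(hv z hz).2.1, (hv z hz).2.2.self_of_nhds⟩⟩
  exact ((hglue p hp).differentiableAt_iff.2 (hv p hp).1.differentiableAt).differentiableWithinAt

/-- A locally finite set of points meets a compact set in a finite set. -/
theorem finite_of_forall_eventually_eq_zero {K : Set ℂ} (hK : IsCompact K) {m : ℂ → ℕ}
    (hm : ∀ p ∈ K, ∀ᶠ z in 𝓝[≠] p, m z = 0) : {p ∈ K | m p ≠ 0}.Finite := by
  by_contra hinf
  obtain ⟨p, hp, hacc⟩ := Set.Infinite.exists_accPt_of_subset_isCompact hinf hK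
    (fun p hp => hp.1)
  rw [accPt_iff_frequently_nhdsNE] at hacc
  obtain ⟨z, hz1, hz2⟩ := (hacc.and_eventually (hm p hp)).exists
  exact hz1.2 hz2

theorem analyticOnNhd_ball {a : ℂ → ℂ} {c : ℂ} {r : ℝ} (ha : DifferentiableOn ℂ a (ball c r)) :
    AnalyticOnNhd ℂ a (ball c r) :=
  ha.analyticOnNhd isOpen_ball

/-- A holomorphic function on the unit disc all of whose zeros have order divisible by `n` is an
`n`-th power. -/
theorem exists_pow_eq_of_dvd_analyticOrderAt {n : ℕ} (hn : 0 < n) {W : ℂ → ℂ}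
    (hW : DifferentiableOn ℂ W (ball 0 1))
    (hdvd : ∀ p ∈ ball (0 : ℂ) 1, ∀ m : ℕ, analyticOrderAt W p = m → n ∣ m) :
    ∃ g : ℂ → ℂ, DifferentiableOn ℂ g (ball 0 1) ∧ ∀ z ∈ ball (0 : ℂ) 1, g z ^ n = W z := by
  have hWa := analyticOnNhd_ball hW
  have h00 : (0 : ℂ) ∈ ball (0 : ℂ) 1 := by simp
  by_cases htop : analyticOrderAt W 0 = ⊤
  · refine ⟨0, differentiableOn_const 0, fun z hz => ?_⟩
    have := hWa.eqOn_zero_of_preconnected_of_eventuallyEq_zero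
      (convex_ball (0 : ℂ) 1).isPreconnected h00 (analyticOrderAt_eq_top.1 htop) hz
    rw [this]
    simp [hn.ne']
  have hfin : ∀ p ∈ ball (0 : ℂ) 1, analyticOrderAt W p ≠ ⊤ := fun p hp =>
    hWa.analyticOrderAt_ne_top_of_isPreconnected (convex_ball (0 : ℂ) 1).isPreconnected h00 hp htop
  have hcast : ∀ p ∈ ball (0 : ℂ) 1, analyticOrderAt W p = analyticOrderNatAt W p := fun p hp =>
    (Nat.cast_analyticOrderNatAt (hfin p hp)).symm
  have hnat : ∀ p ∈ ball (0 : ℂ) 1, n * (analyticOrderNatAt W p / n) = analyticOrderNatAt W p :=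
    fun p hp => Nat.mul_div_cancel' (hdvd p hp _ (hcast p hp))
  obtain ⟨a, ha, hao⟩ := exists_analyticOrderAt_eq (m := fun p => analyticOrderNatAt W p / n)
    (fun r hr => by
      refine finite_of_forall_eventually_eq_zero (isCompact_closedBall 0 r) fun p hp => ?_
      have hp1 : p ∈ ball (0 : ℂ) 1 := closedBall_subset_ball hr hp
      filter_upwards [eventually_ne_zero_of_analyticOrderAt_ne_top (hWa p hp1) (hfin p hp1)]
        with z hz
      have : analyticOrderAt W z = 0 := analyticOrderAt_eq_zero.2 (Or.inr hz)
      simp [analyticOrderNatAt, this])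
  have haa := analyticOnNhd_ball ha
  obtain ⟨h, hh, hh0⟩ := exists_eq_mul_of_analyticOrderAt_eq isOpen_ball
    (m := fun p => analyticOrderNatAt W p)
    (haa.pow n) hWa (fun p hp => by
      rw [analyticOrderAt_pow (haa p hp), hao p hp, nsmul_eq_mul]
      exact_mod_cast hnat p hp) hcast
  obtain ⟨k, hk, hke⟩ := exists_eq_exp_of_ne_zero hh fun z hz => (hh0 z hz).1
  refine ⟨fun z => Complex.exp (k z / n) * a z, ((hk.div_const _).cexp).mul ha, fun z hz => ?_⟩
  have hn' : (n : ℂ) ≠ 0 := by exact_mod_cast hn.ne'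
  rw [(hh0 z hz).2, hke z hz, mul_pow, ← Complex.exp_nat_mul, mul_div_cancel₀ _ hn']
  rfl

/-- A continuous `n`-th root of `w`, up to a continuous nonvanishing factor, forces the order of
vanishing of `w` to be divisible by `n`: compare winding numbers around the zero. -/
theorem dvd_of_eventually_eq_pow_mul {n m : ℕ} (hn : 0 < n) {w φ q : ℂ → ℂ}
    (hw : AnalyticAt ℂ w 0) (hm : analyticOrderAt w 0 = m) (hφ : ∀ᶠ ζ in 𝓝 0, ContinuousAt φ ζ)
    (hq : ∀ᶠ ζ in 𝓝 0, ContinuousAt q ζ) (hq0 : q 0 ≠ 0)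
    (h : ∀ᶠ ζ in 𝓝 0, w ζ = φ ζ ^ n * q ζ) : n ∣ m := by
  obtain ⟨u, hu, hu0, hwu⟩ := hw.analyticOrderAt_eq_natCast.1 hm
  have hn' : (n : ℂ) ≠ 0 := by exact_mod_cast hn.ne'
  have hρ0 : q 0 / u 0 ≠ 0 := div_ne_zero hq0 hu0
  have hρc : ∀ᶠ ζ in 𝓝 0, ContinuousAt (fun ζ => q ζ / u ζ / (q 0 / u 0)) ζ := by
    filter_upwards [hq, hu.eventually_analyticAt, hu.continuousAt.eventually_ne hu0]
      with ζ h1 h2 h3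
    exact (h1.div h2.continuousAt h3).div_const _
  have hslit : ∀ᶠ ζ in 𝓝 0, q ζ / u ζ / (q 0 / u 0) ∈ Complex.slitPlane := by
    refine hρc.self_of_nhds.eventually_mem (Complex.isOpen_slitPlane.mem_nhds ?_)
    rw [div_self hρ0]
    exact Complex.one_mem_slitPlane
  obtain ⟨κ, hκ⟩ := IsAlgClosed.exists_pow_nat_eq (q 0 / u 0) hn
  -- Near `0` the function `ψ` is a continuous `n`-th root of `ζ ^ m`.
  let ψ : ℂ → ℂ := fun ζ => φ ζ * (κ * Complex.exp (Complex.log (q ζ / u ζ / (q 0 / u 0)) / n))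
  have hψ : ∀ᶠ ζ in 𝓝 0, ContinuousAt ψ ζ ∧ ψ ζ ^ n = ζ ^ m := by
    filter_upwards [hφ, hρc, hslit, h, hwu, hu.continuousAt.eventually_ne hu0]
      with ζ h1 h2 h3 h4 h5 h6
    refine ⟨h1.mul (continuousAt_const.mul ((h2.clog h3).div_const _).cexp), ?_⟩
    have h7 := h4.symm.trans h5
    rw [sub_zero, smul_eq_mul] at h7
    simp only [ψ]
    rw [mul_pow, mul_pow, hκ, ← Complex.exp_nat_mul, mul_div_cancel₀ _ hn',
      Complex.exp_log (Complex.slitPlane_ne_zero h3), mul_div_cancel₀ _ hρ0, ← mul_div_assoc, h7,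
      mul_div_cancel_right₀ _ h6]
  obtain ⟨ε, hε, hball⟩ := Metric.eventually_nhds_iff_ball.1 hψ
  have hcirc : ∀ θ : ℝ, ((ε / 2 : ℝ) : ℂ) * Complex.exp (θ * Complex.I) ∈ ball (0 : ℂ) ε := by
    intro θ
    rw [mem_ball_zero_iff, norm_mul, Complex.norm_exp_ofReal_mul_I, mul_one, Complex.norm_real,
      Real.norm_of_nonneg (half_pos hε).le]
    exact half_lt_self hε
  -- On a circle `ψ` differs from the multivalued root `ζ ^ (m / n)` by `k`, which is continuous
  -- with finitely many values; hence `exp (2 π i m / n) = 1`.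
  let k : ℝ → ℂ := fun θ => ψ (((ε / 2 : ℝ) : ℂ) * Complex.exp (θ * Complex.I)) *
    Complex.exp (-(m * (θ * Complex.I) / n))
  have hkc : Continuous k := by
    refine Continuous.mul ?_ (by fun_prop)
    rw [continuous_iff_continuousAt]
    intro θ
    have hin : Continuous fun θ : ℝ => ((ε / 2 : ℝ) : ℂ) * Complex.exp (θ * Complex.I) := by
      fun_prop
    exact ContinuousAt.comp (f := fun θ : ℝ => ((ε / 2 : ℝ) : ℂ) * Complex.exp (θ * Complex.I))
      (hball _ (hcirc θ)).1 hin.continuousAt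
  have hkn : ∀ θ, k θ ^ n = ((ε / 2 : ℝ) : ℂ) ^ m := by
    intro θ
    simp only [k]
    rw [mul_pow, (hball _ (hcirc θ)).2, mul_pow, ← Complex.exp_nat_mul, ← Complex.exp_nat_mul,
      mul_assoc, ← Complex.exp_add, mul_neg, mul_div_cancel₀ _ hn', add_neg_cancel,
      Complex.exp_zero, mul_one]
  have hfin : {z : ℂ | z ^ n = ((ε / 2 : ℝ) : ℂ) ^ m}.Finite := by
    refine (Polynomial.nthRoots n (((ε / 2 : ℝ) : ℂ) ^ m)).toFinset.finite_toSet.subset ?_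
    intro z hz
    simpa [Polynomial.mem_nthRoots hn] using hz
  have hconst : k (2 * Real.pi) = k 0 := by
    exact isPreconnected_univ.constant_of_mapsTo hfin.isDiscrete hkc.continuousOn (fun θ _ => hkn θ)
      (Set.mem_univ _) (Set.mem_univ _)
  have hk0 : k 0 ≠ 0 := by
    intro h0
    have := hkn 0
    rw [h0, zero_pow hn.ne'] at this
    exact pow_ne_zero m (by exact_mod_cast (half_pos hε).ne') this.symm
  simp only [k] at hconst hk0
  have e1 : Complex.exp (((2 * Real.pi : ℝ) : ℂ) * Complex.I) =
      Complex.exp (((0 : ℝ) : ℂ) * Complex.I) := by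
    push_cast
    rw [Complex.exp_two_pi_mul_I]
    simp
  rw [e1] at hconst
  have h8 := mul_left_cancel₀ (left_ne_zero_of_mul hk0) hconst
  rw [Complex.exp_eq_exp_iff_exists_int] at h8
  obtain ⟨N, hN⟩ := h8
  have h9 : (m : ℂ) = n * (-N) := by
    push_cast at hN
    field_simp at hN
    apply mul_left_cancel₀ (show (Real.pi : ℂ) ≠ 0 by exact_mod_cast Real.pi_ne_zero)
    linear_combination (-1 / 2) * hN
  have h10 : (m : ℤ) = n * (-N) := by exact_mod_cast h9
  exact Int.natCast_dvd_natCast.1 ⟨-N, h10⟩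

/-- An entire function of polynomial growth is a polynomial (generalised Liouville theorem). -/
theorem exists_polynomial_of_isBigO {N : ℕ} {f : ℂ → ℂ} (hf : Differentiable ℂ f)
    (hN : f =O[Bornology.cobounded ℂ] fun z => z ^ N) :
    ∃ P : Polynomial ℂ, ∀ z, f z = P.eval z := by
  induction N generalizing f with
  | zero =>
    simp only [pow_zero] at hN
    obtain ⟨C, hC⟩ := hN.bound
    obtain ⟨R, -, hR⟩ := (hasBasis_cobounded_norm (E := ℂ)).eventually_iff.1 hC
    obtain ⟨M, hM⟩ := (isCompact_closedBall (0 : ℂ) R).exists_bound_of_continuousOn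
      hf.continuous.continuousOn
    have hb : Bornology.IsBounded (Set.range f) := by
      refine isBounded_iff_forall_norm_le.2 ⟨max C M, ?_⟩
      rintro _ ⟨z, rfl⟩
      rcases le_total R ‖z‖ with h | h
      · have := hR h
        simp at this
        exact this.trans (le_max_left _ _)
      · exact (hM z (by simpa using h)).trans (le_max_right _ _)
    exact ⟨Polynomial.C (f 0), fun z => by
      rw [Polynomial.eval_C]; exact hf.apply_eq_apply_of_bounded hb z 0⟩
  | succ N ih =>
    have hg : Differentiable ℂ (dslope f 0) := by
      rw [← differentiableOn_univ] at hf ⊢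
      exact (Complex.differentiableOn_dslope univ_mem).2 hf
    have heq : ∀ z, f z = f 0 + z * dslope f 0 z := by
      intro z
      have := sub_smul_dslope f 0 z
      rw [sub_zero, smul_eq_mul] at this
      rw [this]
      ring
    obtain ⟨P, hP⟩ := ih hg (by
      have hne : ∀ᶠ z : ℂ in Bornology.cobounded ℂ, z ≠ 0 :=
        Bornology.eventually_ne_cobounded 0
      have h1 : (fun z => f z - f 0) =O[Bornology.cobounded ℂ] fun z => z ^ (N + 1) := by
        refine hN.sub (Asymptotics.isLittleO_const_left.2 (Or.inr ?_)).isBigO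
        simp only [Function.comp_def, norm_pow]
        exact (tendsto_pow_atTop (Nat.succ_ne_zero N)).comp tendsto_norm_cobounded_atTop
      have h2 := h1.mul (Asymptotics.isBigO_refl (fun z : ℂ => z⁻¹) (Bornology.cobounded ℂ))
      refine (h2.congr' ?_ ?_)
      · filter_upwards [hne] with z hz
        rw [heq z]
        field_simp
        ring
      · filter_upwards [hne] with z hz
        field_simp
        ring)
    exact ⟨Polynomial.C (f 0) + Polynomial.X * P, fun z => by simp [heq z, hP]⟩

end Roots

/-! ### Homogeneous coordinates of a holomorphic map -/

section Represents

open Filter Topology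

/-- The determinant of two vectors of `ℂ²`. -/
def cross (a b : ℂ × ℂ) : ℂ := a.1 * b.2 - a.2 * b.1

theorem exists_smul_eq_of_cross_eq_zero {a b : ℂ × ℂ} (ha : a ≠ 0) (h : cross a b = 0) :
    ∃ c : ℂ, c • a = b := by
  unfold cross at h
  by_cases h1 : a.1 = 0
  · have h2 : a.2 ≠ 0 := fun h2 => ha (Prod.ext h1 h2)
    refine ⟨b.2 / a.2, Prod.ext ?_ ?_⟩
    · rw [h1] at h
      have h3 : b.1 = 0 := by simpa [h2] using h
      simp [h1, h3]
    · simp [h2]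
  · refine ⟨b.1 / a.1, Prod.ext ?_ ?_⟩
    · simp [h1]
    · simp only [Prod.smul_snd, smul_eq_mul]
      field_simp
      linear_combination -h

theorem mem_cone_of_cross_eq_zero {C : ℝ} {a b : ℂ × ℂ} (ha : a ∈ cone C) (hb : b ≠ 0)
    (h : cross a b = 0) : b ∈ cone C := by
  obtain ⟨c, rfl⟩ := exists_smul_eq_of_cross_eq_zero (ne_zero_of_mem_cone ha) h
  have hc : c ≠ 0 := by rintro rfl; simp at hb
  have h1 : 0 < form C a := ha
  show 0 < form C (c • a)
  rw [form_smul]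
  have : 0 < ‖c‖ := norm_pos_iff.2 hc
  positivity

theorem proj_eq_proj_iff {C : ℝ} {a b : ℂ × ℂ} (ha : a ∈ cone C) (hb : b ∈ cone C) :
    proj C a ha = proj C b hb ↔ cross a b = 0 := by
  refine Subtype.ext_iff.trans ((Projectivization.mk_eq_mk_iff' ℂ a b _ _).trans ⟨?_, fun h => ?_⟩)
  · rintro ⟨c, rfl⟩
    simp [cross]
    ring
  · refine exists_smul_eq_of_cross_eq_zero (ne_zero_of_mem_cone hb) ?_
    unfold cross at h ⊢
    linear_combination -h

variable {C₀ C₂ : ℝ} {f : Surface C₀ → Surface C₂}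

/-- In homogeneous coordinates, `f` maps `[z]` to `[w]`. -/
def Represents (f : Surface C₀ → Surface C₂) (z w : ℂ × ℂ) : Prop :=
  ∃ (hz : z ∈ cone C₀) (hw : w ∈ cone C₂), f (proj C₀ z hz) = proj C₂ w hw

theorem Represents.cross_eq_zero {z w w' : ℂ × ℂ} (h : Represents f z w)
    (h' : Represents f z w') : cross w w' = 0 := by
  obtain ⟨hz, hw, e⟩ := h
  obtain ⟨hz', hw', e'⟩ := h'
  exact (proj_eq_proj_iff hw hw').1 (e.symm.trans e')

theorem Represents.congr_right {z w w' : ℂ × ℂ} (h : Represents f z w) (hw' : w' ≠ 0)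
    (hc : cross w w' = 0) : Represents f z w' := by
  obtain ⟨hz, hw, e⟩ := h
  have hw'c := mem_cone_of_cross_eq_zero hw hw' hc
  exact ⟨hz, hw'c, e.trans ((proj_eq_proj_iff hw hw'c).2 hc)⟩

theorem Represents.congr_left {z z' w : ℂ × ℂ} (h : Represents f z w) (hz' : z' ≠ 0)
    (hc : cross z z' = 0) : Represents f z' w := by
  obtain ⟨hz, hw, e⟩ := h
  have hz'c := mem_cone_of_cross_eq_zero hz hz' hc
  exact ⟨hz'c, hw, ((congrArg f ((proj_eq_proj_iff hz hz'c).2 hc)).symm).trans e⟩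

theorem Represents.ne_zero {z w : ℂ × ℂ} (h : Represents f z w) : w ≠ 0 :=
  ne_zero_of_mem_cone h.2.1

theorem wronskian_add_smul (a b : ℂ × ℂ) (ζ : ℂ) :
    wronskian (fun ξ => a + ξ • b) ζ = cross a b := by
  have h1 : deriv (fun ξ : ℂ => (a + ξ • b).1) ζ = b.1 := by
    simp
  have h2 : deriv (fun ξ : ℂ => (a + ξ • b).2) ζ = b.2 := by
    simp
  rw [wronskian, h1, h2]
  simp [cross]
  ring

theorem eventually_add_smul_mem_cone {a : ℂ × ℂ} (ha : a ∈ cone C₀) (b : ℂ × ℂ) :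
    ∀ᶠ ζ : ℂ in 𝓝 0, a + ζ • b ∈ cone C₀ := by
  have hc : ContinuousAt (fun ζ : ℂ => a + ζ • b) 0 := by fun_prop
  exact hc.eventually_mem (by simpa using cone_mem_nhds ha)

/-- A holomorphic map is given by holomorphic homogeneous coordinates along any affine line of
homogeneous coordinates of the source. -/
theorem IsHolomorphicMap.exists_represents_line (hf : IsHolomorphicMap f) {a b : ℂ × ℂ}
    (ha : a ∈ cone C₀) (hab : cross a b ≠ 0) :
    ∃ F : ℂ → ℂ × ℂ, AnalyticAt ℂ F 0 ∧ ∀ᶠ ζ : ℂ in 𝓝 0, Represents f (a + ζ • b) (F ζ) := by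
  obtain ⟨s, F, hs⟩ := hf (proj C₀ a ha)
  obtain ⟨hs0, hcentre⟩ := hs.centre
  have hsa := (proj_eq_proj_iff hs0 ha).1 hcentre
  obtain ⟨c, hc⟩ := exists_smul_eq_of_cross_eq_zero (ne_zero_of_mem_cone ha)
    (show cross a (s 0) = 0 by unfold cross at hsa ⊢; linear_combination -hsa)
  have hc0 : c ≠ 0 := by
    rintro rfl
    exact ne_zero_of_mem_cone hs0 (by rw [← hc, zero_smul])
  have hs1 : AnalyticAt ℂ (fun ξ => (s ξ).1) 0 := analyticAt_fst.comp hs.analytic_s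
  have hs2 : AnalyticAt ℂ (fun ξ => (s ξ).2) 0 := analyticAt_snd.comp hs.analytic_s
  -- The affine coordinate of `[s ζ]` on the line through `a` in direction `b`.
  let α : ℂ → ℂ := fun ζ => (s ζ).1 * b.2 - (s ζ).2 * b.1
  let β : ℂ → ℂ := fun ζ => a.1 * (s ζ).2 - a.2 * (s ζ).1
  have hα : AnalyticAt ℂ α 0 := (hs1.mul analyticAt_const).sub (hs2.mul analyticAt_const)
  have hβ : AnalyticAt ℂ β 0 := (analyticAt_const.mul hs2).sub (analyticAt_const.mul hs1)
  have hα0 : α 0 ≠ 0 := by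
    have : α 0 = c * cross a b := by
      simp only [α, ← hc, cross, Prod.smul_fst, Prod.smul_snd, smul_eq_mul]
      ring
    rw [this]
    exact mul_ne_zero hc0 hab
  have hβ0 : β 0 = 0 := by
    simp only [β]
    unfold cross at hsa
    linear_combination -hsa
  have ht : AnalyticAt ℂ (fun ζ => β ζ / α ζ) 0 := hβ.div hα hα0
  have hβ' : HasDerivAt β (a.1 * deriv (fun ξ => (s ξ).2) 0 - a.2 * deriv (fun ξ => (s ξ).1) 0) 0 :=
    (hs2.differentiableAt.hasDerivAt.const_mul _).sub (hs1.differentiableAt.hasDerivAt.const_mul _)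
  have hw := hs.immersive
  rw [wronskian, ← hc] at hw
  simp only [Prod.smul_fst, Prod.smul_snd, smul_eq_mul] at hw
  have ht' : deriv (fun ζ => β ζ / α ζ) 0 ≠ 0 := by
    have h1 := (hβ'.div hα.differentiableAt.hasDerivAt hα0).deriv
    have h1' : deriv (fun ζ => β ζ / α ζ) 0 = _ := h1
    rw [h1', hβ0, zero_mul, sub_zero]
    refine div_ne_zero (mul_ne_zero (fun h => hw ?_) hα0) (pow_ne_zero _ hα0)
    linear_combination c * h
  let k := ht.hasStrictDerivAt.localInverse _ _ _ ht'
  have ht0 : β 0 / α 0 = 0 := by rw [hβ0, zero_div]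
  have hk : AnalyticAt ℂ k 0 := by
    have := ht.analyticAt_localInverse ht'
    rwa [ht0] at this
  have hk0 : k 0 = 0 := by
    have : k (β 0 / α 0) = 0 := HasStrictFDerivAt.localInverse_apply_image ..
    rwa [ht0] at this
  have hkr : ∀ᶠ ζ in 𝓝 0, β (k ζ) / α (k ζ) = ζ := by
    have := ht.hasStrictDerivAt.eventually_right_inverse ht'
    rwa [ht0] at this
  have hkc : Tendsto k (𝓝 0) (𝓝 0) := by
    have := hk.continuousAt
    rwa [ContinuousAt, hk0] at this
  refine ⟨F ∘ k, AnalyticAt.comp (by rw [hk0]; exact hs.analytic_F) hk, ?_⟩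
  filter_upwards [hkr, hkc.eventually hs.represents,
    hkc.eventually (hα.continuousAt.eventually_ne hα0), eventually_add_smul_mem_cone ha b]
    with ζ h1 h2 h3 h4
  have h2' : Represents f (s (k ζ)) (F (k ζ)) := h2
  refine h2'.congr_left (ne_zero_of_mem_cone h4) ?_
  rw [div_eq_iff h3] at h1
  simp only [α, β] at h1
  simp only [cross, Prod.fst_add, Prod.snd_add, Prod.smul_fst, Prod.smul_snd, smul_eq_mul]
  linear_combination -h1

/-- The vortex condition in homogeneous coordinates: the zeros of the Wronskian have order divisible
by `n`. -/
theorem DeterminesVortex.dvd_analyticOrderAt_wronskian {n : ℕ} (hn : 0 < n)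
    (hv : DeterminesVortex n f) {a b : ℂ × ℂ} (ha : a ∈ cone C₀) (hab : cross a b ≠ 0)
    {F : ℂ → ℂ × ℂ} (hF : AnalyticAt ℂ F 0)
    (hr : ∀ᶠ ζ : ℂ in 𝓝 0, Represents f (a + ζ • b) (F ζ)) {m : ℕ}
    (hm : analyticOrderAt (wronskian F) 0 = m) : n ∣ m := by
  have hs : LocalRep f (proj C₀ a ha) (fun ζ => a + ζ • b) F :=
    { analytic_s := by fun_prop
      analytic_F := hF
      centre := ⟨by simpa using ha, by simp⟩
      immersive := by rwa [wronskian_add_smul]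
      represents := hr }
  obtain ⟨φ, hφ⟩ := hv _ _ _ hs
  have hF1 : AnalyticAt ℂ (fun ξ => (F ξ).1) 0 := analyticAt_fst.comp hF
  have hF2 : AnalyticAt ℂ (fun ξ => (F ξ).2) 0 := analyticAt_snd.comp hF
  have hW : AnalyticAt ℂ (wronskian F) 0 := (hF1.mul hF2.deriv).sub (hF2.mul hF1.deriv)
  have hform : ∀ C, Continuous (form C) := fun C => (contDiff_form C).continuous
  refine dvd_of_eventually_eq_pow_mul (φ := φ)
    (q := fun ζ => cross a b * form C₂ (F ζ) / form C₀ (a + ζ • b)) hn hW hm ?_ ?_ ?_ ?_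
  · filter_upwards [hφ] with ζ h using h.1.continuousAt
  · filter_upwards [hF.eventually_analyticAt, eventually_add_smul_mem_cone ha b] with ζ h1 h2
    have h3 : (form C₀ (a + ζ • b) : ℂ) ≠ 0 := by exact_mod_cast (ne_of_gt h2)
    refine ContinuousAt.div ?_ ?_ h3
    · exact continuousAt_const.mul (Complex.continuous_ofReal.continuousAt.comp
        ((hform C₂).continuousAt.comp h1.continuousAt))
    · have : Continuous fun ζ : ℂ => (form C₀ (a + ζ • b) : ℂ) :=
        Complex.continuous_ofReal.comp ((hform C₀).comp (by fun_prop))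
      exact this.continuousAt
  · have h1 : (form C₂ (F 0) : ℂ) ≠ 0 := by exact_mod_cast (ne_of_gt hr.self_of_nhds.2.1)
    have h2 : (form C₀ (a + (0 : ℂ) • b) : ℂ) ≠ 0 := by
      have h3 : 0 < form C₀ (a + (0 : ℂ) • b) := hr.self_of_nhds.1
      exact_mod_cast h3.ne'
    exact div_ne_zero (mul_ne_zero hab h1) h2
  · filter_upwards [hφ, hr] with ζ h1 h2
    have h3 : (form C₂ (F ζ) : ℂ) ≠ 0 := by exact_mod_cast (ne_of_gt h2.2.1)
    have h4 : (form C₀ (a + ζ • b) : ℂ) ≠ 0 := by exact_mod_cast (ne_of_gt h2.1)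
    have h5 := h1.2
    rw [coframe, coframe, wronskian_add_smul] at h5
    field_simp at h5 ⊢
    linear_combination h5

/-- Homogeneous coordinates `S = (P, Q)` of a vortex on the whole cone, together with an `n`-th root
`g` of their Wronskian, give a lift: normalise `S` to a map between the group manifolds. -/
theorem exists_isLift_of_represents {n : ℕ} (hn : 0 < n) {S : ℂ × ℂ → ℂ × ℂ} {g : ℂ × ℂ → ℂ}
    (hS : AnalyticOnNhd ℂ S (cone C₀)) (hg : AnalyticOnNhd ℂ g (cone C₀))
    (hr : ∀ z ∈ cone C₀, Represents f z (S z))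
    (hW : ∀ z ∈ cone C₀, ∀ v, cross (S z) (fderiv ℂ S z v) = g z ^ n * cross z v) :
    ∃ U Φ A, IsLift n f U Φ A := by
  have hn' : (n : ℝ) ≠ 0 := by exact_mod_cast hn.ne'
  have hSc : ∀ z ∈ cone C₀, ContDiffAt ℝ ∞ S z := fun z hz =>
    (hS z hz).contDiffAt.restrict_scalars ℝ
  have hgc : ∀ z ∈ cone C₀, ContDiffAt ℝ ∞ g z := fun z hz =>
    (hg z hz).contDiffAt.restrict_scalars ℝ
  have hcone : ∀ z ∈ cone C₀, S z ∈ cone C₂ := fun z hz => (hr z hz).2.1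
  let U : ℂ × ℂ → ℂ × ℂ := fun z => retract C₂ (S z)
  let ρ : ℂ × ℂ → ℝ := fun z => form C₂ (S z)
  have hρc : ∀ z ∈ cone C₀, ContDiffAt ℝ ∞ ρ z := fun z hz =>
    (contDiff_form C₂).contDiffAt.comp z (hSc z hz)
  have hρ0 : ∀ z ∈ cone C₀, 0 < ρ z := fun z hz => hcone z hz
  let Φ : ℂ × ℂ → ℂ := fun z => g z * ((ρ z ^ (-(1 / n : ℝ)) : ℝ) : ℂ)
  have hUc : ∀ z ∈ cone C₀, ContDiffAt ℝ ∞ U z := fun z hz =>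
    (contDiffAt_retract (hcone z hz)).comp z (hSc z hz)
  let A : ℂ × ℂ → ℂ × ℂ →L[ℝ] ℝ := fun z =>
    (n : ℝ)⁻¹ • ((sigma0 C₂ (U z)).comp (fderiv ℝ U z) - sigma0 C₀ z)
  refine ⟨U, Φ, A, fun z hz => (hUc z hz).contDiffWithinAt, fun z hz => ?_, fun z hz => ?_,
    fun h hh => ?_, fun h hh v hv => ?_, fun h hh v hv => ?_⟩
  · refine ContDiffAt.contDiffWithinAt ((hgc z hz).mul ?_)
    exact Complex.ofRealCLM.contDiff.contDiffAt.comp z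
      ((hρc z hz).rpow_const_of_ne (hρ0 z hz).ne')
  · refine ContDiffAt.contDiffWithinAt (ContDiffAt.const_smul _ (ContDiffAt.sub ?_ ?_))
    · exact ((contDiff_sigma0 C₂).contDiffAt.comp z (hUc z hz)).clm_comp
        ((hUc z hz).fderiv_right (m := ∞) (by norm_cast))
    · exact (contDiff_sigma0 C₀).contDiffAt
  · have hc := group_subset_cone C₀ hh
    refine ⟨retract_mem_group (hcone h hc), ?_⟩
    have hU0 : U h ≠ 0 := ne_zero_of_mem_cone
      (group_subset_cone C₂ (retract_mem_group (hcone h hc)))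
    obtain ⟨hz, hw, e⟩ := (hr h hc).congr_right hU0 (by
      simp only [U, retract, cross, Prod.smul_fst, Prod.smul_snd, Complex.real_smul]
      ring)
    exact e.symm
  · have hc := group_subset_cone C₀ hh
    have h1 : HasFDerivAt S (fderiv ℝ S h) h :=
      ((hSc h hc).differentiableAt (by simp)).hasFDerivAt
    have h2 : ContDiffAt ℝ ∞ (fun z => (Real.sqrt (ρ z))⁻¹) h :=
      ((hρc h hc).sqrt (hρ0 h hc).ne').inv (Real.sqrt_pos.2 (hρ0 h hc)).ne'
    have h3 : HasFDerivAt U _ h := ((h2.differentiableAt (by simp)).hasFDerivAt).smul h1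
    have h4 : fderiv ℝ S h v = fderiv ℂ S h v := by
      rw [(hS h hc).differentiableAt.fderiv_restrictScalars ℝ]
      rfl
    have h5 := hW h hc v
    have h6 : (ρ h : ℂ) ≠ 0 := by exact_mod_cast (hρ0 h hc).ne'
    have h7 : (((ρ h ^ (-(1 / n : ℝ)) : ℝ) : ℂ)) ^ n = (ρ h : ℂ)⁻¹ := by
      rw [← Complex.ofReal_pow, ← Real.rpow_natCast, ← Real.rpow_mul (hρ0 h hc).le]
      rw [show -(1 / n : ℝ) * n = -1 by field_simp, Real.rpow_neg_one]
      push_cast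
      rfl
    have h8 : ((Real.sqrt (ρ h))⁻¹ : ℂ) * ((Real.sqrt (ρ h))⁻¹ : ℂ) = (ρ h : ℂ)⁻¹ := by
      rw [← mul_inv, ← Complex.ofReal_mul, Real.mul_self_sqrt (hρ0 h hc).le]
    rw [h3.fderiv]
    simp only [Φ, mul_pow, h7]
    simp only [add_apply, smul_apply, ContinuousLinearMap.smulRight_apply, h4]
    rw [cross] at h5
    simp only [sigma, U, retract, Prod.smul_fst, Prod.smul_snd, Prod.fst_add, Prod.snd_add,
      Complex.real_smul, cross] at h5 ⊢
    push_cast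
    linear_combination (-2 * Complex.I * (ρ h : ℂ)⁻¹) * h5 - 2 * Complex.I *
      ((S h).1 * (fderiv ℂ S h v).2 - (S h).2 * (fderiv ℂ S h v).1) * h8
  · simp only [A, smul_apply, sub_apply, ContinuousLinearMap.comp_apply, smul_eq_mul]
    field_simp

end Represents

section Chart

open Filter Topology

variable {C₀ C₂ : ℝ} {f : Surface C₀ → Surface C₂}

theorem Represents.fst_eq_zero_iff {z w w' : ℂ × ℂ} (h : Represents f z w)
    (h' : Represents f z w') : w.1 = 0 ↔ w'.1 = 0 := by
  have key : ∀ {u u' : ℂ × ℂ}, Represents f z u → Represents f z u' → u.1 = 0 → u'.1 = 0 := by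
    intro u u' hu hu' h0
    have hc := hu.cross_eq_zero hu'
    have h2 : u.2 ≠ 0 := fun h2 => hu.ne_zero (Prod.ext h0 h2)
    rw [cross, h0, zero_mul, zero_sub, neg_eq_zero] at hc
    exact (mul_eq_zero.1 hc).resolve_left h2
  exact ⟨key h h', key h' h⟩

/-- Holomorphic homogeneous coordinates near a point of the affine chart `ζ ↦ [1 : ζ]`. -/
theorem IsHolomorphicMap.exists_represents_chart (hf : IsHolomorphicMap f) {p : ℂ}
    (hp : ((1, p) : ℂ × ℂ) ∈ cone C₀) :
    ∃ F : ℂ → ℂ × ℂ, AnalyticAt ℂ F p ∧ ∀ᶠ z in 𝓝 p, Represents f (1, z) (F z) := by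
  obtain ⟨F, hF, hr⟩ := hf.exists_represents_line hp (b := (0, 1)) (by simp [cross])
  have ht : Tendsto (fun z => z - p) (𝓝 p) (𝓝 0) := by
    have : Continuous fun z : ℂ => z - p := by fun_prop
    simpa using this.tendsto p
  refine ⟨fun z => F (z - p), ?_, ?_⟩
  · have h1 : AnalyticAt ℂ (fun z : ℂ => z - p) p := by fun_prop
    exact AnalyticAt.comp (f := fun z : ℂ => z - p) (by simpa using hF) h1
  · filter_upwards [ht.eventually hr] with z hz
    simpa using hz

/-- Either `f` is constantly `[0 : 1]` in the chart, or the poles of `f` form a locally finite set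
with multiplicities `m`. Then any function `P` with zeros of orders `m` is the first component of
holomorphic homogeneous coordinates of `f`. -/
theorem IsHolomorphicMap.exists_orders (hf : IsHolomorphicMap f) {D : Set ℂ} (hD : IsOpen D)
    (hDc : IsPreconnected D) (hDC : ∀ z ∈ D, ((1, z) : ℂ × ℂ) ∈ cone C₀) :
    (∀ z ∈ D, Represents f (1, z) (0, 1)) ∨
    ∃ m : ℂ → ℕ, (∀ z ∈ D, ∀ w, Represents f (1, z) w → w.1 ≠ 0 → m z = 0) ∧
      (∀ p ∈ D, ∀ᶠ z in 𝓝[≠] p, ∃ w, Represents f (1, z) w ∧ w.1 ≠ 0) ∧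
      ∀ P : ℂ → ℂ, DifferentiableOn ℂ P D → (∀ p ∈ D, analyticOrderAt P p = m p) →
        ∃ Q : ℂ → ℂ, DifferentiableOn ℂ Q D ∧ ∀ z ∈ D, Represents f (1, z) (P z, Q z) := by
  have hloc : ∀ p, ∃ F : ℂ → ℂ × ℂ, p ∈ D → AnalyticAt ℂ F p ∧
      ∀ᶠ z in 𝓝 p, Represents f (1, z) (F z) := by
    intro p
    by_cases hp : p ∈ D
    · obtain ⟨F, hF⟩ := hf.exists_represents_chart (hDC p hp)
      exact ⟨F, fun _ => hF⟩
    · exact ⟨0, fun h => (hp h).elim⟩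
  choose F hF using hloc
  let F₁ : ℂ → ℂ → ℂ := fun p z => (F p z).1
  have hF₁ : ∀ p ∈ D, AnalyticAt ℂ (F₁ p) p := fun p hp => analyticAt_fst.comp (hF p hp).1
  have hF₂ : ∀ p ∈ D, AnalyticAt ℂ (fun z => (F p z).2) p := fun p hp =>
    analyticAt_snd.comp (hF p hp).1
  -- Off its centre, a local first component of finite order does not vanish.
  have hfin : ∀ p ∈ D, analyticOrderAt (F₁ p) p ≠ ⊤ →
      ∀ᶠ z in 𝓝[≠] p, F₁ p z ≠ 0 ∧ F₁ z z ≠ 0 ∧ z ∈ D := by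
    intro p hp hpt
    filter_upwards [eventually_ne_zero_of_analyticOrderAt_ne_top (hF₁ p hp) hpt,
      nhdsWithin_le_nhds (hF p hp).2, nhdsWithin_le_nhds (hD.mem_nhds hp)] with z h1 h2 h3
    exact ⟨h1, fun h => h1 ((h2.fst_eq_zero_iff (hF z h3).2.self_of_nhds).2 h), h3⟩
  have hconn : ∀ p ∈ D, ∀ q ∈ D,
      (analyticOrderAt (F₁ p) p = ⊤ ↔ analyticOrderAt (F₁ q) q = ⊤) := by
    intro p hp q hq
    refine hDc.induction₂ (fun p q => analyticOrderAt (F₁ p) p = ⊤ ↔ analyticOrderAt (F₁ q) q = ⊤)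
      (fun p hp => ?_) (fun _ _ _ _ _ _ h h' => h.trans h') (fun _ _ _ _ h => h.symm) hp hq
    refine nhdsWithin_le_nhds ?_
    by_cases hpt : analyticOrderAt (F₁ p) p = ⊤
    · filter_upwards [(analyticOrderAt_eq_top.1 hpt).eventually_nhds,
        (hF p hp).2.eventually_nhds, hD.mem_nhds hp] with q h1 h2 h3
      simp only [hpt, true_iff]
      refine analyticOrderAt_eq_top.2 ?_
      filter_upwards [h1, h2, (hF q h3).2] with z h4 h5 h6
      exact (h5.fst_eq_zero_iff h6).1 h4
    · have h1 := hfin p hp hpt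
      rw [eventually_nhdsWithin_iff] at h1
      filter_upwards [h1] with q hq
      by_cases hqp : q = p
      · rw [hqp]
      · have h2 := hq hqp
        have h3 : analyticOrderAt (F₁ q) q = 0 := analyticOrderAt_eq_zero.2 (Or.inr h2.2.1)
        simp [hpt, h3]
  by_cases htop : ∃ p ∈ D, analyticOrderAt (F₁ p) p = ⊤
  · left
    obtain ⟨p, hp, hpt⟩ := htop
    intro z hz
    have h1 := (analyticOrderAt_eq_top.1 ((hconn p hp z hz).1 hpt)).self_of_nhds
    have h2 := (hF z hz).2.self_of_nhds
    refine h2.congr_right (by simp) ?_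
    have h1' : (F z z).1 = 0 := h1
    simp [cross, h1']
  · right
    push Not at htop
    refine ⟨fun p => analyticOrderNatAt (F₁ p) p, fun z hz w hw hw0 => ?_, fun p hp => ?_,
      fun P hP hPm => ?_⟩
    · have h1 : F₁ z z ≠ 0 := fun h => hw0
        (((hF z hz).2.self_of_nhds.fst_eq_zero_iff hw).1 h)
      have h3 : analyticOrderAt (F₁ z) z = 0 := analyticOrderAt_eq_zero.2 (Or.inr h1)
      simp [analyticOrderNatAt, h3]
    · filter_upwards [hfin p hp (htop p hp)] with z hz
      exact ⟨F z z, (hF z hz.2.2).2.self_of_nhds, hz.2.1⟩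
    · have hPa : AnalyticOnNhd ℂ P D := hP.analyticOnNhd hD
      have hunit : ∀ p, ∃ v : ℂ → ℂ, p ∈ D →
          AnalyticAt ℂ v p ∧ v p ≠ 0 ∧ P =ᶠ[𝓝 p] fun z => v z * F₁ p z := by
        intro p
        by_cases hp : p ∈ D
        · obtain ⟨v, hv⟩ := exists_eventuallyEq_mul_of_analyticOrderAt_eq (hF₁ p hp) (hPa p hp)
            (Nat.cast_analyticOrderNatAt (htop p hp)).symm (hPm p hp)
          exact ⟨v, fun _ => hv⟩
        · exact ⟨0, fun h => (hp h).elim⟩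
      choose v hv using hunit
      let Q : ℂ → ℂ → ℂ := fun p z => v p z * (F p z).2
      have hrep : ∀ p ∈ D, ∀ᶠ z in 𝓝 p, Represents f (1, z) (P z, Q p z) := by
        intro p hp
        obtain ⟨hv1, hv2, hv3⟩ := hv p hp
        filter_upwards [(hF p hp).2, hv3, hv1.continuousAt.eventually_ne hv2] with z h1 h2 h3
        have h4 : (P z, Q p z) = v p z • F p z := Prod.ext h2 rfl
        rw [h4]
        refine h1.congr_right (smul_ne_zero h3 h1.ne_zero) ?_
        simp [cross]
        ring
      have hglue : ∀ p ∈ D, (fun z => Q z z) =ᶠ[𝓝 p] Q p := by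
        intro p hp
        refine eventuallyEq_of_forall_punctured ?_
        filter_upwards [hfin p hp (htop p hp), nhdsWithin_le_nhds (hrep p hp)] with z h1 h2
        have h3 := (hrep z h1.2.2).self_of_nhds
        have hz := hv z h1.2.2
        have hP0 : P z ≠ 0 := by
          rw [hz.2.2.self_of_nhds]
          exact mul_ne_zero hz.2.1 h1.2.1
        have h4 := h3.cross_eq_zero h2
        simp only [cross] at h4
        exact (mul_left_cancel₀ hP0 (by linear_combination h4)).symm
      refine ⟨fun z => Q z z, fun p hp => ?_, fun z hz => (hrep z hz).self_of_nhds⟩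
      have h1 : AnalyticAt ℂ (Q p) p := (hv p hp).1.mul (hF₂ p hp)
      exact ((hglue p hp).differentiableAt_iff.2 h1.differentiableAt).differentiableWithinAt

/-- The Wronskian of the homogenisations `z₁ᵈ P(z₂/z₁)`, `z₁ᵈ Q(z₂/z₁)`. -/
theorem cross_fderiv_homogenize {d : ℕ} {P Q : ℂ → ℂ} {z : ℂ × ℂ} (hz : z.1 ≠ 0)
    (hP : DifferentiableAt ℂ P (z.2 / z.1)) (hQ : DifferentiableAt ℂ Q (z.2 / z.1))
    {S : ℂ × ℂ → ℂ × ℂ}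
    (hS : S =ᶠ[𝓝 z] fun y => (y.1 ^ d * P (y.2 / y.1), y.1 ^ d * Q (y.2 / y.1))) (v : ℂ × ℂ) :
    z.1 ^ 2 * cross (S z) (fderiv ℂ S z v) =
      z.1 ^ (2 * d) * wronskian (fun ζ => (P ζ, Q ζ)) (z.2 / z.1) * cross z v := by
  have h1 : HasFDerivAt (fun y : ℂ × ℂ => y.1) (ContinuousLinearMap.fst ℂ ℂ ℂ) z := hasFDerivAt_fst
  have h2 : HasFDerivAt (fun y : ℂ × ℂ => y.2) (ContinuousLinearMap.snd ℂ ℂ ℂ) z := hasFDerivAt_snd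
  have h3 := h2.mul ((hasDerivAt_inv hz).comp_hasFDerivAt z h1)
  have h3' : HasFDerivAt (fun y : ℂ × ℂ => y.2 / y.1) _ z := h3
  have hPc := (h1.pow d).mul (hP.hasDerivAt.comp_hasFDerivAt z h3')
  have hQc := (h1.pow d).mul (hQ.hasDerivAt.comp_hasFDerivAt z h3')
  have hSd : HasFDerivAt
      (fun y : ℂ × ℂ => (y.1 ^ d * P (y.2 / y.1), y.1 ^ d * Q (y.2 / y.1))) _ z :=
    hPc.prodMk hQc
  rw [hS.fderiv_eq, hSd.fderiv, hS.self_of_nhds]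
  simp only [cross, wronskian, ContinuousLinearMap.prod_apply, add_apply, smul_apply, smul_eq_mul,
    ContinuousLinearMap.coe_fst', ContinuousLinearMap.coe_snd', Function.comp_apply]
  generalize deriv P (z.2 / z.1) = P'
  generalize deriv Q (z.2 / z.1) = Q'
  generalize P (z.2 / z.1) = p
  generalize Q (z.2 / z.1) = q
  field_simp
  ring

end Chart

/-! ### Existence of lifts from the disc -/

section Disc

open Filter Topology Metric

variable {C₀ C₂ : ℝ}

theorem analyticAt_quotient {z : ℂ × ℂ} (hz : z.1 ≠ 0) :
    AnalyticAt ℂ (fun y : ℂ × ℂ => y.2 / y.1) z :=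
  analyticAt_snd.div analyticAt_fst hz

/-- A constant map lifts to a constant map with `Φ = 0`. -/
theorem exists_isLift_of_represents_const {n : ℕ} (hn : 0 < n) {f : Surface C₀ → Surface C₂}
    {w : ℂ × ℂ} (hr : ∀ z ∈ cone C₀, Represents f z w) : ∃ U Φ A, IsLift n f U Φ A := by
  refine exists_isLift_of_represents hn (S := fun _ => w) (g := fun _ => 0)
    (fun _ _ => analyticAt_const) (fun _ _ => analyticAt_const) hr fun z _ v => ?_
  simp [cross, hn.ne']

theorem wronskian_add {P Q : ℂ → ℂ} (p ζ : ℂ) :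
    wronskian (fun ξ => (P (p + ξ), Q (p + ξ))) ζ = wronskian (fun ξ => (P ξ, Q ξ)) (p + ζ) := by
  simp only [wronskian]
  rw [deriv_comp_const_add, deriv_comp_const_add]

/-- The vortex condition in the affine chart. -/
theorem DeterminesVortex.dvd_analyticOrderAt_chart {n : ℕ} (hn : 0 < n)
    {f : Surface C₀ → Surface C₂} (hv : DeterminesVortex n f) {P Q : ℂ → ℂ} {p : ℂ}
    (hp : ((1, p) : ℂ × ℂ) ∈ cone C₀) (hP : AnalyticAt ℂ P p) (hQ : AnalyticAt ℂ Q p)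
    (hr : ∀ᶠ z in 𝓝 p, Represents f (1, z) (P z, Q z)) {m : ℕ}
    (hm : analyticOrderAt (wronskian fun ξ => (P ξ, Q ξ)) p = m) : n ∣ m := by
  have ht : AnalyticAt ℂ (fun ζ : ℂ => p + ζ) 0 := by fun_prop
  have htc : Tendsto (fun ζ : ℂ => p + ζ) (𝓝 0) (𝓝 p) := by
    simpa using ht.continuousAt.tendsto
  have hP' : AnalyticAt ℂ (fun ζ => P (p + ζ)) 0 :=
    AnalyticAt.comp (f := fun ζ : ℂ => p + ζ) (by simpa using hP) ht
  have hQ' : AnalyticAt ℂ (fun ζ => Q (p + ζ)) 0 :=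
    AnalyticAt.comp (f := fun ζ : ℂ => p + ζ) (by simpa using hQ) ht
  refine hv.dvd_analyticOrderAt_wronskian hn hp (b := (0, 1)) (by simp [cross])
    (F := fun ζ => (P (p + ζ), Q (p + ζ))) (hP'.prod hQ') ?_ ?_
  · filter_upwards [htc.eventually hr] with ζ h
    simpa using h
  · have h1 : wronskian (fun ζ => (P (p + ζ), Q (p + ζ))) =
        (wronskian fun ξ => (P ξ, Q ξ)) ∘ fun ζ => p + ζ := funext fun ζ => wronskian_add p ζ
    have h2 : deriv (fun ζ : ℂ => p + ζ) 0 ≠ 0 := by simp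
    rw [h1, analyticOrderAt_comp_of_deriv_ne_zero ht h2, add_zero, hm]

/-- On the disc, numerator and denominator of `f` and the `n`-th root of their Wronskian come from
Weierstrass' theorem in the coordinate `z = z₂ / z₁`. -/
theorem exists_isLift_disc {n : ℕ} (hn : 0 < n) {f : Surface (-1) → Surface C₂}
    (hf : IsHolomorphicMap f) (hv : DeterminesVortex n f) : ∃ U Φ A, IsLift n f U Φ A := by
  have hcone : ∀ z : ℂ × ℂ, z ∈ cone (-1) ↔ ‖z.2‖ < ‖z.1‖ := by
    intro z
    have : z ∈ cone (-1) ↔ 0 < ‖z.1‖ ^ 2 + (-1) * ‖z.2‖ ^ 2 := Iff.rfl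
    rw [this, ← sq_lt_sq₀ (norm_nonneg _) (norm_nonneg _)]
    constructor <;> intro h <;> linarith
  have hne : ∀ z ∈ cone (-1), z.1 ≠ 0 := fun z hz h => by
    rw [hcone, h, norm_zero] at hz
    exact (norm_nonneg _).not_gt hz
  have hq : ∀ z ∈ cone (-1), z.2 / z.1 ∈ ball (0 : ℂ) 1 := fun z hz => by
    rw [mem_ball_zero_iff, norm_div, div_lt_one (norm_pos_iff.2 (hne z hz))]
    exact (hcone z).1 hz
  have hchart : ∀ z ∈ ball (0 : ℂ) 1, ((1, z) : ℂ × ℂ) ∈ cone (-1) := fun z hz => by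
    rw [hcone]
    simpa using hz
  have hscale : ∀ z ∈ cone (-1), ∀ w, Represents f (1, z.2 / z.1) w → Represents f z w :=
    fun z hz w h => h.congr_left (ne_zero_of_mem_cone hz) (by
      have := hne z hz
      simp only [cross]
      field_simp
      ring)
  -- The poles of `f` in the disc are the zeros of the denominator `P`.
  rcases hf.exists_orders isOpen_ball (convex_ball (0 : ℂ) 1).isPreconnected hchart with
    hconst | ⟨m, hm, hmloc, hPQ⟩
  · exact exists_isLift_of_represents_const hn fun z hz => hscale z hz _ (hconst _ (hq z hz))
  obtain ⟨P, hP, hPm⟩ := exists_analyticOrderAt_eq (m := m) fun r hr => by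
    refine finite_of_forall_eventually_eq_zero (isCompact_closedBall 0 r) fun p hp => ?_
    have hp1 : p ∈ ball (0 : ℂ) 1 := closedBall_subset_ball hr hp
    filter_upwards [hmloc p hp1, nhdsWithin_le_nhds (isOpen_ball.mem_nhds hp1)]
      with z ⟨w, hw, hw0⟩ hz
    exact hm z hz w hw hw0
  obtain ⟨Q, hQ, hr⟩ := hPQ P hP hPm
  have hPa := analyticOnNhd_ball hP
  have hQa := analyticOnNhd_ball hQ
  let W : ℂ → ℂ := wronskian fun ξ => (P ξ, Q ξ)
  have hWa : AnalyticOnNhd ℂ W (ball 0 1) := fun p hp =>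
    ((hPa p hp).mul (hQa p hp).deriv).sub ((hQa p hp).mul (hPa p hp).deriv)
  obtain ⟨g, hg, hgW⟩ := exists_pow_eq_of_dvd_analyticOrderAt hn hWa.differentiableOn
    fun p hp k hk => hv.dvd_analyticOrderAt_chart hn (hchart p hp) (hPa p hp) (hQa p hp) (by
      filter_upwards [isOpen_ball.mem_nhds hp] with z hz using hr z hz) hk
  have hga := analyticOnNhd_ball hg
  have hcomp : ∀ {h : ℂ → ℂ}, AnalyticOnNhd ℂ h (ball 0 1) → ∀ z ∈ cone (-1),
      AnalyticAt ℂ (fun y : ℂ × ℂ => h (y.2 / y.1)) z := fun hh z hz =>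
    AnalyticAt.comp (f := fun y : ℂ × ℂ => y.2 / y.1) (hh _ (hq z hz))
      (analyticAt_quotient (hne z hz))
  -- Homogeneity of degree one makes the Wronskian homogeneous of degree zero.
  refine exists_isLift_of_represents hn
    (S := fun y => (y.1 ^ 1 * P (y.2 / y.1), y.1 ^ 1 * Q (y.2 / y.1)))
    (g := fun y => g (y.2 / y.1)) (fun z hz => ?_) (hcomp hga) (fun z hz => ?_) fun z hz v => ?_
  · exact ((analyticAt_fst.pow 1).mul (hcomp hPa z hz)).prod
      ((analyticAt_fst.pow 1).mul (hcomp hQa z hz))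
  · have h1 := hscale z hz _ (hr _ (hq z hz))
    have h2 : (z.1 ^ 1 * P (z.2 / z.1), z.1 ^ 1 * Q (z.2 / z.1)) =
        z.1 • (P (z.2 / z.1), Q (z.2 / z.1)) := by simp
    rw [h2]
    refine h1.congr_right (smul_ne_zero (hne z hz) h1.ne_zero) ?_
    simp [cross]
    ring
  · have h1 := cross_fderiv_homogenize (d := 1) (hne z hz)
      (hPa _ (hq z hz)).differentiableAt (hQa _ (hq z hz)).differentiableAt (.refl _ _) v
    rw [mul_one, mul_assoc] at h1
    rw [mul_left_cancel₀ (pow_ne_zero 2 (hne z hz)) h1, hgW _ (hq z hz)]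

end Disc

/-! ### Existence of lifts from the sphere -/

section Sphere

open Filter Topology Metric

variable {C₂ : ℝ}

theorem isBigO_pow_pow {i N : ℕ} (h : i ≤ N) :
    (fun z : ℂ => z ^ i) =O[Bornology.cobounded ℂ] fun z => z ^ N := by
  refine Asymptotics.IsBigO.of_bound 1 ?_
  filter_upwards [(hasBasis_cobounded_norm (E := ℂ)).mem_of_mem (i := 1) trivial] with z hz
  rw [norm_pow, norm_pow, one_mul]
  exact pow_le_pow_right₀ hz h

theorem isBigO_eval (P : Polynomial ℂ) :
    (fun z => P.eval z) =O[Bornology.cobounded ℂ] fun z => z ^ P.natDegree := by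
  simp only [Polynomial.eval_eq_sum_range]
  refine Asymptotics.IsBigO.fun_sum fun i hi => ?_
  exact (isBigO_pow_pow (Nat.lt_succ_iff.1 (Finset.mem_range.1 hi))).const_mul_left _

/-- The homogenisation in degree `d` of a polynomial in `z₂ / z₁`. -/
noncomputable def homogenize (d : ℕ) (P : Polynomial ℂ) (z : ℂ × ℂ) : ℂ :=
  ∑ i ∈ Finset.range (d + 1), P.coeff i * z.2 ^ i * z.1 ^ (d - i)

theorem homogenize_eq {d : ℕ} {P : Polynomial ℂ} (hd : P.natDegree ≤ d) {z : ℂ × ℂ}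
    (hz : z.1 ≠ 0) : homogenize d P z = z.1 ^ d * P.eval (z.2 / z.1) := by
  rw [homogenize, Polynomial.eval_eq_sum_range' (Nat.lt_succ_of_le hd), Finset.mul_sum]
  refine Finset.sum_congr rfl fun i hi => ?_
  have h : z.1 ^ d = z.1 ^ (d - i) * z.1 ^ i := by
    rw [← pow_add, Nat.sub_add_cancel (Nat.lt_succ_iff.1 (Finset.mem_range.1 hi))]
  rw [h, div_pow]
  field_simp

theorem homogenize_of_fst_eq_zero (d : ℕ) (P : Polynomial ℂ) {z : ℂ × ℂ} (hz : z.1 = 0) :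
    homogenize d P z = P.coeff d * z.2 ^ d := by
  rw [homogenize, Finset.sum_range_succ, Finset.sum_eq_zero, hz]
  · simp
  · intro i hi
    have : d - i ≠ 0 := Nat.sub_ne_zero_of_lt (Finset.mem_range.1 hi)
    rw [hz, zero_pow this, mul_zero]

theorem analyticAt_homogenize (d : ℕ) (P : Polynomial ℂ) (z : ℂ × ℂ) :
    AnalyticAt ℂ (homogenize d P) z := by
  unfold homogenize
  exact Finset.analyticAt_fun_sum _ fun i _ =>
    (analyticAt_const.mul (analyticAt_snd.pow i)).mul (analyticAt_fst.pow (d - i))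

theorem mem_cone_one {z : ℂ × ℂ} : z ∈ cone 1 ↔ z ≠ 0 := by
  refine ⟨ne_zero_of_mem_cone, fun h => ?_⟩
  show 0 < ‖z.1‖ ^ 2 + 1 * ‖z.2‖ ^ 2
  by_cases h1 : z.1 = 0
  · have h2 : z.2 ≠ 0 := fun h2 => h (Prod.ext h1 h2)
    have := norm_pos_iff.2 h2
    positivity
  · have := norm_pos_iff.2 h1
    positivity

/-- A holomorphic map from the sphere which is not constantly `[0 : 1]` is given by two homogeneous
polynomials of the same degree without common zeros. -/
theorem IsHolomorphicMap.exists_polynomial {f : Surface 1 → Surface C₂}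
    (hf : IsHolomorphicMap f) : (∀ z ∈ cone 1, Represents f z (0, 1)) ∨
      ∃ (d : ℕ) (P Q : Polynomial ℂ), P.natDegree ≤ d ∧ Q.natDegree ≤ d ∧
        ∀ z ∈ cone 1, Represents f z (homogenize d P z, homogenize d Q z) := by
  have hchart : ∀ z ∈ (Set.univ : Set ℂ), ((1, z) : ℂ × ℂ) ∈ cone 1 := fun z _ =>
    mem_cone_one.2 (by simp)
  have h01 : ((0, 1) : ℂ × ℂ) ∈ cone 1 := mem_cone_one.2 (by simp)
  obtain ⟨G, hG, hGr⟩ := hf.exists_represents_line h01 (b := (1, 0)) (by simp [cross])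
  have hGr' : ∀ᶠ w : ℂ in 𝓝 0, Represents f (w, 1) (G w) := by
    filter_upwards [hGr] with w hw
    simpa using hw
  have hG1 : AnalyticAt ℂ (fun w => (G w).1) 0 := analyticAt_fst.comp hG
  have hG2 : AnalyticAt ℂ (fun w => (G w).2) 0 := analyticAt_snd.comp hG
  have hinf : ∀ z : ℂ × ℂ, z ≠ 0 → z.1 = 0 → ∀ w, Represents f (0, 1) w → Represents f z w :=
    fun z hz hz1 w hw => hw.congr_left hz (by simp [cross, hz1])
  have haff : ∀ z : ℂ × ℂ, z.1 ≠ 0 → ∀ w, Represents f (1, z.2 / z.1) w → Represents f z w :=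
    fun z hz w hw => hw.congr_left (fun h => hz (by rw [h]; rfl)) (by
      simp only [cross]
      field_simp
      ring)
  have hinv' : Tendsto (fun z : ℂ => z⁻¹) (Bornology.cobounded ℂ) (𝓝[≠] 0) :=
    tendsto_inv₀_cobounded'
  -- Homogeneous coordinates of `f` at the two ends of a point near infinity.
  have hflip : ∀ᶠ z in Bornology.cobounded ℂ, z ≠ 0 ∧ Represents f (1, z) (G z⁻¹) := by
    filter_upwards [hinv'.eventually (nhdsWithin_le_nhds hGr'),
      Bornology.eventually_ne_cobounded (0 : ℂ)] with z h1 h2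
    exact ⟨h2, h1.congr_left (by simp) (by simp [cross, h2])⟩
  rcases hf.exists_orders isOpen_univ isPreconnected_univ hchart with hconst | ⟨m, hm, hmloc, hPQ⟩
  · left
    intro z hz
    by_cases hz1 : z.1 = 0
    · refine hinf z (mem_cone_one.1 hz) hz1 _ (hGr'.self_of_nhds.congr_right (by simp) ?_)
      have h1 : ∀ᶠ w : ℂ in 𝓝[≠] 0, (G w).1 = 0 := by
        filter_upwards [nhdsWithin_le_nhds hGr', self_mem_nhdsWithin] with w h1 h2
        have h3 := (haff (w, 1) h2 _ (hconst _ (Set.mem_univ _))).fst_eq_zero_iff h1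
        exact h3.1 rfl
      have h2 : (G 0).1 = 0 := tendsto_nhds_unique (hG1.continuousAt.tendsto.mono_left
        nhdsWithin_le_nhds) (tendsto_const_nhds.congr' (by
          filter_upwards [h1] with w hw using hw.symm))
      simp [cross, h2]
    · exact haff z hz1 _ (hconst _ (Set.mem_univ _))
  right
  -- The poles do not accumulate at infinity.
  have hord : analyticOrderAt (fun w => (G w).1) 0 ≠ ⊤ := by
    intro htop
    have h1 := (hinv'.mono_right nhdsWithin_le_nhds).eventually
      (analyticOrderAt_eq_top.1 htop).eventually_nhds
    obtain ⟨R, -, hR⟩ := (hasBasis_cobounded_norm (E := ℂ)).eventually_iff.1 (hflip.and h1)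
    let p : ℂ := ((|R| + 1 : ℝ) : ℂ)
    have hp : R < ‖p‖ := by
      rw [Complex.norm_real, Real.norm_of_nonneg (by positivity)]
      linarith [le_abs_self R]
    have hnear : ∀ᶠ z in 𝓝[≠] p, R < ‖z‖ := nhdsWithin_le_nhds
      (continuous_norm.continuousAt.eventually_mem (Ioi_mem_nhds hp))
    obtain ⟨z, ⟨w, hw, hw0⟩, hz⟩ := ((hmloc p (Set.mem_univ p)).and hnear).exists
    have h2 := hR (Set.mem_ofPred.2 hz.le)
    exact hw0 ((h2.1.2.fst_eq_zero_iff hw).1 h2.2.self_of_nhds)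
  obtain ⟨u, hu, hu0, hGu⟩ := hG1.analyticOrderAt_eq_natCast.1
    (Nat.cast_analyticOrderNatAt hord).symm
  set l := analyticOrderNatAt (fun w => (G w).1) 0
  have hpole : ∀ᶠ z in Bornology.cobounded ℂ, m z = 0 := by
    filter_upwards [hflip, hinv'.eventually
      (eventually_ne_zero_of_analyticOrderAt_ne_top hG1 hord)] with z h1 h2
    exact hm z (Set.mem_univ z) _ h1.2 h2
  have hfin : {p | m p ≠ 0}.Finite := by
    obtain ⟨R, -, hR⟩ := (hasBasis_cobounded_norm (E := ℂ)).eventually_iff.1 hpole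
    refine (finite_of_forall_eventually_eq_zero (isCompact_closedBall (0 : ℂ) R) (m := m)
      fun p _ => ?_).subset fun p hp => ⟨?_, hp⟩
    · filter_upwards [hmloc p (Set.mem_univ p)] with z ⟨w, hw, hw0⟩
      exact hm z (Set.mem_univ z) w hw hw0
    · rw [mem_closedBall_zero_iff]
      by_contra h
      exact hp (hR (not_le.1 h).le)
  let P : Polynomial ℂ := ∏ q ∈ hfin.toFinset, (Polynomial.X - Polynomial.C q) ^ m q
  have hPe : ∀ z, P.eval z = ∏ q ∈ hfin.toFinset, (z - q) ^ m q := fun z => by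
    simp [P, Polynomial.eval_prod]
  have hP0 : P ≠ 0 := Finset.prod_ne_zero_iff.2 fun q _ =>
    pow_ne_zero _ (Polynomial.X_sub_C_ne_zero q)
  obtain ⟨Q, hQ, hr⟩ := hPQ (fun z => P.eval z) P.differentiable.differentiableOn fun p _ => by
    simp only [hPe]
    refine (analyticOrderAt_prod_sub_pow _ _ _).trans ?_
    split_ifs with h
    · rfl
    · have : m p = 0 := by simpa using h
      simp [this]
  have hr' : ∀ z, Represents f (1, z) (P.eval z, Q z) := fun z => hr z (Set.mem_univ z)
  rw [differentiableOn_univ] at hQ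
  obtain ⟨Q, rfl⟩ : ∃ Q' : Polynomial ℂ, Q = fun z => Q'.eval z := by
    have hgrowth : Q =O[Bornology.cobounded ℂ] fun z => z ^ (P.natDegree + l) := by
      have h1 : (fun z : ℂ => (G z⁻¹).2 / u z⁻¹) =O[Bornology.cobounded ℂ] fun _ => (1 : ℂ) := by
        have h2 : Tendsto (fun w => (G w).2 / u w) (𝓝 0) (𝓝 ((G 0).2 / u 0)) :=
          (hG2.continuousAt.div hu.continuousAt hu0)
        exact (h2.comp (hinv'.mono_right nhdsWithin_le_nhds)).isBigO_one ℂ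
      have h2 := ((isBigO_eval P).mul (Asymptotics.isBigO_refl (fun z : ℂ => z ^ l) _)).mul h1
      refine h2.congr' ?_ (by filter_upwards with z; ring)
      filter_upwards [hflip, hinv'.eventually (nhdsWithin_le_nhds hGu),
        (hinv'.mono_right nhdsWithin_le_nhds).eventually (hu.continuousAt.eventually_ne hu0)]
        with z h3 h4 h5
      have h6 := (hr' z).cross_eq_zero h3.2
      have hz := h3.1
      simp only [cross, h4, sub_zero, smul_eq_mul, inv_pow] at h6
      generalize u z⁻¹ = u' at *
      generalize (G z⁻¹).2 = G' at *
      field_simp at h6 ⊢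
      linear_combination h6
    obtain ⟨Q', hQ'⟩ := exists_polynomial_of_isBigO hQ hgrowth
    exact ⟨Q', funext hQ'⟩
  -- In degree the maximum of both degrees there is no common zero at infinity.
  let d := max P.natDegree Q.natDegree
  have hPd : P.natDegree ≤ d := le_max_left _ _
  have hQd : Q.natDegree ≤ d := le_max_right _ _
  have haff' : ∀ z : ℂ × ℂ, z.1 ≠ 0 →
      Represents f z (homogenize d P z, homogenize d Q z) := by
    intro z hz
    have h1 := haff z hz _ (hr' _)
    have h2 : (homogenize d P z, homogenize d Q z) =
        z.1 ^ d • (P.eval (z.2 / z.1), Q.eval (z.2 / z.1)) := by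
      rw [homogenize_eq hPd hz, homogenize_eq hQd hz]
      rfl
    rw [h2]
    refine h1.congr_right (smul_ne_zero (pow_ne_zero _ hz) h1.ne_zero) ?_
    simp [cross]
    ring
  refine ⟨d, P, Q, hPd, hQd, fun z hz => ?_⟩
  by_cases hz1 : z.1 = 0
  · -- At infinity the coordinates are compared with `G` by continuity.
    have hcoeff : ¬ (P.coeff d = 0 ∧ Q.coeff d = 0) := by
      rintro ⟨h1, h2⟩
      rcases le_total Q.natDegree P.natDegree with h | h
      · have : d = P.natDegree := max_eq_left h
        rw [this, Polynomial.coeff_natDegree, Polynomial.leadingCoeff_eq_zero] at h1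
        exact hP0 h1
      · have hd : d = Q.natDegree := max_eq_right h
        rw [hd, Polynomial.coeff_natDegree, Polynomial.leadingCoeff_eq_zero] at h2
        rw [h2, Polynomial.natDegree_zero] at h
        have hd' : d = P.natDegree := by rw [hd, h2, Polynomial.natDegree_zero]; omega
        rw [hd', Polynomial.coeff_natDegree, Polynomial.leadingCoeff_eq_zero] at h1
        exact hP0 h1
    have hz2 : z.2 ≠ 0 := fun h => mem_cone_one.1 hz (Prod.ext hz1 h)
    have hlim : ∀ P' : Polynomial ℂ, Tendsto (fun w : ℂ => homogenize d P' (w, 1)) (𝓝[≠] 0)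
        (𝓝 (homogenize d P' (0, 1))) := by
      intro P'
      have h1 : ContinuousAt (fun w : ℂ => homogenize d P' (w, 1)) 0 :=
        ContinuousAt.comp (f := fun w : ℂ => (w, (1 : ℂ)))
          (analyticAt_homogenize d P' _).continuousAt (by fun_prop)
      exact h1.tendsto.mono_left nhdsWithin_le_nhds
    have hcross : cross (G 0) (homogenize d P (0, 1), homogenize d Q (0, 1)) = 0 := by
      have h1 : Tendsto (fun w : ℂ => cross (G w) (homogenize d P (w, 1), homogenize d Q (w, 1)))
          (𝓝[≠] 0) (𝓝 (cross (G 0) (homogenize d P (0, 1), homogenize d Q (0, 1)))) :=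
        ((hG1.continuousAt.tendsto.mono_left nhdsWithin_le_nhds).mul (hlim Q)).sub
          ((hG2.continuousAt.tendsto.mono_left nhdsWithin_le_nhds).mul (hlim P))
      refine tendsto_nhds_unique h1 (tendsto_const_nhds.congr' ?_)
      filter_upwards [nhdsWithin_le_nhds hGr', self_mem_nhdsWithin] with w h2 h3
      exact (h2.cross_eq_zero (haff' (w, 1) h3)).symm
    refine hinf z (mem_cone_one.1 hz) hz1 _ (hGr'.self_of_nhds.congr_right ?_ ?_)
    · intro h
      have h1 := congrArg Prod.fst h
      have h2 := congrArg Prod.snd h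
      simp only [homogenize_of_fst_eq_zero d _ hz1, Prod.fst_zero, Prod.snd_zero] at h1 h2
      exact hcoeff ⟨(mul_eq_zero.1 h1).resolve_right (pow_ne_zero _ hz2),
        (mul_eq_zero.1 h2).resolve_right (pow_ne_zero _ hz2)⟩
    · simp only [cross] at hcross ⊢
      rw [homogenize_of_fst_eq_zero d _ rfl, homogenize_of_fst_eq_zero d _ rfl] at hcross
      rw [homogenize_of_fst_eq_zero d _ hz1, homogenize_of_fst_eq_zero d _ hz1]
      simp only [one_pow, mul_one] at hcross
      linear_combination z.2 ^ d * hcross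
  · exact haff' z hz1

end Sphere

section SphereLift

open Filter Topology

variable {C₂ : ℝ}

theorem wronskian_eval (P Q : Polynomial ℂ) (z : ℂ) :
    wronskian (fun ξ => (P.eval ξ, Q.eval ξ)) z =
      (P * Polynomial.derivative Q - Q * Polynomial.derivative P).eval z := by
  simp [wronskian]

/-- A polynomial all of whose roots have multiplicity divisible by `n` is an `n`-th power, in
product form. -/
theorem exists_eval_eq_mul_prod_pow {n : ℕ} {W : Polynomial ℂ} (hW : W ≠ 0)
    (hdvd : ∀ p, ∀ m : ℕ, analyticOrderAt (fun z => W.eval z) p = m → n ∣ m) :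
    ∃ (c : ℂ) (S : Finset ℂ) (k : ℂ → ℕ), c ≠ 0 ∧
      ∀ z, W.eval z = c * ∏ q ∈ S, (z - q) ^ (n * k q) := by
  classical
  have hfac : ∀ z, W.eval z =
      W.leadingCoeff * ∏ q ∈ W.roots.toFinset, (z - q) ^ W.roots.count q := by
    intro z
    rw [(IsAlgClosed.splits W).eval_eq_prod_roots, Finset.prod_multiset_map_count]
  have hlead : W.leadingCoeff ≠ 0 := Polynomial.leadingCoeff_ne_zero.2 hW
  have hn : ∀ q ∈ W.roots.toFinset, n ∣ W.roots.count q := by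
    intro q hq
    refine hdvd q _ ?_
    simp only [hfac]
    have h1 : AnalyticAt ℂ (fun _ : ℂ => W.leadingCoeff) q := analyticAt_const
    have h2 : AnalyticAt ℂ (fun z : ℂ => ∏ q ∈ W.roots.toFinset, (z - q) ^ W.roots.count q) q := by
      fun_prop
    refine (analyticOrderAt_mul h1 h2).trans ?_
    rw [h1.analyticOrderAt_eq_zero.2 hlead, zero_add]
    refine (analyticOrderAt_prod_sub_pow _ (fun q => W.roots.count q) q).trans ?_
    rw [if_pos hq]
  refine ⟨_, W.roots.toFinset, fun q => W.roots.count q / n, hlead, fun z => ?_⟩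
  rw [hfac]
  congr 1
  refine Finset.prod_congr rfl fun q hq => ?_
  rw [Nat.mul_div_cancel' (hn q hq)]

theorem analyticAt_map_homogenize (d : ℕ) (P Q : Polynomial ℂ) (z : ℂ × ℂ) :
    AnalyticAt ℂ (fun y => (homogenize d P y, homogenize d Q y)) z :=
  (analyticAt_homogenize d P z).prod (analyticAt_homogenize d Q z)

theorem cross_fderiv_map_homogenize {d : ℕ} {P Q : Polynomial ℂ} (hP : P.natDegree ≤ d)
    (hQ : Q.natDegree ≤ d) {z : ℂ × ℂ} (hz : z.1 ≠ 0) (v : ℂ × ℂ) :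
    z.1 ^ 2 * cross (homogenize d P z, homogenize d Q z)
        (fderiv ℂ (fun y => (homogenize d P y, homogenize d Q y)) z v) =
      z.1 ^ (2 * d) * (P * Polynomial.derivative Q - Q * Polynomial.derivative P).eval (z.2 / z.1) *
        cross z v := by
  rw [← wronskian_eval]
  refine cross_fderiv_homogenize (P := fun ξ => P.eval ξ) (Q := fun ξ => Q.eval ξ) hz
    P.differentiableAt Q.differentiableAt (S := fun y => (homogenize d P y, homogenize d Q y)) ?_ v
  filter_upwards [continuousAt_fst.eventually_ne hz] with y hy
  rw [homogenize_eq hP hy, homogenize_eq hQ hy]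

/-- On the sphere, `f` is rational of some degree `d`, and the Wronskian is a homogeneous polynomial
of degree `2d - 2`, all of whose zeros, including the one at infinity, have order divisible
by `n`. -/
theorem exists_isLift_sphere {n : ℕ} (hn : 0 < n) {f : Surface 1 → Surface C₂}
    (hf : IsHolomorphicMap f) (hv : DeterminesVortex n f) : ∃ U Φ A, IsLift n f U Φ A := by
  rcases hf.exists_polynomial with hconst | ⟨d, P, Q, hPd, hQd, hr⟩
  · exact exists_isLift_of_represents_const hn hconst
  let S : ℂ × ℂ → ℂ × ℂ := fun y => (homogenize d P y, homogenize d Q y)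
  have hS : ∀ z, AnalyticAt ℂ S z := analyticAt_map_homogenize d P Q
  let W := P * Polynomial.derivative Q - Q * Polynomial.derivative P
  have hcross : ∀ z : ℂ × ℂ, z.1 ≠ 0 → ∀ v, z.1 ^ 2 * cross (S z) (fderiv ℂ S z v) =
      z.1 ^ (2 * d) * W.eval (z.2 / z.1) * cross z v := fun z hz v =>
    cross_fderiv_map_homogenize hPd hQd hz v
  -- An identity for the Wronskian off the line `z₁ = 0` extends by continuity.
  suffices h : ∃ g : ℂ × ℂ → ℂ, (∀ z, AnalyticAt ℂ g z) ∧ ∀ z : ℂ × ℂ, z.1 ≠ 0 → ∀ v,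
      cross (S z) (fderiv ℂ S z v) = g z ^ n * cross z v by
    obtain ⟨g, hg, hgW⟩ := h
    refine exists_isLift_of_represents hn (fun z _ => hS z) (fun z _ => hg z) hr fun z _ v => ?_
    have hSc : Continuous S := continuous_iff_continuousAt.2 fun z => (hS z).continuousAt
    have hgc : Continuous g := continuous_iff_continuousAt.2 fun z => (hg z).continuousAt
    have hS' : Continuous fun z => fderiv ℂ S z v := continuous_iff_continuousAt.2 fun z =>
      (hS z).fderiv.continuousAt.clm_apply continuousAt_const
    have hdense : Dense {z : ℂ × ℂ | z.1 ≠ 0} :=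
      (dense_compl_singleton (0 : ℂ)).preimage isOpenMap_fst
    have hl : Continuous fun z => cross (S z) (fderiv ℂ S z v) := by
      unfold cross
      fun_prop
    have hrr : Continuous fun z => g z ^ n * cross z v := by
      unfold cross
      fun_prop
    exact congrFun (hl.ext_on hdense hrr fun z hz => hgW z hz v) z
  by_cases hW0 : W = 0
  · refine ⟨fun _ => 0, fun _ => analyticAt_const, fun z hz v => ?_⟩
    have h1 := hcross z hz v
    rw [hW0, Polynomial.eval_zero, mul_zero, zero_mul] at h1
    rw [(mul_eq_zero.1 h1).resolve_left (pow_ne_zero 2 hz), zero_pow hn.ne', zero_mul]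
  have hone : ∀ z : ℂ, ((1, z) : ℂ × ℂ) ∈ cone 1 := fun z => mem_cone_one.2 (by simp)
  have h01 : ((0, 1) : ℂ × ℂ) ∈ cone 1 := mem_cone_one.2 (by simp)
  have hS1 : ∀ z, S (1, z) = (P.eval z, Q.eval z) := fun z => by
    simp only [S]
    rw [homogenize_eq hPd one_ne_zero, homogenize_eq hQd one_ne_zero]
    simp
  obtain ⟨c, R, k, hc, hWR⟩ := exists_eval_eq_mul_prod_pow (n := n) hW0 fun p m hm => by
    refine hv.dvd_analyticOrderAt_chart hn (hone p) (P.differentiable.analyticAt p)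
      (Q.differentiable.analyticAt p) ?_ (m := m) ?_
    · filter_upwards with z
      rw [← hS1]
      exact hr _ (hone z)
    · rw [← hm]
      congr 1
      exact funext fun z => wronskian_eval P Q z
  let K := ∑ q ∈ R, k q
  -- The homogenisation of `W` in degree `n K`.
  have hWinv : ∀ z : ℂ × ℂ, z.1 ≠ 0 → z.1 ^ (n * K) * W.eval (z.2 / z.1) =
      c * ∏ q ∈ R, (z.2 - q * z.1) ^ (n * k q) := by
    intro z hz
    have h1 : z.1 ^ (n * K) = ∏ q ∈ R, z.1 ^ (n * k q) := by
      rw [Finset.prod_pow_eq_pow_sum, Finset.mul_sum]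
    rw [hWR, h1, mul_left_comm, ← Finset.prod_mul_distrib]
    congr 1
    refine Finset.prod_congr rfl fun q _ => ?_
    rw [← mul_pow]
    congr 1
    field_simp
  -- The order of the Wronskian at infinity is `2d - 2 - n K`, in the coordinate `w = z₁ / z₂`.
  let F : ℂ → ℂ × ℂ := fun w => S (w, 1)
  have hF : AnalyticAt ℂ F 0 :=
    AnalyticAt.comp (f := fun w : ℂ => (w, (1 : ℂ))) (hS _) (by fun_prop)
  have hFW : ∀ w, wronskian F w = cross (S (w, 1)) (fderiv ℂ S (w, 1) (1, 0)) := by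
    intro w
    have h1 : HasDerivAt (fun w : ℂ => (w, (1 : ℂ))) ((1 : ℂ), (0 : ℂ)) w :=
      (hasDerivAt_id w).prodMk (hasDerivAt_const w 1)
    have h2 : HasDerivAt F (fderiv ℂ S (w, 1) (1, 0)) w :=
      (hS (w, 1)).differentiableAt.hasFDerivAt.comp_hasDerivAt w h1
    have h3 : HasDerivAt (fun ξ => (F ξ).1) (fderiv ℂ S (w, 1) (1, 0)).1 w :=
      (ContinuousLinearMap.fst ℂ ℂ ℂ).hasFDerivAt.comp_hasDerivAt w h2
    have h4 : HasDerivAt (fun ξ => (F ξ).2) (fderiv ℂ S (w, 1) (1, 0)).2 w :=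
      (ContinuousLinearMap.snd ℂ ℂ ℂ).hasFDerivAt.comp_hasDerivAt w h2
    rw [wronskian, h3.deriv, h4.deriv]
    rfl
  have hF1 : AnalyticAt ℂ (fun w => (F w).1) 0 := analyticAt_fst.comp hF
  have hF2 : AnalyticAt ℂ (fun w => (F w).2) 0 := analyticAt_snd.comp hF
  have hFWa : AnalyticAt ℂ (wronskian F) 0 := (hF1.mul hF2.deriv).sub (hF2.mul hF1.deriv)
  let E : ℂ → ℂ := fun w => -c * ∏ q ∈ R, (1 - q * w) ^ (n * k q)
  have hE : AnalyticAt ℂ E 0 := by fun_prop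
  have hE0 : E 0 ≠ 0 := by
    simp only [E, mul_zero, sub_zero, one_pow, Finset.prod_const_one, mul_one]
    exact neg_ne_zero.2 hc
  have hpow : ∀ j : ℕ, AnalyticAt ℂ (fun w : ℂ => w ^ j) 0 := fun j => by fun_prop
  have hpowo : ∀ j : ℕ, analyticOrderAt (fun w : ℂ => w ^ j) 0 = j := fun j => by
    have h1 : (fun w : ℂ => w ^ j) = (fun w : ℂ => w - 0) ^ j := by
      funext w
      simp
    rw [h1]
    exact analyticOrderAt_centeredMonomial
  have hid : (fun w : ℂ => w ^ (2 + n * K)) * wronskian F = (fun w : ℂ => w ^ (2 * d)) * E := by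
    have h1 : ∀ w : ℂ, w ≠ 0 → w ^ (2 + n * K) * wronskian F w = w ^ (2 * d) * E w := by
      intro w hw
      have h2 := hcross (w, 1) hw (1, 0)
      have h3 := hWinv (w, 1) hw
      rw [hFW]
      simp only at h2 h3
      simp only [E, pow_add]
      have h4 : cross (w, 1) (1, 0) = -1 := by simp [cross]
      rw [h4] at h2
      linear_combination w ^ (n * K) * h2 - w ^ (2 * d) * h3
    have hFWc : Continuous (wronskian F) := by
      have : wronskian F = fun w => cross (S (w, 1)) (fderiv ℂ S (w, 1) (1, 0)) := funext hFW
      have hS'' : Continuous (fderiv ℂ S) := continuous_iff_continuousAt.2 fun z =>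
        (hS z).fderiv.continuousAt
      have hSc : Continuous S := continuous_iff_continuousAt.2 fun z => (hS z).continuousAt
      rw [this]
      unfold cross
      fun_prop
    refine Continuous.ext_on (dense_compl_singleton (0 : ℂ)) ((continuous_pow _).mul hFWc)
      ((continuous_pow _).mul ?_) fun w hw => h1 w hw
    simp only [E]
    fun_prop
  have hord : ((2 + n * K : ℕ) : ℕ∞) + analyticOrderAt (wronskian F) 0 = (2 * d : ℕ) := by
    rw [← hpowo (2 + n * K), ← hpowo (2 * d), ← analyticOrderAt_mul (hpow _) hFWa, hid,
      analyticOrderAt_mul (hpow _) hE, hE.analyticOrderAt_eq_zero.2 hE0, add_zero]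
  obtain ⟨m, hm⟩ : ∃ m : ℕ, analyticOrderAt (wronskian F) 0 = m := by
    refine ⟨(analyticOrderAt (wronskian F) 0).toNat, (ENat.natCast_toNat fun htop => ?_).symm⟩
    rw [htop, add_top] at hord
    exact ENat.top_ne_natCast _ hord
  have hFr : ∀ w : ℂ, Represents f ((0, 1) + w • (1, 0)) (F w) := fun w => by
    have : ((0, 1) : ℂ × ℂ) + w • (1, 0) = (w, 1) := by simp
    rw [this]
    exact hr _ (mem_cone_one.2 (by simp))
  obtain ⟨e, rfl⟩ := hv.dvd_analyticOrderAt_wronskian hn h01 (b := (1, 0)) (by simp [cross]) hF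
    (.of_forall hFr) hm
  have hdeg : 2 + n * K + n * e = 2 * d := by
    rw [hm] at hord
    exact_mod_cast hord
  -- The `n`-th root has the zero at infinity with multiplicity `e`.
  obtain ⟨κ, hκ⟩ := IsAlgClosed.exists_pow_nat_eq c hn
  refine ⟨fun z => κ * z.1 ^ e * ∏ q ∈ R, (z.2 - q * z.1) ^ k q, fun z => ?_, fun z hz v => ?_⟩
  · exact (analyticAt_const.mul (analyticAt_fst.pow e)).mul
      (Finset.analyticAt_fun_prod _ fun q _ =>
        (analyticAt_snd.sub (analyticAt_const.mul analyticAt_fst)).pow (k q))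
  · have h1 := hcross z hz v
    have h2 := hWinv z hz
    have h3 : (∏ q ∈ R, (z.2 - q * z.1) ^ k q) ^ n = ∏ q ∈ R, (z.2 - q * z.1) ^ (n * k q) := by
      rw [← Finset.prod_pow]
      refine Finset.prod_congr rfl fun q _ => ?_
      rw [← pow_mul, mul_comm (k q) n]
    rw [← hdeg, pow_add, pow_add] at h1
    apply mul_left_cancel₀ (pow_ne_zero 2 hz)
    rw [h1, mul_pow, mul_pow, h3, hκ, ← pow_mul, mul_comm e n]
    linear_combination z.1 ^ 2 * z.1 ^ (n * e) * cross z v * h2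

end SphereLift
end Vortex

theorem mainTheorem4 (n : ℕ) (hn : 0 < n) (C₀ C₂ : ℝ) (hC₀ : C₀ = 1 ∨ C₀ = -1)
    (hC₂ : C₂ = 1 ∨ C₂ = 0 ∨ C₂ = -1) (f : Vortex.Surface C₀ → Vortex.Surface C₂)
    (hf : Vortex.IsHolomorphicMap f) (hv : Vortex.DeterminesVortex n f) :
    (∃ U Φ A, Vortex.IsLift n f U Φ A) ∧
    ∀ U Φ A, Vortex.IsLift n f U Φ A →
      Vortex.IsVortexConfiguration n C₀ C₂ Φ A ∧
      Vortex.IsVortexMagneticMode n C₀ C₂ (Vortex.spinorH C₀ Φ) (Vortex.gaugeH C₀ A) := by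
  have hsq : C₀ * C₀ = 1 := by rcases hC₀ with rfl | rfl <;> norm_num
  refine ⟨?_, fun U Φ A hl => ⟨hl.isVortexConfiguration hn,
    (hl.isVortexConfiguration hn).isVortexMagneticMode hn hsq⟩⟩
  rcases hC₀ with rfl | rfl
  · exact Vortex.exists_isLift_sphere hn hf hv
  · exact Vortex.exists_isLift_disc hn hf hv
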